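/- Let $-\infty<a<b<\infty$ and $\varepsilon>0$, and let $G=\{G(x),\,x\in[a,b+\varepsilon]\}$ be a mean zero, (jointly) measurable Gaussian process with stationary increments, with increments variance $\sigma^2$, i.e. $E(G(x)-G(y))^2=\sigma^2(|x-y|)$ for all $x,y\in[a,b+\varepsilon]$, where $\sigma^2$ is not identically zero on $[0,b-a+\varepsilon]$. Assume that $\sigma^2$ is concave on $[0,2(b-a)]$, or that for some $r$ with $1<r\le 3/2$ one has $\sigma^2(h)=h^r$ for all $h\in[0,2(b-a)]$. Write $\sigma(h)=\sqrt{\sigma^2(h)}$ and let $\eta$ be a standard normal random variable. Then for every real $p\ge 1$, \[ \lim_{h\downarrow 0}\ \frac{\displaystyle\int_a^b\left|\frac{G(x+h)-G(x)}{\sigma(h)}\right|^p dx-E|\eta|^p\,(b-a)}{\sqrt{\Phi(h)}}\ \stackrel{law}{=}\ N(0,1), \] where $\Phi(h)$ is the variance of the numerator; that is, the quotient converges in law to $N(0,1)$ as $h\downarrow0$. -/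

import Mathlib

open MeasureTheory ProbabilityTheory Set Filter Topology

noncomputable section

namespace GaussianIncrements

variable {Ω : Type*}

/-- The `p`-th power functional of the normalized increments,
`ω ↦ ∫_a^b |(G(x + h) - G(x)) / σ(h)|^p dx`, where `σ(h) = √(σ²(h))`, for a process
`G` indexed by the interval `[a, b + ε]`. For `x ∈ [a, b]` and `0 ≤ h ≤ ε` both `x` and `x + h`
lie in `[a, b + ε]`, and there `IccExtend` returns the values of `G` itself. -/
def powerFunctional {a b ε : ℝ} (hle : a ≤ b + ε) (G : Icc a (b + ε) → Ω → ℝ)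
    (sigmaSq : ℝ → ℝ) (p h : ℝ) (ω : Ω) : ℝ :=
  ∫ x in a..b,
    |(IccExtend hle G (x + h) ω - IccExtend hle G x ω) / √(sigmaSq h)| ^ p

/-- The absolute moment `E|η|^p` of a standard normal random variable `η`. -/
def normalAbsMoment (p : ℝ) : ℝ := ∫ y, |y| ^ p ∂(gaussianReal 0 1)

/-- The numerator `∫_a^b |(G(x + h) - G(x)) / σ(h)|^p dx - E|η|^p (b - a)`. -/
def centeredFunctional {a b ε : ℝ} (hle : a ≤ b + ε) (G : Icc a (b + ε) → Ω → ℝ)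
    (sigmaSq : ℝ → ℝ) (p h : ℝ) (ω : Ω) : ℝ :=
  powerFunctional hle G sigmaSq p h ω - normalAbsMoment p * (b - a)

end GaussianIncrements

end

set_option linter.unusedSectionVars false

/-- A jointly measurable, centred Gaussian field with covariance function `C`, described by the
characteristic functions of its finite linear combinations. -/
structure IsGaussianField {Z Ω : Type*} [MeasurableSpace Z] [MeasurableSpace Ω]
    (Y : Z → Ω → ℝ) (C : Z → Z → ℝ) (μ : Measure Ω) : Prop where
  measurable : Measurable (fun q : Z × Ω => Y q.1 q.2)
  measurable_cov : Measurable (fun q : Z × Z => C q.1 q.2)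
  symm : ∀ z w, C z w = C w z
  integral_cexp : ∀ (ι : Type) [Fintype ι] (z : ι → Z) (a : ι → ℝ),
    ∫ ω, Complex.exp (Complex.I * ((∑ k, a k * Y (z k) ω : ℝ) : ℂ)) ∂μ =
      ((Real.exp (-(∑ k, ∑ l, a k * a l * C (z k) (z l)) / 2) : ℝ) : ℂ)

/-- The random variable `∫ c(z) exp(i Y_z) dν(z)`. -/
noncomputable def expFunctional {Z Ω : Type*} [MeasurableSpace Z] (ν : Measure Z)
    (Y : Z → Ω → ℝ) (c : Z → ℂ) (ω : Ω) : ℂ :=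
  ∫ z, c z * Complex.exp (Complex.I * (Y z ω : ℂ)) ∂ν

lemma norm_cexp_I_mul (x : ℝ) : ‖Complex.exp (Complex.I * (x : ℂ))‖ = 1 := by
  rw [mul_comm]; exact Complex.norm_exp_ofReal_mul_I x

section

variable {Z Ω : Type*} [MeasurableSpace Z] [MeasurableSpace Ω] {Y : Z → Ω → ℝ}
  {C : Z → Z → ℝ} {μ : Measure Ω} [IsProbabilityMeasure μ] {ν : Measure Z} [IsFiniteMeasure ν]

namespace IsGaussianField

lemma measurable_apply (h : IsGaussianField Y C μ) (z : Z) : Measurable (Y z) :=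
  h.measurable.comp measurable_prodMk_left

lemma measurable_cov_left (h : IsGaussianField Y C μ) (z : Z) : Measurable (C z) :=
  h.measurable_cov.comp measurable_prodMk_left

lemma quad_nonneg (h : IsGaussianField Y C μ) {ι : Type} [Fintype ι] (z : ι → Z) (a : ι → ℝ) :
    0 ≤ ∑ k, ∑ l, a k * a l * C (z k) (z l) := by
  have h1 := h.integral_cexp ι z a
  have h2 : ‖∫ ω, Complex.exp (Complex.I * ((∑ k, a k * Y (z k) ω : ℝ) : ℂ)) ∂μ‖ ≤ 1 := by
    have := norm_integral_le_of_norm_le_const (μ := μ) (C := 1)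
      (f := fun ω => Complex.exp (Complex.I * ((∑ k, a k * Y (z k) ω : ℝ) : ℂ)))
      (Eventually.of_forall fun ω => (norm_cexp_I_mul _).le)
    simpa using this
  rw [h1, Complex.norm_real, Real.norm_eq_abs, abs_of_pos (Real.exp_pos _), Real.exp_le_one_iff] at h2
  linarith

lemma integral_cexp_pair (h : IsGaussianField Y C μ) (z w : Z) (a b : ℝ) :
    ∫ ω, Complex.exp (Complex.I * ((a * Y z ω + b * Y w ω : ℝ) : ℂ)) ∂μ =
      ((Real.exp (-(a ^ 2 * C z z + 2 * (a * b) * C z w + b ^ 2 * C w w) / 2) : ℝ) : ℂ) := by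
  have h1 := h.integral_cexp (Fin 2) ![z, w] ![a, b]
  simp only [Fin.sum_univ_two, Matrix.cons_val_zero, Matrix.cons_val_one] at h1
  rw [h1, h.symm w z]
  congr 3
  ring

lemma pair_nonneg (h : IsGaussianField Y C μ) (z w : Z) (a b : ℝ) :
    0 ≤ a ^ 2 * C z z + 2 * (a * b) * C z w + b ^ 2 * C w w := by
  have h1 := h.quad_nonneg ![z, w] ![a, b]
  simp only [Fin.sum_univ_two, Matrix.cons_val_zero, Matrix.cons_val_one] at h1
  rw [h.symm w z] at h1
  linarith

lemma cov_self_nonneg (h : IsGaussianField Y C μ) (z : Z) : 0 ≤ C z z := by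
  have := h.pair_nonneg z z 1 0
  linarith

lemma abs_cov_le (h : IsGaussianField Y C μ) (z w : Z) : |C z w| ≤ (C z z + C w w) / 2 := by
  have h1 := h.pair_nonneg z w 1 1
  have h2 := h.pair_nonneg z w 1 (-1)
  rw [abs_le]; constructor <;> linarith

lemma abs_cov_le_of_le (h : IsGaussianField Y C μ) {K : ℝ} (hK : ∀ z, C z z ≤ K) (z w : Z) :
    |C z w| ≤ K := by
  have := h.abs_cov_le z w
  linarith [hK z, hK w]

lemma integral_cexp_shift (h : IsGaussianField Y C μ) (z₀ : Z) (θ : ℝ) {n : ℕ} (z : Fin n → Z) :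
    ∫ ω, Complex.exp (Complex.I * ((θ * Y z₀ ω : ℝ) : ℂ)) *
        ∏ i, Complex.exp (Complex.I * (Y (z i) ω : ℂ)) ∂μ =
      ((Real.exp (-(θ ^ 2 * C z₀ z₀) / 2) : ℝ) : ℂ) *
        ((∏ i, ((Real.exp (-(θ * C z₀ (z i))) : ℝ) : ℂ)) *
          ∫ ω, ∏ i, Complex.exp (Complex.I * (Y (z i) ω : ℂ)) ∂μ) := by
  have h1 := h.integral_cexp (Option (Fin n)) (fun o => o.elim z₀ z) (fun o => o.elim θ fun _ => 1)
  have h2 := h.integral_cexp (Fin n) z (fun _ => 1)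
  simp only [Fintype.sum_option, Option.elim, one_mul, mul_one] at h1 h2
  have e1 : ∀ ω, Complex.exp (Complex.I * ((θ * Y z₀ ω : ℝ) : ℂ)) *
        ∏ i, Complex.exp (Complex.I * (Y (z i) ω : ℂ)) =
      Complex.exp (Complex.I * ((θ * Y z₀ ω + ∑ i, Y (z i) ω : ℝ) : ℂ)) := by
    intro ω
    rw [← Complex.exp_sum, ← Complex.exp_add]
    push_cast
    rw [mul_add, Finset.mul_sum]
  have e2 : ∀ ω, ∏ i, Complex.exp (Complex.I * (Y (z i) ω : ℂ)) =
      Complex.exp (Complex.I * ((∑ i, Y (z i) ω : ℝ) : ℂ)) := by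
    intro ω
    rw [← Complex.exp_sum]
    push_cast
    rw [Finset.mul_sum]
  simp_rw [e1, e2, h1, h2]
  rw [← Complex.ofReal_prod, ← Complex.ofReal_mul, ← Complex.ofReal_mul, ← Real.exp_sum,
    ← Real.exp_add, ← Real.exp_add]
  congr 2
  have e3 : ∀ i, C (z i) z₀ = C z₀ (z i) := fun i => h.symm _ _
  simp_rw [e3, Finset.sum_add_distrib, Finset.sum_neg_distrib, ← Finset.mul_sum]
  ring

end IsGaussianField

lemma measurable_integrand (hY : Measurable (fun q : Z × Ω => Y q.1 q.2)) {c : Z → ℂ}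
    (hc : Measurable c) : Measurable
      (fun q : Z × Ω => c q.1 * Complex.exp (Complex.I * (Y q.1 q.2 : ℂ))) := by
  fun_prop

lemma measurable_expFunctional (hY : Measurable (fun q : Z × Ω => Y q.1 q.2)) {c : Z → ℂ}
    (hc : Measurable c) : Measurable (expFunctional ν Y c) := by
  have := (measurable_integrand hY hc).stronglyMeasurable.integral_prod_left' (μ := ν)
  exact this.measurable

lemma norm_expFunctional_le {c : Z → ℂ} {K : ℝ} (hK : ∀ z, ‖c z‖ ≤ K) (ω : Ω) :
    ‖expFunctional ν Y c ω‖ ≤ K * ν.real univ := by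
  refine norm_integral_le_of_norm_le_const (Eventually.of_forall fun z => ?_)
  rw [norm_mul, norm_cexp_I_mul, mul_one]; exact hK z

/-- Complex Cameron–Martin formula for products of exponential functionals. -/
lemma IsGaussianField.integral_cexp_mul_prod (h : IsGaussianField Y C μ) (z₀ : Z) (θ : ℝ)
    {K : ℝ} (hK : ∀ z, C z z ≤ K) {n : ℕ} (c : Fin n → Z → ℂ) (hc : ∀ i, Measurable (c i))
    (hb : ∀ i, ∃ B, ∀ z, ‖c i z‖ ≤ B) :
    ∫ ω, Complex.exp (Complex.I * ((θ * Y z₀ ω : ℝ) : ℂ)) * ∏ i, expFunctional ν Y (c i) ω ∂μ =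
      ((Real.exp (-(θ ^ 2 * C z₀ z₀) / 2) : ℝ) : ℂ) *
        ∫ ω, ∏ i, expFunctional ν Y
          (fun z => c i z * ((Real.exp (-(θ * C z₀ z)) : ℝ) : ℂ)) ω ∂μ := by
  choose B hB using hb
  have key : ∀ (f : Ω → ℂ) (d : Fin n → Z → ℂ) (_ : Measurable f) (_ : ∀ ω, ‖f ω‖ ≤ 1)
      (_ : ∀ i, Measurable (d i)) (D : Fin n → ℝ) (_ : ∀ i z, ‖d i z‖ ≤ D i),
      ∫ ω, f ω * ∏ i, expFunctional ν Y (d i) ω ∂μ =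
        ∫ z : Fin n → Z, (∏ i, d i (z i)) *
          ∫ ω, f ω * ∏ i, Complex.exp (Complex.I * (Y (z i) ω : ℂ)) ∂μ
          ∂(Measure.pi fun _ => ν) := by
    intro f d hf hf1 hd D hD
    have hm : Measurable (fun q : Ω × (Fin n → Z) => f q.1 *
        ∏ i, (d i (q.2 i) * Complex.exp (Complex.I * (Y (q.2 i) q.1 : ℂ)))) := by
      refine (hf.comp measurable_fst).mul (Finset.measurable_prod _ fun i _ => ?_)
      have hg : Measurable (fun q : Ω × (Fin n → Z) => (q.2 i, q.1)) := by fun_prop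
      exact (measurable_integrand h.measurable (hd i)).comp hg
    have e1 : ∀ ω, f ω * ∏ i, expFunctional ν Y (d i) ω = ∫ z : Fin n → Z, f ω *
        ∏ i, (d i (z i) * Complex.exp (Complex.I * (Y (z i) ω : ℂ))) ∂(Measure.pi fun _ => ν) := by
      intro ω
      rw [integral_const_mul]
      congr 1
      exact (integral_fintype_prod_eq_prod (𝕜 := ℂ) (μ := fun _ : Fin n => ν)
        (fun i z => d i z * Complex.exp (Complex.I * (Y z ω : ℂ)))).symm
    simp_rw [e1]
    rw [integral_integral_swap]
    · congr 1; ext z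
      rw [← integral_const_mul]
      congr 1; ext ω
      rw [Finset.prod_mul_distrib]; ring
    · refine Integrable.of_bound (C := ∏ i, D i) hm.aestronglyMeasurable
        (Eventually.of_forall fun q => ?_)
      simp only [Function.uncurry, norm_mul, norm_prod, norm_cexp_I_mul, mul_one]
      calc ‖f q.1‖ * ∏ i, ‖d i (q.2 i)‖ ≤ 1 * ∏ i, D i := by
            gcongr with i
            · exact hf1 _
            · exact hD _ _
        _ = _ := one_mul _
  have hsm : Measurable (fun ω => Complex.exp (Complex.I * ((θ * Y z₀ ω : ℝ) : ℂ))) := by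
    have := h.measurable_apply z₀
    fun_prop
  have hcm := h.measurable_cov_left z₀
  have k1 := key _ c hsm (fun ω => (norm_cexp_I_mul _).le) hc B hB
  have k2 := key (fun _ => 1) (fun i z => c i z * ((Real.exp (-(θ * C z₀ z)) : ℝ) : ℂ))
    measurable_const (by simp) (fun i => (hc i).mul (by fun_prop))
    (fun i => B i * Real.exp (|θ| * K)) (fun i z => by
      rw [norm_mul, Complex.norm_real, Real.norm_eq_abs, abs_of_pos (Real.exp_pos _)]
      have : -(θ * C z₀ z) ≤ |θ| * K := by
        refine (neg_le_abs _).trans ?_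
        rw [abs_mul]
        exact mul_le_mul_of_nonneg_left (h.abs_cov_le_of_le hK z₀ z) (abs_nonneg _)
      gcongr
      · exact (norm_nonneg _).trans (hB i z)
      · exact hB i z)
  simp only [one_mul] at k2
  rw [k1, k2, ← integral_const_mul]
  congr 1; ext z
  rw [h.integral_cexp_shift z₀ θ z, Finset.prod_mul_distrib]
  ring

/-- Equality of all moments against bounded weights passes to exponentials. -/
lemma integral_mul_cexp_eq_of_pow {H H' F F' : Ω → ℂ} {B : ℝ} {κ : ℂ}
    (hH : Measurable H) (hH' : Measurable H') (hF : Measurable F) (hF' : Measurable F')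
    (bH : ∀ ω, ‖H ω‖ ≤ B) (bH' : ∀ ω, ‖H' ω‖ ≤ B) (bF : ∀ ω, ‖F ω‖ ≤ B) (bF' : ∀ ω, ‖F' ω‖ ≤ B)
    (hpow : ∀ n : ℕ, ∫ ω, H ω * F ω ^ n ∂μ = κ * ∫ ω, H' ω * F' ω ^ n ∂μ) :
    ∫ ω, H ω * Complex.exp (F ω) ∂μ = κ * ∫ ω, H' ω * Complex.exp (F' ω) ∂μ := by
  have key : ∀ (H F : Ω → ℂ) (_ : Measurable H) (_ : Measurable F) (_ : ∀ ω, ‖H ω‖ ≤ B)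
      (_ : ∀ ω, ‖F ω‖ ≤ B), HasSum (fun n : ℕ => (∫ ω, H ω * F ω ^ n ∂μ) / (n.factorial : ℂ))
        (∫ ω, H ω * Complex.exp (F ω) ∂μ) := by
    intro H F hH hF bH bF
    have bn : ∀ (n : ℕ) ω, ‖H ω * F ω ^ n / (n.factorial : ℂ)‖ ≤ B * (B ^ n / n.factorial) := by
      intro n ω
      rw [norm_div, norm_mul, norm_pow, Complex.norm_natCast, mul_div_assoc]
      have := bH ω
      have hB : 0 ≤ B := (norm_nonneg _).trans this
      gcongr
      exact bF ω
    have hi : ∀ n : ℕ, Integrable (fun ω => H ω * F ω ^ n / (n.factorial : ℂ)) μ := fun n =>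
      Integrable.of_bound (by fun_prop) _ (Eventually.of_forall (bn n))
    have hs := hasSum_integral_of_summable_integral_norm hi (by
      refine Summable.of_nonneg_of_le (fun n => integral_nonneg fun _ => norm_nonneg _)
        (fun n => ?_) ((Real.summable_pow_div_factorial B).mul_left B)
      calc ∫ ω, ‖H ω * F ω ^ n / (n.factorial : ℂ)‖ ∂μ ≤ ∫ _, B * (B ^ n / n.factorial) ∂μ :=
            integral_mono (hi n).norm (integrable_const _) (bn n)
        _ = _ := by simp)
    simp_rw [integral_div] at hs
    suffices e : ∀ ω, ∑' n : ℕ, H ω * F ω ^ n / (n.factorial : ℂ) = H ω * Complex.exp (F ω) by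
      simp_rw [e] at hs
      exact hs
    intro ω
    have := (NormedSpace.expSeries_div_hasSum_exp (F ω)).mul_left (H ω)
    rw [← Complex.exp_eq_exp_ℂ] at this
    simp_rw [← mul_div_assoc] at this
    exact this.tsum_eq
  have h1 := key H F hH hF bH bF
  have h2 := (key H' F' hH' hF' bH' bF').mul_left κ
  have e : (fun n : ℕ => (∫ ω, H ω * F ω ^ n ∂μ) / (n.factorial : ℂ)) =
      fun n => κ * ((∫ ω, H' ω * F' ω ^ n ∂μ) / (n.factorial : ℂ)) := by
    ext n; rw [hpow n]; ring
  rw [e] at h1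
  exact h1.unique h2

end

section

variable {Z Ω : Type*} [MeasurableSpace Z] [MeasurableSpace Ω] {Y : Z → Ω → ℝ}
  {C : Z → Z → ℝ} {μ : Measure Ω} [IsProbabilityMeasure μ] {ν : Measure Z} [IsFiniteMeasure ν]

namespace IsGaussianField

/-- The weight `c` tilted by `exp(-s D)`. -/
noncomputable def tilt {Z : Type*} (D : Z → ℝ) (c : Z → ℂ) (s : ℝ) (z : Z) : ℂ :=
  c z * ((Real.exp (-(s * D z)) : ℝ) : ℂ)

lemma tilt_eq {Z : Type*} (D : Z → ℝ) (c : Z → ℂ) (s : ℝ) :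
    tilt D c s = fun z => c z * ((Real.exp (-(s * D z)) : ℝ) : ℂ) := rfl

lemma measurable_tilt {D : Z → ℝ} {c : Z → ℂ} (hD : Measurable D) (hc : Measurable c) (s : ℝ) :
    Measurable (tilt D c s) := by
  unfold tilt; fun_prop

lemma norm_tilt_le {D : Z → ℝ} {c : Z → ℂ} {B K : ℝ} (hc : ∀ z, ‖c z‖ ≤ B)
    (hD : ∀ z, |D z| ≤ K) (s : ℝ) (z : Z) : ‖tilt D c s z‖ ≤ B * Real.exp (|s| * K) := by
  rw [tilt, norm_mul, Complex.norm_real, Real.norm_eq_abs, abs_of_pos (Real.exp_pos _)]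
  have h1 : -(s * D z) ≤ |s| * K := by
    refine (neg_le_abs _).trans ?_
    rw [abs_mul]
    exact mul_le_mul_of_nonneg_left (hD z) (abs_nonneg _)
  have := (norm_nonneg _).trans (hc z)
  gcongr
  exact hc z

lemma norm_tilt_le_of_abs_le {D : Z → ℝ} {c : Z → ℂ} {B K S : ℝ} (hc : ∀ z, ‖c z‖ ≤ B)
    (hD : ∀ z, |D z| ≤ K) {s : ℝ} (hs : |s| ≤ S) (z : Z) :
    ‖tilt D c s z‖ ≤ B * Real.exp (S * K) := by
  refine (norm_tilt_le hc hD s z).trans ?_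
  have := (norm_nonneg _).trans (hc z)
  have := (abs_nonneg _).trans (hD z)
  gcongr

lemma hasDerivAt_expFunctional_tilt (hY : Measurable (fun q : Z × Ω => Y q.1 q.2)) {D : Z → ℝ}
    {c : Z → ℂ} {B K : ℝ} (hDm : Measurable D) (hcm : Measurable c) (hc : ∀ z, ‖c z‖ ≤ B)
    (hD : ∀ z, |D z| ≤ K) (ω : Ω) (s : ℝ) :
    HasDerivAt (fun s => expFunctional ν Y (tilt D c s) ω)
      (expFunctional ν Y (tilt D (fun z => -((D z : ℂ) * c z)) s) ω) s := by
  have hm : ∀ c' : Z → ℂ, Measurable c' → AEStronglyMeasurable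
      (fun z => c' z * Complex.exp (Complex.I * (Y z ω : ℂ))) ν := fun c' hc' =>
    ((measurable_integrand hY hc').comp measurable_prodMk_right).aestronglyMeasurable
  have hbd : ∀ z, ‖-((D z : ℂ) * c z)‖ ≤ K * B := fun z => by
    rw [norm_neg, norm_mul, Complex.norm_real, Real.norm_eq_abs]
    have := (norm_nonneg _).trans (hc z)
    have := (abs_nonneg _).trans (hD z)
    gcongr
    exacts [hD z, hc z]
  refine (hasDerivAt_integral_of_dominated_loc_of_deriv_le (μ := ν) (s := Metric.ball s 1)
    (bound := fun _ => (K * B) * Real.exp ((|s| + 1) * K))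
    (F := fun s z => tilt D c s z * Complex.exp (Complex.I * (Y z ω : ℂ)))
    (F' := fun s z => tilt D (fun z => -((D z : ℂ) * c z)) s z *
      Complex.exp (Complex.I * (Y z ω : ℂ))) (Metric.ball_mem_nhds s one_pos)
    (Eventually.of_forall fun s => hm _ (measurable_tilt hDm hcm s)) ?_
    (hm _ (measurable_tilt hDm (by fun_prop) s)) ?_ (integrable_const _) ?_).2
  · refine Integrable.of_bound (hm _ (measurable_tilt hDm hcm s)) (B * Real.exp (|s| * K))
      (Eventually.of_forall fun z => ?_)
    rw [norm_mul, norm_cexp_I_mul, mul_one]; exact norm_tilt_le hc hD s z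
  · refine Eventually.of_forall fun z x hx => ?_
    rw [norm_mul, norm_cexp_I_mul, mul_one]
    refine norm_tilt_le_of_abs_le hbd hD ?_ z
    have := abs_sub_abs_le_abs_sub x s
    rw [Metric.mem_ball, Real.dist_eq] at hx
    linarith
  · refine Eventually.of_forall fun z x _ => HasDerivAt.mul_const ?_ _
    have h1 : HasDerivAt (fun s : ℝ => Real.exp (-(s * D z))) (Real.exp (-(x * D z)) * -(1 * D z)) x :=
      ((hasDerivAt_id x).mul_const (D z)).neg.exp
    have h2 := (h1.ofReal_comp).const_mul (c z)
    have h3 : tilt D (fun z => -((D z : ℂ) * c z)) x z =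
        c z * ((Real.exp (-(x * D z)) * -(1 * D z) : ℝ) : ℂ) := by
      simp only [tilt_eq]; push_cast; ring
    rw [h3]
    exact h2

lemma hasDerivAt_integral_cexp_tilt (hY : Measurable (fun q : Z × Ω => Y q.1 q.2)) {D : Z → ℝ}
    {c : Z → ℂ} {B K : ℝ} (hDm : Measurable D) (hcm : Measurable c) (hc : ∀ z, ‖c z‖ ≤ B)
    (hD : ∀ z, |D z| ≤ K) (s : ℝ) :
    HasDerivAt (fun s => ∫ ω, Complex.exp (expFunctional ν Y (tilt D c s) ω) ∂μ)
      (∫ ω, expFunctional ν Y (tilt D (fun z => -((D z : ℂ) * c z)) s) ω *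
        Complex.exp (expFunctional ν Y (tilt D c s) ω) ∂μ) s := by
  have hbd : ∀ z, ‖-((D z : ℂ) * c z)‖ ≤ K * B := fun z => by
    rw [norm_neg, norm_mul, Complex.norm_real, Real.norm_eq_abs]
    have := (norm_nonneg _).trans (hc z)
    have := (abs_nonneg _).trans (hD z)
    gcongr
    exacts [hD z, hc z]
  have hm : ∀ s, Measurable (fun ω => Complex.exp (expFunctional ν Y (tilt D c s) ω)) := fun s =>
    Complex.measurable_exp.comp (measurable_expFunctional hY (measurable_tilt hDm hcm s))
  have hm' : ∀ s, Measurable (expFunctional ν Y (tilt D (fun z => -((D z : ℂ) * c z)) s)) :=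
    fun s => measurable_expFunctional hY (measurable_tilt hDm (by fun_prop) s)
  have hbe : ∀ {S : ℝ} {x : ℝ} (_ : |x| ≤ S) ω,
      ‖Complex.exp (expFunctional ν Y (tilt D c x) ω)‖ ≤
        Real.exp (B * Real.exp (S * K) * ν.real univ) := fun {S x} hx ω => by
    rw [Complex.norm_exp]
    gcongr
    exact (Complex.re_le_norm _).trans
      (norm_expFunctional_le (norm_tilt_le_of_abs_le hc hD hx) ω)
  refine (hasDerivAt_integral_of_dominated_loc_of_deriv_le (μ := μ) (s := Metric.ball s 1)
    (bound := fun _ => (K * B * Real.exp ((|s| + 1) * K) * ν.real univ) *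
      Real.exp (B * Real.exp ((|s| + 1) * K) * ν.real univ))
    (F := fun s ω => Complex.exp (expFunctional ν Y (tilt D c s) ω))
    (F' := fun s ω => expFunctional ν Y (tilt D (fun z => -((D z : ℂ) * c z)) s) ω *
        Complex.exp (expFunctional ν Y (tilt D c s) ω)) (Metric.ball_mem_nhds s one_pos)
    (Eventually.of_forall fun s => (hm s).aestronglyMeasurable) ?_
    ((hm' s).mul (hm s)).aestronglyMeasurable ?_ (integrable_const _) ?_).2
  · exact Integrable.of_bound (hm s).aestronglyMeasurable _
      (Eventually.of_forall fun ω => hbe le_rfl ω)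
  · refine Eventually.of_forall fun ω x hx => ?_
    have hx' : |x| ≤ |s| + 1 := by
      have := abs_sub_abs_le_abs_sub x s
      rw [Metric.mem_ball, Real.dist_eq] at hx
      linarith
    rw [norm_mul]
    have h1 := norm_expFunctional_le (ν := ν) (Y := Y) (norm_tilt_le_of_abs_le hbd hD hx') ω
    exact mul_le_mul h1 (hbe hx' ω) (norm_nonneg _) ((norm_nonneg _).trans h1)
  · refine Eventually.of_forall fun ω x _ => ?_
    have := (hasDerivAt_expFunctional_tilt (ν := ν) hY hDm hcm hc hD ω x).cexp
    rwa [mul_comm] at this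

lemma integral_cexp_mul_cexp (h : IsGaussianField Y C μ) (z₀ : Z) (θ : ℝ)
    {K B : ℝ} (hK : ∀ z, C z z ≤ K) {c : Z → ℂ} (hc : Measurable c) (hB : ∀ z, ‖c z‖ ≤ B) :
    ∫ ω, Complex.exp (Complex.I * ((θ * Y z₀ ω : ℝ) : ℂ)) *
        Complex.exp (expFunctional ν Y c ω) ∂μ =
      ((Real.exp (-(θ ^ 2 * C z₀ z₀) / 2) : ℝ) : ℂ) *
        ∫ ω, Complex.exp (expFunctional ν Y (tilt (C z₀) c θ) ω) ∂μ := by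
  have hm := h.measurable_apply z₀
  have hDm := h.measurable_cov_left z₀
  have htm := measurable_tilt hDm hc θ
  have hft := measurable_expFunctional (ν := ν) h.measurable htm
  have hfc := measurable_expFunctional (ν := ν) h.measurable hc
  have h1 := norm_expFunctional_le (ν := ν) (Y := Y) hB
  have h2 := norm_expFunctional_le (ν := ν) (Y := Y) (norm_tilt_le hB (h.abs_cov_le_of_le hK z₀) θ)
  have key := integral_mul_cexp_eq_of_pow (μ := μ)
    (H := fun ω => Complex.exp (Complex.I * ((θ * Y z₀ ω : ℝ) : ℂ))) (H' := fun _ => 1)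
    (κ := ((Real.exp (-(θ ^ 2 * C z₀ z₀) / 2) : ℝ) : ℂ))
    (B := max 1 (max (B * ν.real univ) (B * Real.exp (|θ| * K) * ν.real univ)))
    (by fun_prop) measurable_const hfc hft
    (fun ω => (norm_cexp_I_mul _).le.trans (le_max_left _ _))
    (fun ω => by simp)
    (fun ω => (h1 ω).trans ((le_max_left _ _).trans (le_max_right _ _)))
    (fun ω => (h2 ω).trans ((le_max_right _ _).trans (le_max_right _ _)))
    (fun n => by
      have := h.integral_cexp_mul_prod (ν := ν) z₀ θ hK (fun _ : Fin n => c) (fun _ => hc)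
        (fun _ => ⟨B, hB⟩)
      simpa [Finset.prod_const, tilt_eq] using this)
  simpa using key

lemma integral_cexp_mul_mul_cexp (h : IsGaussianField Y C μ) (z₀ : Z) (θ : ℝ)
    {K B B' : ℝ} (hK : ∀ z, C z z ≤ K) {b c : Z → ℂ} (hb : Measurable b) (hc : Measurable c)
    (hbB : ∀ z, ‖b z‖ ≤ B') (hB : ∀ z, ‖c z‖ ≤ B) :
    ∫ ω, Complex.exp (Complex.I * ((θ * Y z₀ ω : ℝ) : ℂ)) * expFunctional ν Y b ω *
        Complex.exp (expFunctional ν Y c ω) ∂μ =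
      ((Real.exp (-(θ ^ 2 * C z₀ z₀) / 2) : ℝ) : ℂ) *
        ∫ ω, expFunctional ν Y (tilt (C z₀) b θ) ω *
          Complex.exp (expFunctional ν Y (tilt (C z₀) c θ) ω) ∂μ := by
  have hm := h.measurable_apply z₀
  have hDm := h.measurable_cov_left z₀
  have hD := h.abs_cov_le_of_le hK z₀
  have hft := measurable_expFunctional (ν := ν) h.measurable (measurable_tilt hDm hc θ)
  have hfc := measurable_expFunctional (ν := ν) h.measurable hc
  have hfbt := measurable_expFunctional (ν := ν) h.measurable (measurable_tilt hDm hb θ)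
  have hfb := measurable_expFunctional (ν := ν) h.measurable hb
  have h1 := norm_expFunctional_le (ν := ν) (Y := Y) hB
  have h2 := norm_expFunctional_le (ν := ν) (Y := Y) (norm_tilt_le hB hD θ)
  have h3 := norm_expFunctional_le (ν := ν) (Y := Y) hbB
  have h4 := norm_expFunctional_le (ν := ν) (Y := Y) (norm_tilt_le hbB hD θ)
  refine integral_mul_cexp_eq_of_pow (μ := μ)
    (H := fun ω => Complex.exp (Complex.I * ((θ * Y z₀ ω : ℝ) : ℂ)) * expFunctional ν Y b ω)
    (κ := ((Real.exp (-(θ ^ 2 * C z₀ z₀) / 2) : ℝ) : ℂ))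
    (B := max (max (B' * ν.real univ) (B' * Real.exp (|θ| * K) * ν.real univ))
      (max (B * ν.real univ) (B * Real.exp (|θ| * K) * ν.real univ)))
    (by fun_prop) hfbt hfc hft
    (fun ω => by
      rw [norm_mul, norm_cexp_I_mul, one_mul]
      exact (h3 ω).trans ((le_max_left _ _).trans (le_max_left _ _)))
    (fun ω => (h4 ω).trans ((le_max_right _ _).trans (le_max_left _ _)))
    (fun ω => (h1 ω).trans ((le_max_left _ _).trans (le_max_right _ _)))
    (fun ω => (h2 ω).trans ((le_max_right _ _).trans (le_max_right _ _)))
    (fun n => ?_)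
  have := h.integral_cexp_mul_prod (ν := ν) z₀ θ hK (fun i : Fin (n + 1) => Fin.cases b (fun _ => c) i)
    (fun i => by cases i using Fin.cases <;> simpa)
    (fun i => by
      cases i using Fin.cases
      · exact ⟨B', hbB⟩
      · exact ⟨B, hB⟩)
  simpa [Fin.prod_univ_succ, tilt_eq, mul_assoc] using this

/-- Stein identity for exponentials of functionals of a Gaussian field. -/
lemma stein_identity (h : IsGaussianField Y C μ) (z₀ : Z)
    {K B : ℝ} (hK : ∀ z, C z z ≤ K) {c : Z → ℂ} (hc : Measurable c) (hB : ∀ z, ‖c z‖ ≤ B) :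
    ∫ ω, (Complex.exp (Complex.I * (Y z₀ ω : ℂ)) - ((Real.exp (-(C z₀ z₀) / 2) : ℝ) : ℂ)) *
        Complex.exp (expFunctional ν Y c ω) ∂μ =
      -∫ s in (0 : ℝ)..1, ((Real.exp (-(C z₀ z₀ * (1 - s ^ 2)) / 2) : ℝ) : ℂ) *
        ∫ ω, Complex.exp (Complex.I * ((s * Y z₀ ω : ℝ) : ℂ)) *
          expFunctional ν Y (fun z => (C z₀ z : ℂ) * c z) ω *
          Complex.exp (expFunctional ν Y c ω) ∂μ := by
  have hm := h.measurable_apply z₀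
  have hDm := h.measurable_cov_left z₀
  have hD := h.abs_cov_le_of_le hK z₀
  have hfc := measurable_expFunctional (ν := ν) h.measurable hc
  have h1 := norm_expFunctional_le (ν := ν) (Y := Y) hB
  set Ψ : ℝ → ℂ := fun s => ∫ ω, Complex.exp (expFunctional ν Y (tilt (C z₀) c s) ω) ∂μ with hΨ
  set Ψ' : ℝ → ℂ := fun s => ∫ ω, expFunctional ν Y (tilt (C z₀) (fun z => -((C z₀ z : ℂ) * c z)) s) ω *
        Complex.exp (expFunctional ν Y (tilt (C z₀) c s) ω) ∂μ with hΨ'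
  have hder : ∀ s, HasDerivAt Ψ (Ψ' s) s := fun s =>
    hasDerivAt_integral_cexp_tilt h.measurable hDm hc hB hD s
  have hbd : ∀ z, ‖-((C z₀ z : ℂ) * c z)‖ ≤ K * B := fun z => by
    rw [norm_neg, norm_mul, Complex.norm_real, Real.norm_eq_abs]
    have := (norm_nonneg _).trans (hB z)
    have := (abs_nonneg _).trans (hD z)
    gcongr
    exacts [hD z, hB z]
  have hint : IntervalIntegrable Ψ' volume 0 1 := by
    have e : Ψ' = deriv Ψ := funext fun s => (hder s).deriv.symm
    rw [intervalIntegrable_iff, uIoc_of_le zero_le_one]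
    refine Integrable.of_bound (C := K * B * Real.exp (1 * K) * ν.real univ *
      Real.exp (B * Real.exp (1 * K) * ν.real univ)) ?_ ?_
    · rw [e]; exact (measurable_deriv Ψ).aestronglyMeasurable
    · refine (ae_restrict_iff' measurableSet_Ioc).2 (Eventually.of_forall fun s hs => ?_)
      have hs' : |s| ≤ 1 := by rw [abs_of_pos hs.1]; exact hs.2
      have := norm_integral_le_of_norm_le_const (μ := μ)
        (f := fun ω => expFunctional ν Y (tilt (C z₀) (fun z => -((C z₀ z : ℂ) * c z)) s) ω *
        Complex.exp (expFunctional ν Y (tilt (C z₀) c s) ω))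
        (C := K * B * Real.exp (1 * K) * ν.real univ *
          Real.exp (B * Real.exp (1 * K) * ν.real univ)) (Eventually.of_forall fun ω => by
            rw [norm_mul, Complex.norm_exp]
            have h1 := norm_expFunctional_le (ν := ν) (Y := Y) (norm_tilt_le_of_abs_le hbd hD hs') ω
            refine mul_le_mul h1 ?_ (Real.exp_nonneg _) ((norm_nonneg _).trans h1)
            gcongr
            exact (Complex.re_le_norm _).trans
              (norm_expFunctional_le (norm_tilt_le_of_abs_le hB hD hs') ω))
      simpa using this
  have ftc := intervalIntegral.integral_eq_sub_of_hasDerivAt (fun s _ => hder s) hint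
  have e1 := h.integral_cexp_mul_cexp (ν := ν) z₀ 1 hK hc hB
  have e0 : Ψ 0 = ∫ ω, Complex.exp (expFunctional ν Y c ω) ∂μ := by simp [hΨ, tilt_eq]
  have i1 : Integrable (fun ω => Complex.exp (expFunctional ν Y c ω)) μ := by
    refine Integrable.of_bound (by fun_prop) (Real.exp (B * ν.real univ))
      (Eventually.of_forall fun ω => ?_)
    rw [Complex.norm_exp]
    gcongr
    exact (Complex.re_le_norm _).trans (h1 ω)
  have i2 : Integrable (fun ω => Complex.exp (Complex.I * (Y z₀ ω : ℂ)) *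
      Complex.exp (expFunctional ν Y c ω)) μ := by
    refine i1.bdd_mul (c := 1) (by fun_prop) (Eventually.of_forall fun ω => (norm_cexp_I_mul _).le)
  simp only [one_mul, one_pow] at e1
  simp_rw [sub_mul]
  rw [integral_sub i2 (i1.const_mul _), e1, integral_const_mul, ← e0, ← mul_sub]
  change _ * (Ψ 1 - Ψ 0) = _
  rw [← ftc, ← intervalIntegral.integral_const_mul, ← intervalIntegral.integral_neg]
  congr 1; ext s
  have e2 := h.integral_cexp_mul_mul_cexp (ν := ν) z₀ s hK (b := fun z => -((C z₀ z : ℂ) * c z))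
    (by fun_prop) hc hbd hB
  have e3 : ∀ ω, expFunctional ν Y (fun z => -((C z₀ z : ℂ) * c z)) ω =
      -expFunctional ν Y (fun z => (C z₀ z : ℂ) * c z) ω := by
    intro ω
    simp only [expFunctional, neg_mul, integral_neg]
  simp_rw [e3] at e2
  have e4 : ∫ ω, Complex.exp (Complex.I * ((s * Y z₀ ω : ℝ) : ℂ)) *
          expFunctional ν Y (fun z => (C z₀ z : ℂ) * c z) ω *
          Complex.exp (expFunctional ν Y c ω) ∂μ =
      -(((Real.exp (-(s ^ 2 * C z₀ z₀) / 2) : ℝ) : ℂ) * Ψ' s) := by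
    rw [← e2, ← integral_neg]
    congr 1; ext ω; ring
  rw [e4, mul_neg, neg_neg, ← mul_assoc, ← Complex.ofReal_mul, ← Real.exp_add]
  congr 3
  ring_nf

end IsGaussianField
end

section

variable {Z Ω : Type*} [MeasurableSpace Z] [MeasurableSpace Ω] {μ : Measure Ω}
  [IsProbabilityMeasure μ] {ν : Measure Z} [IsFiniteMeasure ν]

/-- Second moment of an integrated process. -/
lemma integral_sq_integral_eq {H : Z → Ω → ℝ} {M : ℝ}
    (hH : Measurable (fun q : Z × Ω => H q.1 q.2)) (hi : ∀ z, Integrable (fun ω => H z ω ^ 2) μ)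
    (hM : ∀ z, ∫ ω, H z ω ^ 2 ∂μ ≤ M) :
    Integrable (fun ω => (∫ z, H z ω ∂ν) ^ 2) μ ∧
    Integrable (fun q : Z × Z => ∫ ω, H q.1 ω * H q.2 ω ∂μ) (ν.prod ν) ∧
    ∫ ω, (∫ z, H z ω ∂ν) ^ 2 ∂μ = ∫ q : Z × Z, ∫ ω, H q.1 ω * H q.2 ω ∂μ ∂(ν.prod ν) := by
  have hm : Measurable (fun p : (Z × Z) × Ω => H p.1.1 p.2 * H p.1.2 p.2) := by
    have h1 : Measurable (fun p : (Z × Z) × Ω => (p.1.1, p.2)) := by fun_prop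
    have h2 : Measurable (fun p : (Z × Z) × Ω => (p.1.2, p.2)) := by fun_prop
    exact (hH.comp h1).mul (hH.comp h2)
  have hs : ∀ q : Z × Z, Integrable (fun ω => H q.1 ω * H q.2 ω) μ := fun q =>
    (((hi q.1).add (hi q.2))).mono' (hm.comp measurable_prodMk_left).aestronglyMeasurable
      (Eventually.of_forall fun ω => by
        rw [Real.norm_eq_abs, abs_le, Pi.add_apply]
        constructor <;> nlinarith [sq_nonneg (H q.1 ω + H q.2 ω), sq_nonneg (H q.1 ω - H q.2 ω),
          sq_nonneg (H q.1 ω), sq_nonneg (H q.2 ω)])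
  have hI : Integrable (fun p : (Z × Z) × Ω => H p.1.1 p.2 * H p.1.2 p.2) ((ν.prod ν).prod μ) := by
    refine (integrable_prod_iff hm.aestronglyMeasurable).2
      ⟨Eventually.of_forall fun q => hs q, ?_⟩
    refine Integrable.of_bound
      (hm.stronglyMeasurable.norm.integral_prod_right').aestronglyMeasurable (M + M)
      (Eventually.of_forall fun q => ?_)
    rw [Real.norm_of_nonneg (integral_nonneg fun _ => norm_nonneg _)]
    calc ∫ ω, ‖H q.1 ω * H q.2 ω‖ ∂μ ≤ ∫ ω, (H q.1 ω ^ 2 + H q.2 ω ^ 2) ∂μ := by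
          refine integral_mono (hs q).norm ((hi q.1).add (hi q.2)) fun ω => ?_
          simp only [Real.norm_eq_abs, abs_le]
          constructor <;> nlinarith [sq_nonneg (H q.1 ω + H q.2 ω), sq_nonneg (H q.1 ω - H q.2 ω),
            sq_nonneg (H q.1 ω), sq_nonneg (H q.2 ω)]
      _ ≤ M + M := by
          rw [integral_add (hi _) (hi _)]
          exact add_le_add (hM _) (hM _)
  have e : ∀ ω, (∫ z, H z ω ∂ν) ^ 2 = ∫ q : Z × Z, H q.1 ω * H q.2 ω ∂(ν.prod ν) := fun ω => by
    rw [integral_prod_mul (fun z => H z ω) (fun z => H z ω), sq]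
  refine ⟨?_, hI.integral_prod_left, ?_⟩
  · simp_rw [e]; exact hI.integral_prod_right
  · simp_rw [e]
    exact integral_integral_swap (f := fun ω (q : Z × Z) => H q.1 ω * H q.2 ω) hI.swap

lemma abs_cosh_sub_one_le (x : ℝ) : Real.cosh x - 1 ≤ x ^ 2 * Real.exp |x| := by
  have h1 : ∀ y : ℝ, Real.exp y - 1 - y ≤ y ^ 2 * Real.exp |y| := fun y => by
    have h := Complex.norm_exp_sub_sum_le_norm_mul_exp (y : ℂ) 2
    simp only [Finset.sum_range_succ, Finset.range_zero, Finset.sum_empty, pow_zero,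
      Nat.factorial, Nat.cast_one, div_one, zero_add, pow_one, Complex.norm_real, mul_one] at h
    have e : Complex.exp (y : ℂ) - (1 + (y : ℂ)) = ((Real.exp y - 1 - y : ℝ) : ℂ) := by
      push_cast; ring
    rw [e, Complex.norm_real, Real.norm_eq_abs, Real.norm_eq_abs, sq_abs] at h
    exact (le_abs_self _).trans h
  have h2 := h1 x
  have h3 := h1 (-x)
  rw [abs_neg, neg_sq] at h3
  rw [Real.cosh_eq]
  linarith

variable {Y : Z → Ω → ℝ} {C : Z → Z → ℝ}

namespace IsGaussianField

/-- The field of linear combinations `s Y_z + Y_w`. -/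
lemma pair (h : IsGaussianField Y C μ) (s : ℝ) :
    IsGaussianField (fun (q : Z × Z) ω => s * Y q.1 ω + Y q.2 ω)
      (fun q q' => s ^ 2 * C q.1 q'.1 + s * C q.1 q'.2 + s * C q.2 q'.1 + C q.2 q'.2) μ where
  measurable := by
    have h1 : Measurable (fun p : (Z × Z) × Ω => (p.1.1, p.2)) := by fun_prop
    have h2 : Measurable (fun p : (Z × Z) × Ω => (p.1.2, p.2)) := by fun_prop
    exact ((h.measurable.comp h1).const_mul s).add (h.measurable.comp h2)
  measurable_cov := by
    have h1 : Measurable (fun p : (Z × Z) × (Z × Z) => (p.1.1, p.2.1)) := by fun_prop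
    have h2 : Measurable (fun p : (Z × Z) × (Z × Z) => (p.1.1, p.2.2)) := by fun_prop
    have h3 : Measurable (fun p : (Z × Z) × (Z × Z) => (p.1.2, p.2.1)) := by fun_prop
    have h4 : Measurable (fun p : (Z × Z) × (Z × Z) => (p.1.2, p.2.2)) := by fun_prop
    exact (((((h.measurable_cov.comp h1).const_mul _).add
      ((h.measurable_cov.comp h2).const_mul _)).add
      ((h.measurable_cov.comp h3).const_mul _))).add (h.measurable_cov.comp h4)
  symm := fun q q' => by
    rw [h.symm q.1 q'.1, h.symm q.1 q'.2, h.symm q.2 q'.1, h.symm q.2 q'.2]; ring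
  integral_cexp := by
    intro ι _ q a
    have := h.integral_cexp (ι ⊕ ι) (Sum.elim (fun k => (q k).1) (fun k => (q k).2))
      (Sum.elim (fun k => s * a k) a)
    simp only [Fintype.sum_sum_type, Sum.elim_inl, Sum.elim_inr] at this
    rw [show (∫ ω, Complex.exp (Complex.I *
      ((∑ k, a k * (s * Y (q k).1 ω + Y (q k).2 ω) : ℝ) : ℂ)) ∂μ) = ∫ ω, Complex.exp (Complex.I *
      ((∑ k, s * a k * Y (q k).1 ω + ∑ k, a k * Y (q k).2 ω : ℝ) : ℂ)) ∂μ by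
        congr 1; ext ω; congr 3
        rw [← Finset.sum_add_distrib]
        exact Finset.sum_congr rfl fun k _ => by ring, this]
    congr 4
    rw [Finset.sum_add_distrib, Finset.sum_add_distrib]
    simp only [← Finset.sum_add_distrib]
    exact Finset.sum_congr rfl fun k _ => Finset.sum_congr rfl fun l _ => by ring

lemma integral_cos_pair (h : IsGaussianField Y C μ) (z w : Z) (a b : ℝ) :
    ∫ ω, Real.cos (a * Y z ω + b * Y w ω) ∂μ =
      Real.exp (-(a ^ 2 * C z z + 2 * (a * b) * C z w + b ^ 2 * C w w) / 2) := by
  have h1 := h.integral_cexp_pair z w a b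
  have hm := h.measurable_apply z
  have hm' := h.measurable_apply w
  have hi : Integrable (fun ω => Complex.exp (Complex.I * ((a * Y z ω + b * Y w ω : ℝ) : ℂ))) μ :=
    Integrable.of_bound (by fun_prop) 1 (Eventually.of_forall fun ω => (norm_cexp_I_mul _).le)
  have h2 := congrArg Complex.re h1
  rw [Complex.ofReal_re] at h2
  rw [← h2]
  refine Eq.trans ?_ (integral_re (𝕜 := ℂ) hi)
  congr 1; ext ω
  change _ = (Complex.exp _).re
  rw [mul_comm Complex.I, Complex.exp_ofReal_mul_I_re]

lemma integral_cos (h : IsGaussianField Y C μ) (z : Z) :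
    ∫ ω, Real.cos (Y z ω) ∂μ = Real.exp (-(C z z) / 2) := by
  have := h.integral_cos_pair z z 1 0
  simpa using this

lemma integrable_cos (h : IsGaussianField Y C μ) (z : Z) :
    Integrable (fun ω => Real.cos (Y z ω)) μ :=
  Integrable.of_bound (Real.measurable_cos.comp (h.measurable_apply z)).aestronglyMeasurable 1
    (Eventually.of_forall fun _ => Real.abs_cos_le_one _)

lemma integral_cos_mul_cos (h : IsGaussianField Y C μ) (z w : Z) :
    ∫ ω, Real.cos (Y z ω) * Real.cos (Y w ω) ∂μ =
      Real.exp (-(C z z + C w w) / 2) * Real.cosh (C z w) := by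
  have h1 := h.integral_cos_pair z w 1 1
  have h2 := h.integral_cos_pair z w 1 (-1)
  have m1 := h.measurable_apply z
  have m2 := h.measurable_apply w
  have i : ∀ b : ℝ, Integrable (fun ω => Real.cos (1 * Y z ω + b * Y w ω)) μ := fun b =>
    Integrable.of_bound (by fun_prop) 1 (Eventually.of_forall fun ω => Real.abs_cos_le_one _)
  have e : ∀ ω, Real.cos (Y z ω) * Real.cos (Y w ω) =
      (Real.cos (1 * Y z ω + 1 * Y w ω) + Real.cos (1 * Y z ω + (-1) * Y w ω)) / 2 := fun ω => by
    rw [show 1 * Y z ω + (-1) * Y w ω = Y z ω - Y w ω by ring, one_mul, one_mul, Real.cos_add,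
      Real.cos_sub]
    ring
  simp_rw [e]
  rw [integral_div, integral_add (i 1) (i (-1)), h1, h2, Real.cosh_eq, ← mul_div_assoc, mul_add,
    ← Real.exp_add, ← Real.exp_add]
  ring_nf

lemma integral_centered_cos_mul (h : IsGaussianField Y C μ) (z w : Z) :
    ∫ ω, (Real.cos (Y z ω) - Real.exp (-(C z z) / 2)) *
      (Real.cos (Y w ω) - Real.exp (-(C w w) / 2)) ∂μ =
      Real.exp (-(C z z + C w w) / 2) * (Real.cosh (C z w) - 1) := by
  have m1 := h.measurable_apply z
  have m2 := h.measurable_apply w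
  have i1 := h.integrable_cos z
  have i2 := h.integrable_cos w
  have i3 : Integrable (fun ω => Real.cos (Y z ω) * Real.cos (Y w ω)) μ :=
    Integrable.of_bound (by fun_prop) 1 (Eventually.of_forall fun ω => by
      rw [norm_mul]
      exact mul_le_one₀ (Real.abs_cos_le_one _) (norm_nonneg _) (Real.abs_cos_le_one _))
  have e : ∀ ω, (Real.cos (Y z ω) - Real.exp (-(C z z) / 2)) *
      (Real.cos (Y w ω) - Real.exp (-(C w w) / 2)) =
      Real.cos (Y z ω) * Real.cos (Y w ω) - (Real.exp (-(C w w) / 2) * Real.cos (Y z ω) +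
        Real.exp (-(C z z) / 2) * Real.cos (Y w ω)
        - Real.exp (-(C z z) / 2) * Real.exp (-(C w w) / 2)) := fun ω => by ring
  simp_rw [e]
  rw [integral_sub i3, integral_sub, integral_add, integral_const_mul, integral_const_mul,
    h.integral_cos, h.integral_cos, h.integral_cos_mul_cos, integral_const, mul_sub, mul_one,
    neg_add, add_div, Real.exp_add]
  · simp only [probReal_univ, one_smul]; ring
  · exact i1.const_mul _
  · exact i2.const_mul _
  · exact (i1.const_mul _).add (i2.const_mul _)
  · exact integrable_const _
  · exact ((i1.const_mul _).add (i2.const_mul _)).sub (integrable_const _)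

lemma centered_cos_cov_nonneg (h : IsGaussianField Y C μ) (z w : Z) :
    0 ≤ ∫ ω, (Real.cos (Y z ω) - Real.exp (-(C z z) / 2)) *
      (Real.cos (Y w ω) - Real.exp (-(C w w) / 2)) ∂μ := by
  rw [h.integral_centered_cos_mul]
  exact mul_nonneg (Real.exp_nonneg _) (sub_nonneg.2 (Real.one_le_cosh _))

lemma centered_cos_cov_le (h : IsGaussianField Y C μ) (z w : Z) :
    ∫ ω, (Real.cos (Y z ω) - Real.exp (-(C z z) / 2)) *
      (Real.cos (Y w ω) - Real.exp (-(C w w) / 2)) ∂μ ≤ C z w ^ 2 := by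
  rw [h.integral_centered_cos_mul]
  calc _ ≤ Real.exp (-(C z z + C w w) / 2) * (C z w ^ 2 * Real.exp |C z w|) := by
        gcongr; exact abs_cosh_sub_one_le _
    _ ≤ Real.exp (-(C z z + C w w) / 2) * (C z w ^ 2 * Real.exp ((C z z + C w w) / 2)) := by
        gcongr; exact h.abs_cov_le z w
    _ = C z w ^ 2 := by
        rw [mul_left_comm, ← Real.exp_add, neg_div, neg_add_cancel, Real.exp_zero, mul_one]

/-- Variance bound for a weighted integral of cosines of a Gaussian field. -/
lemma integral_sq_cos_le (h : IsGaussianField Y C μ) {K B : ℝ} (hK : ∀ z, C z z ≤ K)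
    {k : Z → ℝ} (hk : Measurable k) (hB : ∀ z, |k z| ≤ B) :
    Integrable (fun ω => (∫ z, k z * (Real.cos (Y z ω) - Real.exp (-(C z z) / 2)) ∂ν) ^ 2) μ ∧
    ∫ ω, (∫ z, k z * (Real.cos (Y z ω) - Real.exp (-(C z z) / 2)) ∂ν) ^ 2 ∂μ ≤
      ∫ q : Z × Z, |k q.1| * |k q.2| * C q.1 q.2 ^ 2 ∂(ν.prod ν) := by
  have hCd : Measurable (fun z => C z z) :=
    h.measurable_cov.comp (measurable_id.prodMk measurable_id)
  have hYm := h.measurable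
  have hcm := h.measurable_cov
  have hm : Measurable (fun q : Z × Ω =>
      k q.1 * (Real.cos (Y q.1 q.2) - Real.exp (-(C q.1 q.1) / 2))) := by fun_prop
  have hb : ∀ z ω, |k z * (Real.cos (Y z ω) - Real.exp (-(C z z) / 2))| ≤ B * 2 := by
    intro z ω
    rw [abs_mul]
    have h1 := Real.abs_cos_le_one (Y z ω)
    have h2 : Real.exp (-(C z z) / 2) ≤ 1 := by
      rw [Real.exp_le_one_iff]; linarith [h.cov_self_nonneg z]
    have h3 := Real.exp_pos (-(C z z) / 2)
    have : |Real.cos (Y z ω) - Real.exp (-(C z z) / 2)| ≤ 2 := by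
      rw [abs_le] at *; constructor <;> linarith
    have := (abs_nonneg _).trans (hB z)
    gcongr
    exact hB z
  have hi : ∀ z, Integrable (fun ω => (k z * (Real.cos (Y z ω) - Real.exp (-(C z z) / 2))) ^ 2) μ :=
    fun z => Integrable.of_bound ((hm.comp measurable_prodMk_left).pow_const 2).aestronglyMeasurable
      ((B * 2) ^ 2) (Eventually.of_forall fun ω => by
        rw [Real.norm_eq_abs, abs_pow]
        exact pow_le_pow_left₀ (abs_nonneg _) (hb z ω) 2)
  obtain ⟨h1, h2, h3⟩ := integral_sq_integral_eq (ν := ν) (M := (B * 2) ^ 2) hm hi (fun z => by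
    calc _ ≤ ∫ _, (B * 2) ^ 2 ∂μ := integral_mono (hi z) (integrable_const _) fun ω => by
          rw [← sq_abs]
          exact pow_le_pow_left₀ (abs_nonneg _) (hb z ω) 2
      _ = _ := by simp)
  refine ⟨h1, ?_⟩
  rw [h3]
  refine integral_mono h2 ?_ fun q => ?_
  · refine Integrable.of_bound (C := B * B * K ^ 2) (by fun_prop) (Eventually.of_forall fun q => ?_)
    have := (abs_nonneg _).trans (hB q.1)
    rw [norm_mul, norm_mul, Real.norm_eq_abs, Real.norm_eq_abs, Real.norm_eq_abs, abs_abs, abs_abs,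
      abs_pow]
    gcongr
    · exact hB _
    · exact hB _
    · exact h.abs_cov_le_of_le hK _ _
  · have e : ∀ ω, k q.1 * (Real.cos (Y q.1 ω) - Real.exp (-(C q.1 q.1) / 2)) *
        (k q.2 * (Real.cos (Y q.2 ω) - Real.exp (-(C q.2 q.2) / 2))) = k q.1 * k q.2 *
        ((Real.cos (Y q.1 ω) - Real.exp (-(C q.1 q.1) / 2)) *
        ((Real.cos (Y q.2 ω) - Real.exp (-(C q.2 q.2) / 2)))) := fun ω => by ring
    simp_rw [e]
    rw [integral_const_mul, ← abs_mul]
    exact mul_le_mul (le_abs_self _) (h.centered_cos_cov_le _ _)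
      (h.centered_cos_cov_nonneg _ _) (abs_nonneg _)

end IsGaussianField

/-- Contraction bound for a bounded symmetric kernel. -/
lemma integral_contraction_le (hCm : Measurable (fun q : Z × Z => C q.1 q.2)) {K A : ℝ}
    (hK : ∀ z w, |C z w| ≤ K) (hA : ∀ z, ∫ w, |C z w| ∂ν ≤ A) :
    ∫ p : (Z × Z) × (Z × Z), |C p.1.1 p.1.2| * |C p.2.1 p.2.2| * C p.1.1 p.2.1 ^ 2
      ∂((ν.prod ν).prod (ν.prod ν)) ≤ A ^ 2 * ∫ q : Z × Z, C q.1 q.2 ^ 2 ∂(ν.prod ν) := by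
  rcases isEmpty_or_nonempty Z with hZ | ⟨⟨z₀⟩⟩
  · have : ν = 0 := Measure.eq_zero_of_isEmpty ν
    simp [this]
  have hA0 : 0 ≤ A := (integral_nonneg fun _ => abs_nonneg _).trans (hA z₀)
  set g : Z × Z → ENNReal := fun q => ENNReal.ofReal |C q.1 q.2| with hg
  set k : Z × Z → ENNReal := fun q => ENNReal.ofReal (C q.1 q.2 ^ 2) with hk
  have hgm : Measurable g := by fun_prop
  have hkm : Measurable k := by fun_prop
  have hgA : ∀ z, ∫⁻ w, g (z, w) ∂ν ≤ ENNReal.ofReal A := fun z => by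
    have hi : Integrable (fun w => |C z w|) ν :=
      Integrable.of_bound ((hCm.comp measurable_prodMk_left).norm).aestronglyMeasurable K
        (Eventually.of_forall fun w => by rw [Real.norm_eq_abs, abs_abs]; exact hK z w)
    rw [← ofReal_integral_eq_lintegral_ofReal hi (Eventually.of_forall fun _ => abs_nonneg _)]
    exact ENNReal.ofReal_le_ofReal (hA z)
  have hp : Measurable (fun p : (Z × Z) × (Z × Z) => (p.1.1, p.1.2)) := by fun_prop
  have hin : ∀ z, ∫⁻ q' : Z × Z, g q' * k (z, q'.1) ∂(ν.prod ν) ≤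
      ENNReal.ofReal A * ∫⁻ z', k (z, z') ∂ν := fun z => by
    rw [lintegral_prod _ (by fun_prop), ← lintegral_const_mul _ (by fun_prop)]
    refine lintegral_mono fun z' => ?_
    change ∫⁻ w', g (z', w') * k (z, z') ∂ν ≤ _
    rw [lintegral_mul_const _ (by fun_prop)]
    gcongr
    exact hgA z'
  have hout : ∫⁻ q : Z × Z, ∫⁻ q' : Z × Z, g q * g q' * k (q.1, q'.1) ∂(ν.prod ν) ∂(ν.prod ν) ≤
      ENNReal.ofReal A ^ 2 * ∫⁻ q : Z × Z, k q ∂(ν.prod ν) := by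
    calc _ ≤ ∫⁻ q : Z × Z, g q * (ENNReal.ofReal A * ∫⁻ z', k (q.1, z') ∂ν) ∂(ν.prod ν) := by
          refine lintegral_mono fun q => ?_
          simp_rw [mul_assoc]
          rw [lintegral_const_mul _ (by fun_prop)]
          gcongr
          exact hin q.1
      _ = ∫⁻ z, ∫⁻ w, g (z, w) * (ENNReal.ofReal A * ∫⁻ z', k (z, z') ∂ν) ∂ν ∂ν := by
          rw [lintegral_prod]
          refine (hgm.mul (measurable_const.mul ?_)).aemeasurable
          exact (hkm.lintegral_prod_right').comp measurable_fst
      _ ≤ ∫⁻ z, ENNReal.ofReal A * (ENNReal.ofReal A * ∫⁻ z', k (z, z') ∂ν) ∂ν := by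
          refine lintegral_mono fun z => ?_
          rw [lintegral_mul_const _ (by fun_prop)]
          gcongr
          exact hgA z
      _ = _ := by
          simp_rw [← mul_assoc, ← sq]
          rw [lintegral_const_mul _ hkm.lintegral_prod_right', lintegral_prod _ hkm.aemeasurable]
  have hQi : Integrable (fun q : Z × Z => C q.1 q.2 ^ 2) (ν.prod ν) :=
    Integrable.of_bound (by fun_prop) (K ^ 2) (Eventually.of_forall fun q => by
      rw [Real.norm_eq_abs, abs_pow]; exact pow_le_pow_left₀ (abs_nonneg _) (hK _ _) 2)
  have hm4 : Measurable (fun p : (Z × Z) × (Z × Z) =>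
      |C p.1.1 p.1.2| * |C p.2.1 p.2.2| * C p.1.1 p.2.1 ^ 2) := by
    have h1 : Measurable (fun p : (Z × Z) × (Z × Z) => (p.1.1, p.2.1)) := by fun_prop
    exact (((hCm.comp measurable_fst).norm).mul ((hCm.comp measurable_snd).norm)).mul
      ((hCm.comp h1).pow_const 2)
  have hnn : ∀ p : (Z × Z) × (Z × Z), 0 ≤ |C p.1.1 p.1.2| * |C p.2.1 p.2.2| * C p.1.1 p.2.1 ^ 2 :=
    fun p => by positivity
  have hi4 : Integrable (fun p : (Z × Z) × (Z × Z) =>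
      |C p.1.1 p.1.2| * |C p.2.1 p.2.2| * C p.1.1 p.2.1 ^ 2) ((ν.prod ν).prod (ν.prod ν)) :=
    Integrable.of_bound hm4.aestronglyMeasurable (K * K * K ^ 2)
      (Eventually.of_forall fun p => by
        have := (abs_nonneg _).trans (hK p.1.1 p.1.2)
        rw [Real.norm_of_nonneg (hnn p), ← sq_abs (C p.1.1 p.2.1)]
        gcongr <;> exact hK _ _)
  rw [← ENNReal.ofReal_le_ofReal_iff
    (mul_nonneg (sq_nonneg _) (integral_nonneg fun _ => sq_nonneg _)),
    ofReal_integral_eq_lintegral_ofReal hi4 (Eventually.of_forall hnn),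
    ENNReal.ofReal_mul (sq_nonneg _), ENNReal.ofReal_pow hA0,
    ofReal_integral_eq_lintegral_ofReal hQi (Eventually.of_forall fun _ => sq_nonneg _),
    lintegral_prod _ (by fun_prop)]
  refine le_trans (le_of_eq ?_) hout
  congr 1; ext q; congr 1; ext q'
  rw [ENNReal.ofReal_mul (by positivity), ENNReal.ofReal_mul (by positivity)]

end

section

/-- Derivative of a weighted characteristic function of a bounded random variable. -/
lemma hasDerivAt_integral_mul_cexp {α : Type*} [MeasurableSpace α] {m : Measure α}
    [IsFiniteMeasure m] {H : α → ℂ} {F : α → ℝ} {B : ℝ} (hH : AEStronglyMeasurable H m)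
    (hF : AEStronglyMeasurable F m) (bH : ∀ᵐ x ∂m, ‖H x‖ ≤ B) (bF : ∀ᵐ x ∂m, |F x| ≤ B) (t : ℝ) :
    HasDerivAt (fun t : ℝ => ∫ x, H x * Complex.exp (Complex.I * ((t * F x : ℝ) : ℂ)) ∂m)
      (∫ x, H x * (Complex.I * (F x : ℂ)) * Complex.exp (Complex.I * ((t * F x : ℝ) : ℂ)) ∂m) t := by
  have hE : ∀ t : ℝ, AEStronglyMeasurable
      (fun x => Complex.exp (Complex.I * ((t * F x : ℝ) : ℂ))) m := fun t =>
    (by fun_prop : Continuous fun y : ℝ => Complex.exp (Complex.I * ((t * y : ℝ) : ℂ))).comp_aestronglyMeasurable hF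
  refine (hasDerivAt_integral_of_dominated_loc_of_deriv_le (s := univ) (bound := fun _ => B * B)
    (F := fun (t : ℝ) x => H x * Complex.exp (Complex.I * ((t * F x : ℝ) : ℂ)))
    (F' := fun (t : ℝ) x => H x * (Complex.I * (F x : ℂ)) *
      Complex.exp (Complex.I * ((t * F x : ℝ) : ℂ)))
    univ_mem (Eventually.of_forall fun t => hH.mul (hE t)) ?_
    ((hH.mul ((Complex.continuous_ofReal.comp_aestronglyMeasurable hF).const_mul _)).mul (hE t)) ?_
    (integrable_const _) ?_).2
  · refine Integrable.of_bound (hH.mul (hE t)) B ?_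
    filter_upwards [bH] with x hx
    rwa [norm_mul, norm_cexp_I_mul, mul_one]
  · filter_upwards [bH, bF] with x hx hx' s _
    rw [norm_mul, norm_cexp_I_mul, mul_one, norm_mul, norm_mul, Complex.norm_I, one_mul,
      Complex.norm_real, Real.norm_eq_abs]
    exact mul_le_mul hx hx' (abs_nonneg _) ((norm_nonneg _).trans hx)
  · refine Eventually.of_forall fun x s _ => ?_
    have h1 : HasDerivAt (fun t : ℝ => Complex.I * ((t * F x : ℝ) : ℂ))
        (Complex.I * ((1 * F x : ℝ) : ℂ)) s :=
      (((hasDerivAt_id s).mul_const (F x)).ofReal_comp).const_mul _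
    have h2 := (h1.cexp).const_mul (H x)
    rw [one_mul] at h2
    exact h2.congr_deriv (by ring)

variable {Ω : Type*} [MeasurableSpace Ω] {μ : Measure Ω} [IsProbabilityMeasure μ]

/-- Stein's method on the level of characteristic functions. -/
lemma norm_charFun_sub_gaussian_le {P : Type*} [MeasurableSpace P] {m : Measure P}
    [IsFiniteMeasure m] {F : Ω → ℝ} {B δ : ℝ} (hF : Measurable F) (bF : ∀ ω, |F ω| ≤ B)
    {π : P → Ω} (hπ : Measurable π) {T : P → ℝ} (hT : AEStronglyMeasurable T m)
    (bT : ∃ B', ∀ᵐ p ∂m, |T p| ≤ B')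
    (hst : ∀ t : ℝ, ∫ ω, (F ω : ℂ) * Complex.exp (Complex.I * ((t * F ω : ℝ) : ℂ)) ∂μ =
      Complex.I * t * ∫ p, (T p : ℂ) * Complex.exp (Complex.I * ((t * F (π p) : ℝ) : ℂ)) ∂m)
    (hδ : ∀ t : ℝ, ‖∫ p, (T p : ℂ) * Complex.exp (Complex.I * ((t * F (π p) : ℝ) : ℂ)) ∂m -
      ((∫ p, T p ∂m : ℝ) : ℂ) * ∫ ω, Complex.exp (Complex.I * ((t * F ω : ℝ) : ℂ)) ∂μ‖ ≤ δ)
    (t : ℝ) :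
    ‖∫ ω, Complex.exp (Complex.I * ((t * F ω : ℝ) : ℂ)) ∂μ -
      ((Real.exp (-(∫ ω, F ω ^ 2 ∂μ) * t ^ 2 / 2) : ℝ) : ℂ)‖ ≤ t ^ 2 * δ := by
  obtain ⟨B', bT⟩ := bT
  have hδ0 : 0 ≤ δ := (norm_nonneg _).trans (hδ 0)
  set φ : ℝ → ℂ := fun t => ∫ ω, Complex.exp (Complex.I * ((t * F ω : ℝ) : ℂ)) ∂μ with hφ
  set G : ℝ → ℂ := fun t =>
    ∫ p, (T p : ℂ) * Complex.exp (Complex.I * ((t * F (π p) : ℝ) : ℂ)) ∂m with hG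
  have hFc : AEStronglyMeasurable (fun ω => (F ω : ℂ)) μ :=
    (Complex.measurable_ofReal.comp hF).aestronglyMeasurable
  have dG := hasDerivAt_integral_mul_cexp (m := m) (H := fun p => (T p : ℂ)) (F := fun p => F (π p))
    (B := max B B')
    (Complex.continuous_ofReal.comp_aestronglyMeasurable hT) (hF.comp hπ).aestronglyMeasurable
    (by filter_upwards [bT] with p hp
        rw [Complex.norm_real, Real.norm_eq_abs]; exact hp.trans (le_max_right _ _))
    (Eventually.of_forall fun p => (bF _).trans (le_max_left _ _))
  have dF := hasDerivAt_integral_mul_cexp (m := μ) (H := fun ω => (F ω : ℂ)) (F := F) (B := B)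
    hFc hF.aestronglyMeasurable (Eventually.of_forall fun ω => by
      rw [Complex.norm_real, Real.norm_eq_abs]; exact bF ω) (Eventually.of_forall bF)
  have dφ := hasDerivAt_integral_mul_cexp (m := μ) (H := fun _ => (1 : ℂ)) (F := F) (B := max B 1)
    aestronglyMeasurable_const hF.aestronglyMeasurable (Eventually.of_forall fun ω => by simp)
    (Eventually.of_forall fun ω => (bF ω).trans (le_max_left _ _))
  have hv : ((∫ ω, F ω ^ 2 ∂μ : ℝ) : ℂ) = ((∫ p, T p ∂m : ℝ) : ℂ) := by
    have h1 := dF 0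
    have h2 : HasDerivAt (fun t : ℝ => Complex.I * t * G t)
        (Complex.I * ((1 : ℝ) : ℂ) * G 0 + Complex.I * ((0 : ℝ) : ℂ) * _) 0 :=
      (((hasDerivAt_id (0 : ℝ)).ofReal_comp).const_mul Complex.I).mul (dG 0)
    have h3 := h1.unique (h2.congr_of_eventuallyEq (Eventually.of_forall fun t => hst t))
    simp only [Complex.ofReal_one, Complex.ofReal_zero, mul_zero, zero_mul, add_zero, mul_one] at h3
    have h4 : G 0 = ((∫ p, T p ∂m : ℝ) : ℂ) := by
      simp only [hG, zero_mul, Complex.ofReal_zero, mul_zero, Complex.exp_zero, mul_one]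
      exact integral_complex_ofReal
    rw [h4] at h3
    have h5 : ∫ ω, (F ω : ℂ) * (Complex.I * (F ω : ℂ)) ∂μ =
        Complex.I * ((∫ ω, F ω ^ 2 ∂μ : ℝ) : ℂ) := by
      rw [← integral_complex_ofReal, ← integral_const_mul]
      congr 1; ext ω; push_cast; ring
    have h6 : ∫ ω, (F ω : ℂ) * (Complex.I * (F ω : ℂ)) ∂μ =
        Complex.I * ((∫ p, T p ∂m : ℝ) : ℂ) := by
      rw [← h3]; congr 1; ext ω; simp
    exact mul_left_cancel₀ Complex.I_ne_zero (h5.symm.trans h6)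
  set v : ℝ := ∫ ω, F ω ^ 2 ∂μ with hvdef
  have hv0 : 0 ≤ v := integral_nonneg fun _ => sq_nonneg _
  have hφ' : ∀ s, HasDerivAt φ (-(s * G s)) s := fun s => by
    have h1 := dφ s
    simp only [one_mul] at h1
    refine h1.congr_deriv ?_
    have h2 : ∫ x, Complex.I * (F x : ℂ) * Complex.exp (Complex.I * ((s * F x : ℝ) : ℂ)) ∂μ =
        Complex.I * ∫ x, (F x : ℂ) * Complex.exp (Complex.I * ((s * F x : ℝ) : ℂ)) ∂μ := by
      rw [← integral_const_mul]; congr 1; ext; ring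
    rw [h2, hst s]
    linear_combination ((s : ℂ) * G s) * Complex.I_sq
  set D : ℝ → ℂ := fun s => φ s * ((Real.exp (v * s ^ 2 / 2) : ℝ) : ℂ) with hD
  have dD : ∀ s : ℝ, HasDerivAt D (-(s : ℂ) * (G s - v * φ s) * ((Real.exp (v * s ^ 2 / 2) : ℝ) : ℂ)) s := by
    intro s
    have h1 : HasDerivAt (fun s : ℝ => Real.exp (v * s ^ 2 / 2)) (Real.exp (v * s ^ 2 / 2) * (v * s)) s := by
      have := ((((hasDerivAt_pow 2 s).const_mul v).div_const 2)).exp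
      exact this.congr_deriv (by norm_num; ring)
    have h2 := (hφ' s).mul h1.ofReal_comp
    exact h2.congr_deriv (by push_cast; ring)
  have hbd : ∀ s ∈ uIcc 0 t, ‖-(s : ℂ) * (G s - v * φ s) * ((Real.exp (v * s ^ 2 / 2) : ℝ) : ℂ)‖ ≤
      |t| * δ * Real.exp (v * t ^ 2 / 2) := by
    intro s hs
    have hst : |s| ≤ |t| := by
      have := abs_sub_left_of_mem_uIcc hs
      simpa using this
    have h1 : ‖G s - v * φ s‖ ≤ δ := by
      rw [hv]
      exact hδ s
    have h2 : s ^ 2 ≤ t ^ 2 := sq_le_sq.2 hst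
    rw [norm_mul, norm_mul, norm_neg, Complex.norm_real, Complex.norm_real, Real.norm_eq_abs,
      Real.norm_eq_abs, Real.abs_exp]
    gcongr
  have hmv := Convex.norm_image_sub_le_of_norm_hasDerivWithin_le
    (fun s hs => (dD s).hasDerivWithinAt) hbd (convex_uIcc 0 t) left_mem_uIcc right_mem_uIcc
  have hD0 : D 0 = 1 := by simp [hD, hφ]
  rw [hD0, sub_zero, Real.norm_eq_abs] at hmv
  have e : φ t - ((Real.exp (-v * t ^ 2 / 2) : ℝ) : ℂ) =
      (D t - 1) * ((Real.exp (-v * t ^ 2 / 2) : ℝ) : ℂ) := by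
    rw [hD, sub_mul, one_mul, mul_assoc, ← Complex.ofReal_mul, ← Real.exp_add]
    rw [show v * t ^ 2 / 2 + -v * t ^ 2 / 2 = 0 by ring, Real.exp_zero, Complex.ofReal_one, mul_one]
  change ‖φ t - _‖ ≤ _
  rw [e, norm_mul, Complex.norm_real, Real.norm_eq_abs, Real.abs_exp]
  calc _ ≤ |t| * δ * Real.exp (v * t ^ 2 / 2) * |t| * Real.exp (-v * t ^ 2 / 2) := by gcongr
    _ = |t| * |t| * δ * (Real.exp (v * t ^ 2 / 2) * Real.exp (-v * t ^ 2 / 2)) := by ring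
    _ = t ^ 2 * δ := by
        rw [← Real.exp_add, show v * t ^ 2 / 2 + -v * t ^ 2 / 2 = 0 by ring, Real.exp_zero,
          mul_one, abs_mul_abs_self, sq]

end

section

variable {Z Ω : Type*} [MeasurableSpace Z] [MeasurableSpace Ω] {Y : Z → Ω → ℝ}
  {C : Z → Z → ℝ} {μ : Measure Ω} [IsProbabilityMeasure μ] {ν : Measure Z} [IsFiniteMeasure ν]

lemma integral_eq_zero_of_odd {τ : Z → Z} (hτ : MeasurePreserving τ ν ν) {u : Z → ℝ}
    (hu : Measurable u) (hodd : ∀ z, u (τ z) = -u z) : ∫ z, u z ∂ν = 0 := by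
  have h1 : ∫ z, u z ∂ν = ∫ z, u (τ z) ∂ν := by
    conv_lhs => rw [← hτ.map_eq]
    exact integral_map hτ.measurable.aemeasurable hu.aestronglyMeasurable
  simp_rw [hodd, integral_neg] at h1
  linarith

lemma integral_mul_cexp_eq_of_odd {τ : Z → Z} (hτ : MeasurePreserving τ ν ν) {k y : Z → ℝ}
    (hk : Measurable k) (hy : Measurable y) (hki : ∃ B, ∀ z, |k z| ≤ B)
    (hkτ : ∀ z, k (τ z) = k z) (hyτ : ∀ z, y (τ z) = -y z) :
    ∫ z, (k z : ℂ) * Complex.exp (Complex.I * (y z : ℂ)) ∂ν =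
      ((∫ z, k z * Real.cos (y z) ∂ν : ℝ) : ℂ) := by
  obtain ⟨B, hB⟩ := hki
  have hs : ∫ z, k z * Real.sin (y z) ∂ν = 0 :=
    integral_eq_zero_of_odd hτ (by fun_prop) fun z => by rw [hkτ, hyτ, Real.sin_neg, mul_neg]
  have e : ∀ z, (k z : ℂ) * Complex.exp (Complex.I * (y z : ℂ)) =
      ((k z * Real.cos (y z) : ℝ) : ℂ) + ((k z * Real.sin (y z) : ℝ) : ℂ) * Complex.I := fun z => by
    rw [mul_comm Complex.I, Complex.exp_mul_I]; push_cast; ring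
  have hB' : ∀ z x, |x| ≤ 1 → |k z * x| ≤ B := fun z x hx => by
    rw [abs_mul]
    calc _ ≤ B * 1 := mul_le_mul (hB z) hx (abs_nonneg _) ((abs_nonneg _).trans (hB z))
      _ = B := mul_one B
  have i1 : Integrable (fun z => ((k z * Real.cos (y z) : ℝ) : ℂ)) ν :=
    Integrable.of_bound (by fun_prop) B (Eventually.of_forall fun z => by
      rw [Complex.norm_real]; exact hB' _ _ (Real.abs_cos_le_one _))
  have i2 : Integrable (fun z => ((k z * Real.sin (y z) : ℝ) : ℂ)) ν :=
    Integrable.of_bound (by fun_prop) B (Eventually.of_forall fun z => by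
      rw [Complex.norm_real]; exact hB' _ _ (Real.abs_sin_le_one _))
  simp_rw [e]
  rw [integral_add i1 (i2.mul_const _), integral_mul_const, integral_complex_ofReal,
    integral_complex_ofReal, hs]
  simp

/-- The centred random variable `∫ c(z) (cos Y_z - E cos Y_z) dν(z)`. -/
noncomputable def cosFunctional (ν : Measure Z) (Y : Z → Ω → ℝ) (C : Z → Z → ℝ) (c : Z → ℝ)
    (ω : Ω) : ℝ :=
  ∫ z, c z * (Real.cos (Y z ω) - Real.exp (-(C z z) / 2)) ∂ν

/-- The kernel of the Stein factor of `cosFunctional`. -/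
noncomputable def steinKernel (C : Z → Z → ℝ) (c : Z → ℝ) (s : ℝ) (q : Z × Z) : ℝ :=
  c q.1 * c q.2 * C q.1 q.2 * Real.exp (-(C q.1 q.1 * (1 - s ^ 2)) / 2)

/-- The Stein factor of `cosFunctional`. -/
noncomputable def steinFactor (ν : Measure Z) (Y : Z → Ω → ℝ) (C : Z → Z → ℝ) (c : Z → ℝ)
    (p : ℝ × Ω) : ℝ :=
  -∫ q, steinKernel C c p.1 q * Real.cos (p.1 * Y q.1 p.2 + Y q.2 p.2) ∂(ν.prod ν)

namespace IsGaussianField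

variable {c : Z → ℝ} {K B : ℝ}

lemma measurable_cov_diag (h : IsGaussianField Y C μ) : Measurable (fun z => C z z) :=
  h.measurable_cov.comp (measurable_id.prodMk measurable_id)

lemma exp_neg_cov_le_one (h : IsGaussianField Y C μ) (z : Z) : Real.exp (-(C z z) / 2) ≤ 1 := by
  rw [Real.exp_le_one_iff]; linarith [h.cov_self_nonneg z]

lemma measurable_cosFunctional (h : IsGaussianField Y C μ) (hc : Measurable c) :
    Measurable (cosFunctional ν Y C c) := by
  have hCd := h.measurable_cov_diag
  have hYm := h.measurable
  have h1 : Measurable (fun q : Z × Ω => C q.1 q.1) := hCd.comp measurable_fst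
  have hm : Measurable (fun q : Z × Ω =>
      c q.1 * (Real.cos (Y q.1 q.2) - Real.exp (-(C q.1 q.1) / 2))) :=
    (hc.comp measurable_fst).mul ((Real.measurable_cos.comp hYm).sub
      (Real.measurable_exp.comp (h1.neg.div_const 2)))
  exact hm.stronglyMeasurable.integral_prod_left'.measurable

lemma abs_cos_sub_le (h : IsGaussianField Y C μ) (z : Z) (ω : Ω) :
    |Real.cos (Y z ω) - Real.exp (-(C z z) / 2)| ≤ 2 := by
  have h1 := Real.abs_cos_le_one (Y z ω)
  have h2 := h.exp_neg_cov_le_one z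
  have h3 := Real.exp_pos (-(C z z) / 2)
  rw [abs_le] at *; constructor <;> linarith

lemma abs_cosFunctional_le (h : IsGaussianField Y C μ) (hB : ∀ z, |c z| ≤ B) (ω : Ω) :
    |cosFunctional ν Y C c ω| ≤ B * 2 * ν.real univ := by
  rw [cosFunctional, ← Real.norm_eq_abs]
  refine norm_integral_le_of_norm_le_const (μ := ν) (Eventually.of_forall fun z => ?_)
  rw [norm_mul]
  exact mul_le_mul (hB z) (h.abs_cos_sub_le z ω) (norm_nonneg _) ((abs_nonneg _).trans (hB z))

lemma measurable_steinKernel (h : IsGaussianField Y C μ) (hc : Measurable c) :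
    Measurable (fun p : ℝ × (Z × Z) => steinKernel C c p.1 p.2) := by
  have hCd := h.measurable_cov_diag
  have hCm := h.measurable_cov
  have h1 : Measurable (fun p : ℝ × (Z × Z) => C p.2.1 p.2.2) := hCm.comp measurable_snd
  have h2 : Measurable (fun p : ℝ × (Z × Z) => C p.2.1 p.2.1) :=
    hCd.comp (measurable_fst.comp measurable_snd)
  unfold steinKernel
  fun_prop

lemma abs_steinKernel_le (h : IsGaussianField Y C μ) (hB : ∀ z, |c z| ≤ B) {s : ℝ}
    (hs : s ∈ Ioc (0 : ℝ) 1) (q : Z × Z) : |steinKernel C c s q| ≤ B ^ 2 * |C q.1 q.2| := by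
  have h0 := (abs_nonneg _).trans (hB q.1)
  have h1 : Real.exp (-(C q.1 q.1 * (1 - s ^ 2)) / 2) ≤ 1 := by
    rw [Real.exp_le_one_iff]
    have : 0 ≤ C q.1 q.1 * (1 - s ^ 2) :=
      mul_nonneg (h.cov_self_nonneg _) (by nlinarith [hs.1, hs.2])
    linarith
  rw [steinKernel, abs_mul, abs_mul, abs_mul, Real.abs_exp, sq B]
  calc |c q.1| * |c q.2| * |C q.1 q.2| * Real.exp (-(C q.1 q.1 * (1 - s ^ 2)) / 2)
      ≤ B * B * |C q.1 q.2| * 1 := by gcongr <;> exact hB _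
    _ = _ := mul_one _

lemma measurable_steinFactor (h : IsGaussianField Y C μ) (hc : Measurable c) :
    Measurable (steinFactor ν Y C c) := by
  have h1 : Measurable (fun p : (Z × Z) × (ℝ × Ω) => steinKernel C c p.2.1 p.1) :=
    (h.measurable_steinKernel hc).comp
      ((measurable_fst.comp measurable_snd).prodMk measurable_fst)
  have h2 : Measurable (fun p : (Z × Z) × (ℝ × Ω) => Y p.1.1 p.2.2) := by
    have : Measurable (fun p : (Z × Z) × (ℝ × Ω) => (p.1.1, p.2.2)) := by fun_prop
    exact h.measurable.comp this
  have h3 : Measurable (fun p : (Z × Z) × (ℝ × Ω) => Y p.1.2 p.2.2) := by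
    have : Measurable (fun p : (Z × Z) × (ℝ × Ω) => (p.1.2, p.2.2)) := by fun_prop
    exact h.measurable.comp this
  have hm : Measurable (fun p : (Z × Z) × (ℝ × Ω) =>
      steinKernel C c p.2.1 p.1 * Real.cos (p.2.1 * Y p.1.1 p.2.2 + Y p.1.2 p.2.2)) :=
    h1.mul (Real.measurable_cos.comp
      (((measurable_fst.comp measurable_snd).mul h2).add h3))
  exact (hm.stronglyMeasurable.integral_prod_left' (μ := ν.prod ν)).measurable.neg

lemma abs_steinFactor_le (h : IsGaussianField Y C μ) (hK : ∀ z, C z z ≤ K) (hB : ∀ z, |c z| ≤ B)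
    {s : ℝ} (hs : s ∈ Ioc (0 : ℝ) 1) (ω : Ω) :
    |steinFactor ν Y C c (s, ω)| ≤ B ^ 2 * K * (ν.prod ν).real univ := by
  rw [steinFactor, abs_neg, ← Real.norm_eq_abs]
  refine norm_integral_le_of_norm_le_const (μ := ν.prod ν) (Eventually.of_forall fun q => ?_)
  rw [norm_mul]
  calc _ ≤ B ^ 2 * |C q.1 q.2| * 1 := mul_le_mul (h.abs_steinKernel_le hB hs q)
        (Real.abs_cos_le_one _) (abs_nonneg _) (by positivity)
    _ ≤ B ^ 2 * K := by
        rw [mul_one]; gcongr; exact h.abs_cov_le_of_le hK _ _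

/-- Mean deviation of the Stein factor. -/
lemma integral_sq_steinFactor_le (h : IsGaussianField Y C μ) (hK : ∀ z, C z z ≤ K)
    (hc : Measurable c) (hB : ∀ z, |c z| ≤ B) {A : ℝ} (hA : ∀ z, ∫ w, |C z w| ∂ν ≤ A)
    {s : ℝ} (hs : s ∈ Ioc (0 : ℝ) 1) :
    ∫ ω, (steinFactor ν Y C c (s, ω) - ∫ ω', steinFactor ν Y C c (s, ω') ∂μ) ^ 2 ∂μ ≤
      (4 * B ^ 2 * A) ^ 2 * ∫ q : Z × Z, C q.1 q.2 ^ 2 ∂(ν.prod ν) := by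
  have hCK := h.abs_cov_le_of_le hK
  have hP := h.pair s
  have hCm := h.measurable_cov
  have hs2 : |s| ≤ 1 := by rw [abs_of_pos hs.1]; exact hs.2
  have hkm : Measurable (steinKernel C c s) :=
    (h.measurable_steinKernel hc).comp measurable_prodMk_left
  have hkb : ∀ q, |steinKernel C c s q| ≤ B ^ 2 * K := fun q =>
    (h.abs_steinKernel_le hB hs q).trans (by gcongr; exact hCK _ _)
  have hPK : ∀ q : Z × Z, s ^ 2 * C q.1 q.1 + s * C q.1 q.2 + s * C q.2 q.1 + C q.2 q.2 ≤
      4 * K := fun q => by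
    have h1 := h.cov_self_nonneg q.1
    have h2 := (abs_le.1 (hCK q.1 q.2)).2
    have h3 := (abs_le.1 (hCK q.2 q.1)).2
    have h4 := hK q.1
    have h5 := hK q.2
    have h6 : s ^ 2 * C q.1 q.1 ≤ C q.1 q.1 :=
      mul_le_of_le_one_left h1 (by nlinarith [hs.1, hs.2])
    have hK0 : 0 ≤ K := h1.trans h4
    have h7 : s * C q.1 q.2 ≤ K :=
      (mul_le_mul_of_nonneg_left h2 hs.1.le).trans (mul_le_of_le_one_left hK0 hs.2)
    have h8 : s * C q.2 q.1 ≤ K :=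
      (mul_le_mul_of_nonneg_left h3 hs.1.le).trans (mul_le_of_le_one_left hK0 hs.2)
    linarith
  obtain ⟨-, hvar⟩ := hP.integral_sq_cos_le (ν := ν.prod ν) hPK hkm hkb
  have e : ∀ ω, steinFactor ν Y C c (s, ω) - ∫ ω', steinFactor ν Y C c (s, ω') ∂μ =
      -∫ q : Z × Z, steinKernel C c s q * (Real.cos (s * Y q.1 ω + Y q.2 ω) -
        Real.exp (-(s ^ 2 * C q.1 q.1 + s * C q.1 q.2 + s * C q.2 q.1 + C q.2 q.2) / 2))
        ∂(ν.prod ν) := by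
    intro ω
    have hm2 : Measurable (fun p : (Z × Z) × Ω =>
        steinKernel C c s p.1 * Real.cos (s * Y p.1.1 p.2 + Y p.1.2 p.2)) := by
      exact (hkm.comp measurable_fst).mul (Real.measurable_cos.comp hP.measurable)
    have hb2 : ∀ q ω, ‖steinKernel C c s q * Real.cos (s * Y q.1 ω + Y q.2 ω)‖ ≤ B ^ 2 * K :=
      fun q ω => by
        rw [norm_mul]
        calc _ ≤ B ^ 2 * K * 1 := mul_le_mul (hkb q) (Real.abs_cos_le_one _) (abs_nonneg _)
              ((abs_nonneg _).trans (hkb q))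
          _ = _ := mul_one _
    have i0 : Integrable (fun p : (Z × Z) × Ω =>
        steinKernel C c s p.1 * Real.cos (s * Y p.1.1 p.2 + Y p.1.2 p.2)) ((ν.prod ν).prod μ) :=
      Integrable.of_bound hm2.aestronglyMeasurable (B ^ 2 * K)
        (Eventually.of_forall fun p => hb2 p.1 p.2)
    have e1 : ∫ ω', steinFactor ν Y C c (s, ω') ∂μ = -∫ q : Z × Z, steinKernel C c s q *
        Real.exp (-(s ^ 2 * C q.1 q.1 + s * C q.1 q.2 + s * C q.2 q.1 + C q.2 q.2) / 2)
        ∂(ν.prod ν) := by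
      simp only [steinFactor]
      rw [integral_neg, integral_integral_swap (f := fun ω' (q : Z × Z) =>
        steinKernel C c s q * Real.cos (s * Y q.1 ω' + Y q.2 ω')) i0.swap]
      congr 1; congr 1; ext q
      rw [integral_const_mul, hP.integral_cos q]
    rw [e1]
    simp only [steinFactor, mul_sub]
    rw [integral_sub]
    · ring
    · exact Integrable.of_bound (hm2.comp measurable_prodMk_right).aestronglyMeasurable _
        (Eventually.of_forall fun q => hb2 q ω)
    · refine Integrable.of_bound (hkm.mul (Real.measurable_exp.comp
        (hP.measurable_cov_diag.neg.div_const 2))).aestronglyMeasurable (B ^ 2 * K)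
        (Eventually.of_forall fun q => ?_)
      rw [norm_mul]
      calc _ ≤ B ^ 2 * K * 1 := mul_le_mul (hkb q) (by
              rw [Real.norm_eq_abs, Real.abs_exp]; exact hP.exp_neg_cov_le_one q) (norm_nonneg _)
              ((abs_nonneg _).trans (hkb q))
        _ = _ := mul_one _
  simp_rw [e, neg_sq]
  refine hvar.trans ?_
  have hswap1 := integral_contraction_le (ν := ν) hCm hCK hA
  set J : ℝ := ∫ p : (Z × Z) × (Z × Z), |C p.1.1 p.1.2| * |C p.2.1 p.2.2| * C p.1.1 p.2.1 ^ 2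
      ∂((ν.prod ν).prod (ν.prod ν)) with hJ
  set ρ := (ν.prod ν).prod (ν.prod ν) with hρ
  have sw : MeasurePreserving (Prod.swap : Z × Z → Z × Z) (ν.prod ν) (ν.prod ν) :=
    Measure.measurePreserving_swap
  have idp := MeasurePreserving.id (ν.prod ν)
  have gen : ∀ (f g : Z × Z → Z × Z) (_ : MeasurePreserving f (ν.prod ν) (ν.prod ν))
      (_ : MeasurePreserving g (ν.prod ν) (ν.prod ν))
      (_ : ∀ q, |C (f q).1 (f q).2| = |C q.1 q.2|) (_ : ∀ q, |C (g q).1 (g q).2| = |C q.1 q.2|),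
      Integrable (fun p : (Z × Z) × (Z × Z) =>
        |C p.1.1 p.1.2| * |C p.2.1 p.2.2| * C (f p.1).1 (g p.2).1 ^ 2) ρ ∧
      ∫ p : (Z × Z) × (Z × Z), |C p.1.1 p.1.2| * |C p.2.1 p.2.2| * C (f p.1).1 (g p.2).1 ^ 2 ∂ρ
        = J := by
    intro f g hf hg hfC hgC
    have hm0 : Measurable (fun p : (Z × Z) × (Z × Z) =>
        |C p.1.1 p.1.2| * |C p.2.1 p.2.2| * C p.1.1 p.2.1 ^ 2) := by
      have h1 : Measurable (fun p : (Z × Z) × (Z × Z) => (p.1.1, p.2.1)) := by fun_prop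
      exact (((hCm.comp measurable_fst).norm).mul ((hCm.comp measurable_snd).norm)).mul
        ((hCm.comp h1).pow_const 2)
    have hfg : MeasurePreserving (Prod.map f g) ρ ρ := hf.prod hg
    have e2 : (fun p : (Z × Z) × (Z × Z) =>
        |C p.1.1 p.1.2| * |C p.2.1 p.2.2| * C (f p.1).1 (g p.2).1 ^ 2) =
        (fun p : (Z × Z) × (Z × Z) => |C p.1.1 p.1.2| * |C p.2.1 p.2.2| * C p.1.1 p.2.1 ^ 2) ∘
          Prod.map f g := by
      ext p
      simp [hfC, hgC]
    rw [e2]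
    constructor
    · refine Integrable.of_bound (hm0.comp hfg.measurable).aestronglyMeasurable (K * K * K ^ 2)
        (Eventually.of_forall fun p => ?_)
      have := (abs_nonneg _).trans (hCK (f p.1).1 (f p.1).2)
      simp only [Function.comp, Prod.map, norm_mul, norm_pow, Real.norm_eq_abs, abs_abs]
      gcongr <;> exact hCK _ _
    · rw [hJ]
      conv_rhs => rw [← hfg.map_eq]
      exact (integral_map hfg.measurable.aemeasurable hm0.aestronglyMeasurable).symm
  have hsC : ∀ q : Z × Z, |C q.swap.1 q.swap.2| = |C q.1 q.2| := fun q => by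
    rw [Prod.fst_swap, Prod.snd_swap, h.symm]
  obtain ⟨i1, j1⟩ := gen id id idp idp (fun _ => rfl) (fun _ => rfl)
  obtain ⟨i2, j2⟩ := gen id Prod.swap idp sw (fun _ => rfl) hsC
  obtain ⟨i3, j3⟩ := gen Prod.swap id sw idp hsC (fun _ => rfl)
  obtain ⟨i4, j4⟩ := gen Prod.swap Prod.swap sw sw hsC hsC
  simp only [id, Prod.fst_swap] at i1 i2 i3 i4 j1 j2 j3 j4
  have hub := ((i1.add i2).add (i3.add i4)).const_mul (4 * B ^ 4)
  have hpt : ∀ q : (Z × Z) × (Z × Z), |steinKernel C c s q.1| *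
      |steinKernel C c s q.2| * (s ^ 2 * C q.1.1 q.2.1 + s * C q.1.1 q.2.2 + s * C q.1.2 q.2.1 +
        C q.1.2 q.2.2) ^ 2 ≤ 4 * B ^ 4 * (|C q.1.1 q.1.2| * |C q.2.1 q.2.2| * C q.1.1 q.2.1 ^ 2 +
        |C q.1.1 q.1.2| * |C q.2.1 q.2.2| * C q.1.1 q.2.2 ^ 2 +
        (|C q.1.1 q.1.2| * |C q.2.1 q.2.2| * C q.1.2 q.2.1 ^ 2 +
        |C q.1.1 q.1.2| * |C q.2.1 q.2.2| * C q.1.2 q.2.2 ^ 2)) := by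
    intro q
    have hsq : ∀ x y z w : ℝ, (s ^ 2 * x + s * y + s * z + w) ^ 2 ≤
        4 * (x ^ 2 + y ^ 2 + z ^ 2 + w ^ 2) := fun x y z w => by
      have h1 : (s ^ 2 * x + s * y + s * z + w) ^ 2 ≤
          4 * ((s ^ 2 * x) ^ 2 + (s * y) ^ 2 + (s * z) ^ 2 + w ^ 2) := by
        nlinarith [sq_nonneg (s ^ 2 * x - s * y), sq_nonneg (s ^ 2 * x - s * z),
          sq_nonneg (s ^ 2 * x - w), sq_nonneg (s * y - s * z), sq_nonneg (s * y - w),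
          sq_nonneg (s * z - w)]
      have h2 : s ^ 2 ≤ 1 := by nlinarith [hs.1, hs.2]
      have h3 : ∀ y : ℝ, (s * y) ^ 2 ≤ y ^ 2 := fun y => by
        rw [mul_pow]; exact mul_le_of_le_one_left (sq_nonneg _) h2
      have h4 : (s ^ 2 * x) ^ 2 ≤ x ^ 2 := by
        rw [sq s, mul_assoc]; exact (h3 _).trans (h3 _)
      linarith [h3 y, h3 z]
    calc _ ≤ (B ^ 2 * |C q.1.1 q.1.2|) * (B ^ 2 * |C q.2.1 q.2.2|) *
          (4 * (C q.1.1 q.2.1 ^ 2 + C q.1.1 q.2.2 ^ 2 + C q.1.2 q.2.1 ^ 2 + C q.1.2 q.2.2 ^ 2)) := by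
          gcongr
          · exact h.abs_steinKernel_le hB hs q.1
          · exact h.abs_steinKernel_le hB hs q.2
          · exact hsq _ _ _ _
      _ = _ := by ring
  have hlb : Integrable (fun q : (Z × Z) × (Z × Z) => |steinKernel C c s q.1| *
      |steinKernel C c s q.2| * (s ^ 2 * C q.1.1 q.2.1 + s * C q.1.1 q.2.2 + s * C q.1.2 q.2.1 +
        C q.1.2 q.2.2) ^ 2) ρ := by
    refine hub.mono' ?_ (Eventually.of_forall fun q => ?_)
    · exact (((hkm.comp measurable_fst).norm.mul (hkm.comp measurable_snd).norm).mul
        (hP.measurable_cov.pow_const 2)).aestronglyMeasurable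
    · rw [Real.norm_of_nonneg (by positivity)]
      exact hpt q
  refine (integral_mono hlb hub hpt).trans ?_
  have e3 : ∫ q : (Z × Z) × (Z × Z), 4 * B ^ 4 * (|C q.1.1 q.1.2| * |C q.2.1 q.2.2| * C q.1.1 q.2.1 ^ 2 +
        |C q.1.1 q.1.2| * |C q.2.1 q.2.2| * C q.1.1 q.2.2 ^ 2 +
        (|C q.1.1 q.1.2| * |C q.2.1 q.2.2| * C q.1.2 q.2.1 ^ 2 +
        |C q.1.1 q.1.2| * |C q.2.1 q.2.2| * C q.1.2 q.2.2 ^ 2)) ∂ρ = 4 * B ^ 4 * (J + J + (J + J)) := by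
    rw [integral_const_mul]
    congr 1
    exact (integral_add (i1.add i2) (i3.add i4)).trans (congrArg₂ (· + ·)
      ((integral_add i1 i2).trans (congrArg₂ (· + ·) j1 j2))
      ((integral_add i3 i4).trans (congrArg₂ (· + ·) j3 j4)))
  refine (le_of_eq e3).trans ?_
  calc 4 * B ^ 4 * (J + J + (J + J)) = 16 * B ^ 4 * J := by ring
    _ ≤ 16 * B ^ 4 * (A ^ 2 * ∫ q : Z × Z, C q.1 q.2 ^ 2 ∂(ν.prod ν)) := by gcongr
    _ = _ := by ring

end IsGaussianField
end

section

variable {Z Ω : Type*} [MeasurableSpace Z] [MeasurableSpace Ω] {Y : Z → Ω → ℝ}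
  {C : Z → Z → ℝ} {μ : Measure Ω} [IsProbabilityMeasure μ] {ν : Measure Z} [IsFiniteMeasure ν]

namespace IsGaussianField

variable {c : Z → ℝ} {K B : ℝ}

/-- The law of the interpolation parameter and the randomness. -/
noncomputable abbrev unitProd (μ : Measure Ω) : Measure (ℝ × Ω) :=
  (volume.restrict (Ioc (0 : ℝ) 1)).prod μ

lemma ae_fst_mem_unitProd (μ : Measure Ω) [IsProbabilityMeasure μ] :
    ∀ᵐ p ∂(unitProd μ), p.1 ∈ Ioc (0 : ℝ) 1 :=
  Measure.quasiMeasurePreserving_fst.ae (ae_restrict_mem measurableSet_Ioc)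

/-- Stein identity for `cosFunctional`. -/
lemma integral_cosFunctional_mul_cexp (h : IsGaussianField Y C μ) (hK : ∀ z, C z z ≤ K)
    (hc : Measurable c) (hB : ∀ z, |c z| ≤ B) {τ : Z → Z} (hτ : MeasurePreserving τ ν ν)
    (hYτ : ∀ z ω, Y (τ z) ω = -Y z ω) (hcτ : ∀ z, c (τ z) = c z)
    (hCτ : ∀ z w, C (τ z) (τ w) = C z w) (t : ℝ) :
    ∫ ω, (cosFunctional ν Y C c ω : ℂ) *
        Complex.exp (Complex.I * ((t * cosFunctional ν Y C c ω : ℝ) : ℂ)) ∂μ =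
      Complex.I * t * ∫ p, (steinFactor ν Y C c p : ℂ) *
        Complex.exp (Complex.I * ((t * cosFunctional ν Y C c p.2 : ℝ) : ℂ)) ∂(unitProd μ) := by
  have hYm := h.measurable
  have hCm := h.measurable_cov
  have hCd := h.measurable_cov_diag
  have hFm := h.measurable_cosFunctional (ν := ν) hc
  set F := cosFunctional ν Y C c with hF
  set E : Ω → ℂ := fun ω => Complex.exp (Complex.I * ((t * F ω : ℝ) : ℂ)) with hE
  have hEm : Measurable E := by fun_prop
  have hE1 : ∀ ω, ‖E ω‖ = 1 := fun ω => norm_cexp_I_mul _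
  set m : ℝ := ∫ z, c z * Real.exp (-(C z z) / 2) ∂ν with hm
  have hYz : ∀ ω, Measurable (fun z => Y z ω) := fun ω => hYm.comp measurable_prodMk_right
  have iexp : Integrable (fun z => c z * Real.exp (-(C z z) / 2)) ν :=
    Integrable.of_bound (by fun_prop) B (Eventually.of_forall fun z => by
      rw [norm_mul, Real.norm_eq_abs, Real.norm_eq_abs, Real.abs_exp]
      calc _ ≤ B * 1 := mul_le_mul (hB z) (h.exp_neg_cov_le_one z) (Real.exp_nonneg _)
            ((abs_nonneg _).trans (hB z))
        _ = B := mul_one B)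
  have hcexp : ∀ ω, ∫ z, (c z : ℂ) * Complex.exp (Complex.I * (Y z ω : ℂ)) ∂ν =
      ((∫ z, c z * Real.cos (Y z ω) ∂ν : ℝ) : ℂ) := fun ω =>
    integral_mul_cexp_eq_of_odd hτ hc (hYz ω) ⟨B, hB⟩ hcτ (fun z => hYτ z ω)
  have icexp : ∀ ω, Integrable (fun z => (c z : ℂ) * Complex.exp (Complex.I * (Y z ω : ℂ))) ν :=
    fun ω => by
      have := hYz ω
      refine Integrable.of_bound (by fun_prop) B (Eventually.of_forall fun z => ?_)
      rw [norm_mul, norm_cexp_I_mul, mul_one, Complex.norm_real]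
      exact hB z
  have hFe : ∀ ω, F ω = (∫ z, c z * Real.cos (Y z ω) ∂ν) - m := fun ω => by
    rw [hF, hm, ← integral_sub]
    · simp only [cosFunctional, mul_sub]
    · have := hYz ω
      refine Integrable.of_bound (by fun_prop) B (Eventually.of_forall fun z => ?_)
      rw [norm_mul]
      calc _ ≤ B * 1 := mul_le_mul (hB z) (Real.abs_cos_le_one _) (abs_nonneg _)
            ((abs_nonneg _).trans (hB z))
        _ = B := mul_one B
    · exact iexp
  have hFc : ∀ ω, (F ω : ℂ) = ∫ z, (c z : ℂ) * (Complex.exp (Complex.I * (Y z ω : ℂ)) -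
      ((Real.exp (-(C z z) / 2) : ℝ) : ℂ)) ∂ν := fun ω => by
    simp_rw [mul_sub]
    rw [integral_sub (icexp ω) ((iexp.ofReal (𝕜 := ℂ)).congr (Eventually.of_forall fun z => by
      change ((c z * Real.exp (-(C z z) / 2) : ℝ) : ℂ) = _
      rw [Complex.ofReal_mul])), hcexp, hFe, Complex.ofReal_sub]
    congr 1
    rw [hm, ← integral_complex_ofReal]
    congr 1; ext z; push_cast; rfl
  have hEe : ∀ ω, E ω = Complex.exp (-(Complex.I * (t * m : ℝ))) *
      Complex.exp (expFunctional ν Y (fun z => Complex.I * t * c z) ω) := fun ω => by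
    have : expFunctional ν Y (fun z => Complex.I * t * c z) ω =
        Complex.I * t * ((∫ z, c z * Real.cos (Y z ω) ∂ν : ℝ) : ℂ) := by
      rw [← hcexp, ← integral_const_mul]
      simp only [expFunctional, mul_assoc]
    rw [this, ← Complex.exp_add, hE]
    simp only [hFe]
    congr 1; push_cast; ring
  clear_value m
  set f : Z × (ℝ × Ω) → ℂ := fun x => (∫ w, (steinKernel C c x.2.1 (x.1, w) : ℂ) *
    Complex.exp (Complex.I * ((x.2.1 * Y x.1 x.2.2 + Y w x.2.2 : ℝ) : ℂ)) ∂ν) * E x.2.2 with hf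
  have hfm : StronglyMeasurable f := by
    have h1 : Measurable (fun x : (Z × (ℝ × Ω)) × Z => steinKernel C c x.1.2.1 (x.1.1, x.2)) := by
      have : Measurable (fun x : (Z × (ℝ × Ω)) × Z => (x.1.2.1, (x.1.1, x.2))) := by fun_prop
      exact (h.measurable_steinKernel hc).comp this
    have h2 : Measurable (fun x : (Z × (ℝ × Ω)) × Z => Y x.1.1 x.1.2.2) := by
      have : Measurable (fun x : (Z × (ℝ × Ω)) × Z => (x.1.1, x.1.2.2)) := by fun_prop
      exact hYm.comp this
    have h3 : Measurable (fun x : (Z × (ℝ × Ω)) × Z => Y x.2 x.1.2.2) := by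
      have : Measurable (fun x : (Z × (ℝ × Ω)) × Z => (x.2, x.1.2.2)) := by fun_prop
      exact hYm.comp this
    have h4 : Measurable (fun x : (Z × (ℝ × Ω)) × Z => x.1.2.1) := by fun_prop
    have hg : Measurable (fun x : (Z × (ℝ × Ω)) × Z => (steinKernel C c x.1.2.1 (x.1.1, x.2) : ℂ) *
        Complex.exp (Complex.I * ((x.1.2.1 * Y x.1.1 x.1.2.2 + Y x.2 x.1.2.2 : ℝ) : ℂ))) :=
      (Complex.measurable_ofReal.comp h1).mul (Complex.measurable_exp.comp
        (measurable_const.mul (Complex.measurable_ofReal.comp ((h4.mul h2).add h3))))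
    have hE2 : Measurable (fun x : Z × (ℝ × Ω) => E x.2.2) :=
      hEm.comp (measurable_snd.comp measurable_snd)
    exact (hg.stronglyMeasurable.integral_prod_right').mul hE2.stronglyMeasurable
  have hfb : ∀ z s ω, s ∈ Ioc (0 : ℝ) 1 → ‖f (z, (s, ω))‖ ≤ B ^ 2 * K * ν.real univ := by
    intro z s ω hs
    rw [hf]
    simp only
    rw [norm_mul, hE1, mul_one]
    refine norm_integral_le_of_norm_le_const (Eventually.of_forall fun w => ?_)
    rw [norm_mul, norm_cexp_I_mul, mul_one, Complex.norm_real]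
    exact (h.abs_steinKernel_le hB hs (z, w)).trans (by
      gcongr; exact h.abs_cov_le_of_le hK _ _)
  have hcI : ∀ z, ‖Complex.I * t * c z‖ ≤ |t| * B := fun z => by
    rw [norm_mul, norm_mul, Complex.norm_I, one_mul, Complex.norm_real, Complex.norm_real,
      Real.norm_eq_abs, Real.norm_eq_abs]
    exact mul_le_mul_of_nonneg_left (hB z) (abs_nonneg _)
  have S1 : ∀ z, (c z : ℂ) * ∫ ω, (Complex.exp (Complex.I * (Y z ω : ℂ)) -
      ((Real.exp (-(C z z) / 2) : ℝ) : ℂ)) * E ω ∂μ =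
      -(Complex.I * t) * ∫ p, f (z, p) ∂(unitProd μ) := by
    intro z
    have st := h.stein_identity (ν := ν) z hK (c := fun z => Complex.I * t * c z) (by fun_prop) hcI
    have e1 : ∫ ω, (Complex.exp (Complex.I * (Y z ω : ℂ)) -
        ((Real.exp (-(C z z) / 2) : ℝ) : ℂ)) * E ω ∂μ = Complex.exp (-(Complex.I * (t * m : ℝ))) *
        ∫ ω, (Complex.exp (Complex.I * (Y z ω : ℂ)) - ((Real.exp (-(C z z) / 2) : ℝ) : ℂ)) *
          Complex.exp (expFunctional ν Y (fun z => Complex.I * t * c z) ω) ∂μ := by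
      rw [← integral_const_mul]
      congr 1; ext ω; rw [hEe]; ring
    rw [e1, st, integral_prod]
    · rw [intervalIntegral.integral_of_le zero_le_one, mul_neg, mul_neg, neg_mul, neg_inj,
        ← integral_const_mul, ← integral_const_mul, ← integral_const_mul]
      congr 1; ext s
      rw [← integral_const_mul, ← integral_const_mul, ← integral_const_mul, ← integral_const_mul]
      congr 1; ext ω
      have e2 : ∫ w, (steinKernel C c s (z, w) : ℂ) *
          Complex.exp (Complex.I * ((s * Y z ω + Y w ω : ℝ) : ℂ)) ∂ν =
          (c z : ℂ) * ((Real.exp (-(C z z * (1 - s ^ 2)) / 2) : ℝ) : ℂ) *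
          Complex.exp (Complex.I * ((s * Y z ω : ℝ) : ℂ)) *
          ∫ w, (C z w : ℂ) * c w * Complex.exp (Complex.I * (Y w ω : ℂ)) ∂ν := by
        rw [← integral_const_mul]
        congr 1; ext w
        rw [steinKernel, Complex.ofReal_add, mul_add, Complex.exp_add]
        push_cast; ring
      have e3 : expFunctional ν Y (fun w => (C z w : ℂ) * (Complex.I * t * c w)) ω =
          Complex.I * t * ∫ w, (C z w : ℂ) * c w * Complex.exp (Complex.I * (Y w ω : ℂ)) ∂ν := by
        rw [expFunctional, ← integral_const_mul]
        congr 1; ext w; ring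
      rw [hf]
      simp only
      rw [e2, e3, hEe]
      ring
    · refine Integrable.of_bound (hfm.comp_measurable measurable_prodMk_left).aestronglyMeasurable
        (B ^ 2 * K * ν.real univ) ?_
      filter_upwards [ae_fst_mem_unitProd μ] with p hp
      exact hfb z p.1 p.2 hp
  have hgm : Measurable (fun x : Z × Ω => (c x.1 : ℂ) * (Complex.exp (Complex.I * (Y x.1 x.2 : ℂ)) -
      ((Real.exp (-(C x.1 x.1) / 2) : ℝ) : ℂ)) * E x.2) := by
    have h1 : Measurable (fun q : Z × Ω => C q.1 q.1) := hCd.comp measurable_fst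
    exact ((Complex.measurable_ofReal.comp (hc.comp measurable_fst)).mul
      ((Complex.measurable_exp.comp (measurable_const.mul (Complex.measurable_ofReal.comp hYm))).sub
      (Complex.measurable_ofReal.comp (Real.measurable_exp.comp (h1.neg.div_const 2))))).mul
      (hEm.comp measurable_snd)
  have hgi : Integrable (fun x : Z × Ω => (c x.1 : ℂ) *
      (Complex.exp (Complex.I * (Y x.1 x.2 : ℂ)) -
      ((Real.exp (-(C x.1 x.1) / 2) : ℝ) : ℂ)) * E x.2) (ν.prod μ) := by
    refine Integrable.of_bound hgm.aestronglyMeasurable (B * 2) (Eventually.of_forall fun x => ?_)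
    rw [norm_mul, norm_mul, hE1, mul_one, Complex.norm_real]
    refine mul_le_mul (hB _) ((norm_sub_le _ _).trans ?_) (norm_nonneg _)
      ((abs_nonneg _).trans (hB x.1))
    rw [norm_cexp_I_mul, Complex.norm_real, Real.norm_eq_abs, Real.abs_exp]
    linarith [h.exp_neg_cov_le_one x.1]
  have S2 : ∫ ω, (F ω : ℂ) * E ω ∂μ = ∫ z, (c z : ℂ) * ∫ ω,
      (Complex.exp (Complex.I * (Y z ω : ℂ)) - ((Real.exp (-(C z z) / 2) : ℝ) : ℂ)) * E ω ∂μ ∂ν := by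
    simp_rw [hFc, ← integral_mul_const, ← integral_const_mul]
    rw [integral_integral_swap (f := fun ω z => (c z : ℂ) * (Complex.exp (Complex.I * (Y z ω : ℂ)) -
      ((Real.exp (-(C z z) / 2) : ℝ) : ℂ)) * E ω) hgi.swap]
    simp_rw [mul_assoc]
  have hfi : Integrable f (ν.prod (unitProd μ)) := by
    refine Integrable.of_bound hfm.aestronglyMeasurable (B ^ 2 * K * ν.real univ) ?_
    filter_upwards [Measure.quasiMeasurePreserving_snd.ae (ae_fst_mem_unitProd μ)] with x hx
    exact hfb x.1 x.2.1 x.2.2 hx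
  rw [S2]
  simp_rw [S1]
  rw [integral_const_mul, integral_integral_swap (f := fun z p => f (z, p)) hfi,
    neg_mul, ← mul_neg, ← integral_neg]
  congr 1
  refine integral_congr_ae ?_
  filter_upwards [ae_fst_mem_unitProd μ] with p hp
  obtain ⟨s, ω⟩ := p
  change -∫ z, f (z, (s, ω)) ∂ν = (steinFactor ν Y C c (s, ω) : ℂ) * E ω
  rw [hf]
  simp only
  rw [integral_mul_const, ← neg_mul]
  congr 1
  have hkm : Measurable (steinKernel C c s) :=
    (h.measurable_steinKernel hc).comp measurable_prodMk_left
  have hkb : ∀ q, |steinKernel C c s q| ≤ B ^ 2 * K := fun q =>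
    (h.abs_steinKernel_le hB hp q).trans (by gcongr; exact h.abs_cov_le_of_le hK _ _)
  have hym : Measurable (fun q : Z × Z => s * Y q.1 ω + Y q.2 ω) :=
    (h.pair s).measurable.comp measurable_prodMk_right
  rw [integral_integral (f := fun z w => (steinKernel C c s (z, w) : ℂ) *
    Complex.exp (Complex.I * ((s * Y z ω + Y w ω : ℝ) : ℂ)))]
  · rw [steinFactor, Complex.ofReal_neg, neg_inj]
    exact integral_mul_cexp_eq_of_odd (hτ.prod hτ) hkm hym ⟨_, hkb⟩
      (fun q => by simp [steinKernel, hcτ, hCτ]) (fun q => by simp [hYτ]; ring)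
  · refine Integrable.of_bound (by fun_prop) (B ^ 2 * K) (Eventually.of_forall fun q => ?_)
    simp only [Function.uncurry, Prod.mk.eta]
    rw [norm_mul, norm_cexp_I_mul, mul_one, Complex.norm_real]
    exact hkb q

/-- Quantitative central limit theorem for integrated cosines of a Gaussian field. -/
theorem norm_charFun_cosFunctional_sub_le (h : IsGaussianField Y C μ) (hK : ∀ z, C z z ≤ K)
    (hc : Measurable c) (hB : ∀ z, |c z| ≤ B) {τ : Z → Z} (hτ : MeasurePreserving τ ν ν)
    (hYτ : ∀ z ω, Y (τ z) ω = -Y z ω) (hcτ : ∀ z, c (τ z) = c z)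
    (hCτ : ∀ z w, C (τ z) (τ w) = C z w) {A : ℝ} (hA : ∀ z, ∫ w, |C z w| ∂ν ≤ A) (hA0 : 0 ≤ A)
    (t : ℝ) :
    ‖∫ ω, Complex.exp (Complex.I * ((t * cosFunctional ν Y C c ω : ℝ) : ℂ)) ∂μ -
      ((Real.exp (-(∫ ω, cosFunctional ν Y C c ω ^ 2 ∂μ) * t ^ 2 / 2) : ℝ) : ℂ)‖ ≤
      t ^ 2 * (4 * B ^ 2 * A * √(∫ q : Z × Z, C q.1 q.2 ^ 2 ∂(ν.prod ν))) := by
  set T := steinFactor ν Y C c with hT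
  have hTm := h.measurable_steinFactor (ν := ν) hc
  have hFm := h.measurable_cosFunctional (ν := ν) hc
  have hTb : ∀ s ∈ Ioc (0 : ℝ) 1, ∀ ω, |T (s, ω)| ≤ B ^ 2 * K * (ν.prod ν).real univ :=
    fun s hs ω => h.abs_steinFactor_le hK hB hs ω
  set Q : ℝ := ∫ q : Z × Z, C q.1 q.2 ^ 2 ∂(ν.prod ν) with hQ
  have hTae : ∀ᵐ p ∂(unitProd μ), |T p| ≤ B ^ 2 * K * (ν.prod ν).real univ := by
    filter_upwards [ae_fst_mem_unitProd μ] with p hp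
    exact hTb p.1 hp p.2
  refine norm_charFun_sub_gaussian_le (m := unitProd μ) (T := T) (π := Prod.snd) hFm
    (h.abs_cosFunctional_le hB) measurable_snd hTm.aestronglyMeasurable ⟨_, hTae⟩
    (fun t => h.integral_cosFunctional_mul_cexp hK hc hB hτ hYτ hcτ hCτ t) (fun t => ?_) t
  set E : Ω → ℂ := fun ω => Complex.exp (Complex.I * ((t * cosFunctional ν Y C c ω : ℝ) : ℂ)) with hE
  have hEm : Measurable E := by fun_prop
  have hE1 : ∀ ω, ‖E ω‖ = 1 := fun ω => norm_cexp_I_mul _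
  have i1 : Integrable (fun p => (T p : ℂ) * E p.2) (unitProd μ) := by
    refine Integrable.of_bound ((Complex.measurable_ofReal.comp hTm).mul
      (hEm.comp measurable_snd)).aestronglyMeasurable (B ^ 2 * K * (ν.prod ν).real univ) ?_
    filter_upwards [hTae] with p hp
    rwa [norm_mul, hE1, mul_one, Complex.norm_real]
  have i2 : Integrable T (unitProd μ) := Integrable.of_bound hTm.aestronglyMeasurable _ hTae
  have i3 : ∀ s ∈ Ioc (0 : ℝ) 1, Integrable (fun ω => T (s, ω)) μ := fun s hs =>
    Integrable.of_bound (hTm.comp measurable_prodMk_left).aestronglyMeasurable _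
      (Eventually.of_forall (hTb s hs))
  have i4 : Integrable E μ := Integrable.of_bound hEm.aestronglyMeasurable 1
    (Eventually.of_forall fun ω => (hE1 ω).le)
  have e1 : ∫ p, (T p : ℂ) * E p.2 ∂(unitProd μ) - ((∫ p, T p ∂(unitProd μ) : ℝ) : ℂ) *
      ∫ ω, E ω ∂μ = ∫ s in Ioc (0 : ℝ) 1, ((∫ ω, (T (s, ω) : ℂ) * E ω ∂μ) -
        ((∫ ω, T (s, ω) ∂μ : ℝ) : ℂ) * ∫ ω, E ω ∂μ) := by
    rw [integral_sub i1.integral_prod_left, integral_prod _ i1, integral_prod _ i2,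
      integral_mul_const, integral_complex_ofReal]
    exact i2.integral_prod_left.ofReal.mul_const _
  change ‖∫ p, (T p : ℂ) * E p.2 ∂(unitProd μ) - ((∫ p, T p ∂(unitProd μ) : ℝ) : ℂ) *
      ∫ ω, E ω ∂μ‖ ≤ _
  rw [e1]
  have hfin : ∀ s ∈ Ioc (0 : ℝ) 1, ‖(∫ ω, (T (s, ω) : ℂ) * E ω ∂μ) -
        ((∫ ω, T (s, ω) ∂μ : ℝ) : ℂ) * ∫ ω, E ω ∂μ‖ ≤ 4 * B ^ 2 * A * √Q := by
    intro s hs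
    set a : ℝ := ∫ ω, T (s, ω) ∂μ with ha
    have i5 : Integrable (fun ω => (T (s, ω) : ℂ) * E ω) μ :=
      (i3 s hs).ofReal.mul_bdd (c := 1) hEm.aestronglyMeasurable
        (Eventually.of_forall fun ω => (hE1 ω).le)
    have e2 : (∫ ω, (T (s, ω) : ℂ) * E ω ∂μ) - (a : ℂ) * ∫ ω, E ω ∂μ =
        ∫ ω, ((T (s, ω) - a : ℝ) : ℂ) * E ω ∂μ := by
      rw [← integral_const_mul, ← integral_sub i5 (i4.const_mul _)]
      congr 1; ext ω; push_cast; ring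
    rw [e2]
    have hsq := h.integral_sq_steinFactor_le hK hc hB hA hs
    set D : Ω → ℝ := fun ω => |T (s, ω) - a| with hD
    have hDm : MemLp D 2 μ := by
      refine MemLp.of_bound (C := 2 * (B ^ 2 * K * (ν.prod ν).real univ))
        (((hTm.comp measurable_prodMk_left).sub_const a).norm.aestronglyMeasurable)
        (Eventually.of_forall fun ω => ?_)
      have h1 : |a| ≤ B ^ 2 * K * (ν.prod ν).real univ := by
        have := norm_integral_le_of_norm_le_const (μ := μ) (f := fun ω => T (s, ω))
          (C := B ^ 2 * K * (ν.prod ν).real univ) (Eventually.of_forall (hTb s hs))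
        simpa using this
      rw [hD, Real.norm_eq_abs, abs_abs]
      have h2 := abs_sub (T (s, ω)) a
      linarith [hTb s hs ω]
    have hvar := variance_nonneg D μ
    rw [variance_eq_sub hDm] at hvar
    have hD2 : ∫ ω, D ω ^ 2 ∂μ ≤ (4 * B ^ 2 * A) ^ 2 * Q := by
      simp only [hD, sq_abs]
      exact hsq
    calc _ ≤ ∫ ω, ‖((T (s, ω) - a : ℝ) : ℂ) * E ω‖ ∂μ := norm_integral_le_integral_norm _
      _ = ∫ ω, D ω ∂μ := by
          congr 1; ext ω
          rw [norm_mul, hE1, mul_one, Complex.norm_real, Real.norm_eq_abs]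
      _ ≤ √((4 * B ^ 2 * A) ^ 2 * Q) := by
          refine Real.le_sqrt_of_sq_le ?_
          refine le_trans ?_ hD2
          have : (μ[D]) ^ 2 ≤ μ[D ^ 2] := by linarith
          simpa using this
      _ = _ := by
          rw [Real.sqrt_mul (sq_nonneg _), Real.sqrt_sq (by positivity)]
  have := norm_setIntegral_le_of_norm_le_const (μ := volume) (s := Ioc (0 : ℝ) 1)
    (by simp) hfin
  simpa using this

end IsGaussianField
end

section

/-- An integrable function orthogonal to all sines and cosines vanishes almost everywhere. -/
lemma ae_eq_zero_of_integral_cos_sin {P : Measure ℝ} [IsFiniteMeasure P] {f : ℝ → ℝ}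
    (hfm : Measurable f) (hf : Integrable f P) (hcos : ∀ t : ℝ, ∫ x, f x * Real.cos (t * x) ∂P = 0)
    (hsin : ∀ t : ℝ, ∫ x, f x * Real.sin (t * x) ∂P = 0) : f =ᵐ[P] 0 := by
  have hfin : ∀ g : ℝ → ℝ, Integrable g P → ∫⁻ x, ENNReal.ofReal (g x) ∂P ≠ ⊤ := fun g hg =>
    hg.lintegral_lt_top.ne
  have hm1 : Measurable (fun x => ENNReal.ofReal (f x)) := by fun_prop
  have hm2 : Measurable (fun x => ENNReal.ofReal (-f x)) := by fun_prop
  have : IsFiniteMeasure (P.withDensity fun x => ENNReal.ofReal (f x)) :=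
    isFiniteMeasure_withDensity (hfin f hf)
  have : IsFiniteMeasure (P.withDensity fun x => ENNReal.ofReal (-f x)) :=
    isFiniteMeasure_withDensity (hfin _ hf.neg)
  have hE : ∀ t : ℝ, AEStronglyMeasurable (fun x : ℝ => Complex.exp (t * x * Complex.I)) P :=
    fun t => by fun_prop
  have hE1 : ∀ t : ℝ, ∀ᵐ x : ℝ ∂P, ‖Complex.exp (t * x * Complex.I)‖ ≤ 1 := fun t =>
    Eventually.of_forall fun x => by
      have := Complex.norm_exp_ofReal_mul_I (t * x)
      push_cast at this
      exact this.le
  have key : (P.withDensity fun x => ENNReal.ofReal (f x)) =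
      P.withDensity fun x => ENNReal.ofReal (-f x) := by
    refine Measure.ext_of_charFun (funext fun t => ?_)
    rw [charFun_apply_real, charFun_apply_real, integral_withDensity_eq_integral_toReal_smul hm1
      (Eventually.of_forall fun x => ENNReal.ofReal_lt_top),
      integral_withDensity_eq_integral_toReal_smul hm2
      (Eventually.of_forall fun x => ENNReal.ofReal_lt_top), ← sub_eq_zero, ← integral_sub]
    · have e : ∀ x : ℝ, (ENNReal.ofReal (f x)).toReal • Complex.exp (t * x * Complex.I) -
          (ENNReal.ofReal (-f x)).toReal • Complex.exp (t * x * Complex.I) =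
          ((f x * Real.cos (t * x) : ℝ) : ℂ) + ((f x * Real.sin (t * x) : ℝ) : ℂ) * Complex.I := by
        intro x
        rw [← sub_smul, ENNReal.toReal_ofReal', ENNReal.toReal_ofReal', Complex.real_smul]
        have : max (f x) 0 - max (-f x) 0 = f x := by
          rcases le_total 0 (f x) with h | h
          · rw [max_eq_left h, max_eq_right (by linarith)]; ring
          · rw [max_eq_right h, max_eq_left (by linarith)]; ring
        rw [this, Complex.exp_mul_I]
        push_cast; ring
      simp_rw [e]
      have i1 : Integrable (fun x => f x * Real.cos (t * x)) P :=
        hf.mul_bdd (c := 1) (by fun_prop) (Eventually.of_forall fun x => Real.abs_cos_le_one _)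
      have i2 : Integrable (fun x => f x * Real.sin (t * x)) P :=
        hf.mul_bdd (c := 1) (by fun_prop) (Eventually.of_forall fun x => Real.abs_sin_le_one _)
      rw [integral_add i1.ofReal (i2.ofReal.mul_const _), integral_mul_const]
      rw [integral_complex_ofReal, integral_complex_ofReal, hcos, hsin]
      simp
    · exact (Integrable.mul_bdd (c := 1) (f := fun x => ((((ENNReal.ofReal (f x)).toReal : ℝ)) : ℂ))
        ((integrable_toReal_of_lintegral_ne_top hm1.aemeasurable (hfin f hf)).ofReal) (hE t) (hE1 t))
    · exact (Integrable.mul_bdd (c := 1) (f := fun x => ((((ENNReal.ofReal (-f x)).toReal : ℝ)) : ℂ))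
        ((integrable_toReal_of_lintegral_ne_top hm2.aemeasurable (hfin _ hf.neg)).ofReal) (hE t) (hE1 t))
  rw [withDensity_eq_iff hm1.aemeasurable hm2.aemeasurable (hfin f hf)] at key
  filter_upwards [key] with x hx
  simp only [Pi.zero_apply]
  rcases lt_trichotomy (f x) 0 with h | h | h
  · rw [ENNReal.ofReal_of_nonpos h.le] at hx
    have := ENNReal.ofReal_eq_zero.1 hx.symm
    linarith
  · exact h
  · rw [ENNReal.ofReal_of_nonpos (by linarith : -f x ≤ 0)] at hx
    have := ENNReal.ofReal_eq_zero.1 hx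
    linarith

/-- The cosine or sine of frequency `l` as a bounded continuous function. -/
noncomputable def trigBCF (i : ℝ × Bool) : BoundedContinuousFunction ℝ ℝ :=
  BoundedContinuousFunction.ofNormedAddCommGroup
    (fun y => if i.2 then Real.cos (i.1 * y) else Real.sin (i.1 * y))
    (by cases i.2 <;> simp <;> fun_prop) 1
    (fun y => by
      cases i.2
      · simpa using Real.abs_sin_le_one _
      · simpa using Real.abs_cos_le_one _)

lemma trigBCF_apply (i : ℝ × Bool) (y : ℝ) :
    trigBCF i y = if i.2 then Real.cos (i.1 * y) else Real.sin (i.1 * y) := rfl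

lemma dense_span_trigBCF (P : Measure ℝ) [IsFiniteMeasure P] :
    (Submodule.span ℝ (range fun i => BoundedContinuousFunction.toLp 2 P ℝ (trigBCF i))).topologicalClosure
      = ⊤ := by
  rw [Submodule.topologicalClosure_eq_top_iff, Submodule.eq_bot_iff]
  intro f hf
  have hfi : Integrable f P := (Lp.memLp f).integrable (by norm_num)
  have horth : ∀ i, ∫ x, f x * trigBCF i x ∂P = 0 := fun i => by
    have h1 := (Submodule.mem_orthogonal _ _).1 hf _ (Submodule.subset_span ⟨i, rfl⟩)
    rw [L2.inner_def] at h1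
    rw [← h1]
    refine integral_congr_ae ?_
    filter_upwards [BoundedContinuousFunction.coeFn_toLp 2 P ℝ (trigBCF i)] with x hx
    rw [hx]
    simp
  have h0 := ae_eq_zero_of_integral_cos_sin (Lp.stronglyMeasurable f).measurable hfi
    (fun t => by simpa [trigBCF_apply] using horth (t, true))
    (fun t => by simpa [trigBCF_apply] using horth (t, false))
  exact (Lp.eq_zero_iff_ae_eq_zero).2 h0

/-- The even trigonometric polynomial `∑ a_j cos(l_j y)`. -/
noncomputable def evenTrig {N : ℕ} (a l : Fin N → ℝ) (y : ℝ) : ℝ := ∑ j, a j * Real.cos (l j * y)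

lemma continuous_evenTrig {N : ℕ} (a l : Fin N → ℝ) : Continuous (evenTrig a l) := by
  unfold evenTrig; fun_prop

lemma abs_evenTrig_le {N : ℕ} (a l : Fin N → ℝ) (y : ℝ) : |evenTrig a l y| ≤ ∑ j, |a j| := by
  refine (Finset.abs_sum_le_sum_abs _ _).trans (Finset.sum_le_sum fun j _ => ?_)
  rw [abs_mul]
  exact mul_le_of_le_one_right (abs_nonneg _) (Real.abs_cos_le_one _)

lemma memLp_evenTrig {N : ℕ} (a l : Fin N → ℝ) (P : Measure ℝ) [IsFiniteMeasure P] :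
    MemLp (evenTrig a l) 2 P :=
  MemLp.of_bound (continuous_evenTrig a l).aestronglyMeasurable (∑ j, |a j|)
    (Eventually.of_forall (abs_evenTrig_le a l))

/-- Even square integrable functions are approximated by even trigonometric polynomials. -/
lemma exists_evenTrig_approx {P : Measure ℝ} [IsFiniteMeasure P]
    (hneg : MeasurePreserving (fun x : ℝ => -x) P P) {u : ℝ → ℝ} (hu : MemLp u 2 P)
    (heven : ∀ y, u (-y) = u y) {ε : ℝ} (hε : 0 < ε) :
    ∃ (N : ℕ) (a l : Fin N → ℝ), ∫ y, (u y - evenTrig a l y) ^ 2 ∂P < ε := by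
  have hd := dense_span_trigBCF P
  have hmem : hu.toLp u ∈ closure ((Submodule.span ℝ (range fun i =>
      BoundedContinuousFunction.toLp 2 P ℝ (trigBCF i)) : Submodule ℝ (Lp ℝ 2 P)) : Set (Lp ℝ 2 P)) := by
    rw [← Submodule.topologicalClosure_coe, hd]; trivial
  obtain ⟨w, hw, hdist⟩ := Metric.mem_closure_iff.1 hmem (√ε) (Real.sqrt_pos.2 hε)
  obtain ⟨c, rfl⟩ := Finsupp.mem_span_range_iff_exists_finsupp.1 hw
  set b : BoundedContinuousFunction ℝ ℝ := c.sum fun i r => r • trigBCF i with hb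
  have hbl : (c.sum fun i r => r • BoundedContinuousFunction.toLp 2 P ℝ (trigBCF i)) =
      BoundedContinuousFunction.toLp 2 P ℝ b := by
    rw [hb, Finsupp.sum, Finsupp.sum, map_sum]
    simp_rw [map_smul]
  rw [hbl] at hdist
  have hbm : MemLp b 2 P := MemLp.of_bound b.continuous.aestronglyMeasurable ‖b‖
    (Eventually.of_forall b.norm_coe_le_norm)
  have h1 : ∫ y, (u y - b y) ^ 2 ∂P < ε := by
    have h2 : ‖hu.toLp u - BoundedContinuousFunction.toLp 2 P ℝ b‖ ^ 2 < ε := by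
      rw [← dist_eq_norm]
      calc _ < √ε ^ 2 := by gcongr
        _ = ε := Real.sq_sqrt hε.le
    rw [← real_inner_self_eq_norm_sq, L2.inner_def] at h2
    refine lt_of_eq_of_lt (integral_congr_ae ?_) h2
    filter_upwards [Lp.coeFn_sub (hu.toLp u) (BoundedContinuousFunction.toLp 2 P ℝ b),
      hu.coeFn_toLp, BoundedContinuousFunction.coeFn_toLp 2 P ℝ b] with x hx1 hx2 hx3
    rw [hx1, Pi.sub_apply, hx2, hx3]
    simp [sq]
  set e := c.support.equivFin with he
  refine ⟨c.support.card, fun j => if (e.symm j).1.2 then c (e.symm j).1 else 0,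
    fun j => (e.symm j).1.1, ?_⟩
  set g := evenTrig (fun j => if (e.symm j).1.2 then c (e.symm j).1 else 0)
    (fun j => (e.symm j).1.1) with hg
  have hgb : ∀ y, g y = (b y + b (-y)) / 2 := fun y => by
    have hby : ∀ y, b y = ∑ j, c (e.symm j).1 * trigBCF (e.symm j).1 y := fun y => by
      rw [Equiv.sum_comp e.symm (fun i : c.support => c i.1 * trigBCF i.1 y)]
      rw [Finset.sum_coe_sort c.support (fun i => c i * trigBCF i y), hb, Finsupp.sum]
      simp
    rw [hby, hby, hg, evenTrig, ← Finset.sum_add_distrib, Finset.sum_div]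
    refine Finset.sum_congr rfl fun j _ => ?_
    simp only [trigBCF_apply]
    split_ifs
    · rw [mul_neg, Real.cos_neg]; ring
    · rw [mul_neg, Real.sin_neg]; ring
  have i1 : Integrable (fun y => (u y - b y) ^ 2) P := (hu.sub hbm).integrable_sq
  have i2 : Integrable (fun y => (u (-y) - b (-y)) ^ 2) P :=
    (MemLp.comp_measurePreserving (hu.sub hbm) hneg).integrable_sq
  have e2 : ∫ y, (u (-y) - b (-y)) ^ 2 ∂P = ∫ y, (u y - b y) ^ 2 ∂P := by
    conv_rhs => rw [← hneg.map_eq]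
    refine (integral_map (f := fun y => (u y - b y) ^ 2) hneg.measurable.aemeasurable ?_).symm
    rw [hneg.map_eq]
    exact i1.aestronglyMeasurable
  refine lt_of_le_of_lt ?_ h1
  calc ∫ y, (u y - g y) ^ 2 ∂P ≤ ∫ y, ((u y - b y) ^ 2 + (u (-y) - b (-y)) ^ 2) / 2 ∂P := by
        refine integral_mono ((hu.sub (memLp_evenTrig _ _ P)).integrable_sq)
          ((i1.add i2).div_const 2) fun y => ?_
        simp only
        rw [hgb, heven]
        nlinarith [sq_nonneg ((u y - b y) - (u y - b (-y)))]
    _ = ∫ y, (u y - b y) ^ 2 ∂P := by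
        rw [integral_div, integral_add i1 i2, e2]; ring

/-- Integrals of products are continuous for mean square convergence. -/
lemma tendsto_integral_mul_of_tendsto_sq {α : Type*} [MeasurableSpace α] {P : Measure α}
    {f g : ℕ → α → ℝ} {f₀ g₀ : α → ℝ} (hf : ∀ n, MemLp (f n) 2 P) (hg : ∀ n, MemLp (g n) 2 P)
    (hf₀ : MemLp f₀ 2 P) (hg₀ : MemLp g₀ 2 P)
    (hfl : Tendsto (fun n => ∫ x, (f₀ x - f n x) ^ 2 ∂P) atTop (𝓝 0))
    (hgl : Tendsto (fun n => ∫ x, (g₀ x - g n x) ^ 2 ∂P) atTop (𝓝 0)) :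
    Tendsto (fun n => ∫ x, f n x * g n x ∂P) atTop (𝓝 (∫ x, f₀ x * g₀ x ∂P)) := by
  have key : ∀ (f : ℕ → α → ℝ) (f₀ : α → ℝ) (hf : ∀ n, MemLp (f n) 2 P) (hf₀ : MemLp f₀ 2 P)
      (_ : Tendsto (fun n => ∫ x, (f₀ x - f n x) ^ 2 ∂P) atTop (𝓝 0)),
      Tendsto (fun n => (hf n).toLp (f n)) atTop (𝓝 (hf₀.toLp f₀)) := by
    intro f f₀ hf hf₀ hl
    rw [tendsto_iff_norm_sub_tendsto_zero]
    have : ∀ n, ‖(hf n).toLp (f n) - hf₀.toLp f₀‖ = √(∫ x, (f₀ x - f n x) ^ 2 ∂P) := fun n => by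
      rw [norm_sub_rev, ← MemLp.toLp_sub, ← Real.sqrt_sq (norm_nonneg _),
        ← real_inner_self_eq_norm_sq, L2.inner_def]
      congr 1
      refine integral_congr_ae ?_
      filter_upwards [(hf₀.sub (hf n)).coeFn_toLp] with x hx
      rw [hx]; simp [sq]
    simp_rw [this]
    simpa using hl.sqrt
  have h := (key f f₀ hf hf₀ hfl).inner (𝕜 := ℝ) (key g g₀ hg hg₀ hgl)
  have e : ∀ (f g : α → ℝ) (hf : MemLp f 2 P) (hg : MemLp g 2 P),
      inner ℝ (hf.toLp f) (hg.toLp g) = ∫ x, f x * g x ∂P := fun f g hf hg => by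
    rw [L2.inner_def]
    refine integral_congr_ae ?_
    filter_upwards [hf.coeFn_toLp, hg.coeFn_toLp] with x h1 h2
    rw [h1, h2]; simp [mul_comm]
  simpa only [e] using h

/-- Comparison of covariances of even trigonometric polynomials with the square of the
correlation. -/
lemma cosh_quadratic_bounds {N : ℕ} (b l : Fin N → ℝ) {ρ : ℝ} (hρ : |ρ| ≤ 1) :
    ρ ^ 2 / 2 * (∑ j, b j * l j ^ 2) ^ 2 ≤
      ∑ j, ∑ k, b j * b k * (Real.cosh (l j * l k * ρ) - 1) ∧
    ∑ j, ∑ k, b j * b k * (Real.cosh (l j * l k * ρ) - 1) ≤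
      ρ ^ 2 * ∑ j, ∑ k, b j * b k * (Real.cosh (l j * l k) - 1) := by
  set S : ℕ → ℝ := fun n => (∑ j, b j * l j ^ (2 * n)) ^ 2 / ((2 * n).factorial : ℝ) with hS
  have hS0 : ∀ n, 0 ≤ S n := fun n => by positivity
  have hsum : ∀ r : ℝ, HasSum (fun n => r ^ (2 * n) * S n)
      (∑ j, ∑ k, b j * b k * Real.cosh (l j * l k * r)) := fun r => by
    have h1 := hasSum_sum (s := Finset.univ) fun j (_ : j ∈ Finset.univ) =>
      hasSum_sum (s := Finset.univ) fun k (_ : k ∈ Finset.univ) =>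
        (Real.hasSum_cosh (l j * l k * r)).mul_left (b j * b k)
    have e : (fun n => ∑ j, ∑ k, b j * b k * ((l j * l k * r) ^ (2 * n) / ((2 * n).factorial : ℝ))) =
        fun n => r ^ (2 * n) * S n := by
      ext n
      rw [hS]
      simp only
      rw [sq, Finset.sum_mul_sum, Finset.sum_div, Finset.mul_sum]
      refine Finset.sum_congr rfl fun j _ => ?_
      rw [Finset.sum_div, Finset.mul_sum]
      refine Finset.sum_congr rfl fun k _ => ?_
      rw [mul_pow, mul_pow]
      ring
    rw [e] at h1
    exact h1
  have hS00 : S 0 = ∑ j, ∑ k, b j * b k := by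
    simp [hS, sq, Finset.sum_mul_sum]
  have hS1 : S 1 = (∑ j, b j * l j ^ 2) ^ 2 / 2 := by
    simp [hS, Nat.factorial]
  have hρ2 : ρ ^ 2 ≤ 1 := by rw [← sq_abs]; nlinarith [abs_nonneg ρ]
  simp_rw [mul_sub, mul_one, Finset.sum_sub_distrib, ← hS00]
  constructor
  · have h1 := sum_le_hasSum (Finset.range 2) (fun n _ => mul_nonneg (by
      rw [pow_mul]; positivity) (hS0 n)) (hsum ρ)
    rw [Finset.sum_range_succ, Finset.sum_range_one, hS1] at h1
    simp only [mul_zero, pow_zero, one_mul, mul_one] at h1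
    linarith
  · have h2 := sum_le_hasSum {0} (fun n hn => ?_) (((hsum 1).mul_left (ρ ^ 2)).sub (hsum ρ))
    · simp only [Finset.sum_singleton, mul_zero, pow_zero, one_mul, mul_one] at h2
      linarith
    · obtain ⟨m, rfl⟩ := Nat.exists_eq_succ_of_ne_zero (Finset.notMem_singleton.1 hn)
      have h3 : ρ ^ (2 * (m + 1)) ≤ ρ ^ 2 := by
        rw [pow_mul, pow_succ]
        exact mul_le_of_le_one_left (sq_nonneg _) (pow_le_one₀ (sq_nonneg _) hρ2)
      rw [one_pow, one_mul, ← sub_mul]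
      exact mul_nonneg (sub_nonneg.2 h3) (hS0 _)

end

section

lemma integral_cexp_gaussianReal (t : ℝ) :
    ∫ y, Complex.exp (t * y * Complex.I) ∂(gaussianReal 0 1) = Complex.exp (-(t : ℂ) ^ 2 / 2) := by
  have := charFun_gaussianReal (μ := 0) (v := 1) t
  rw [charFun_apply_real] at this
  rw [this]; congr 1; simp; ring

lemma integral_cos_gaussianReal (t : ℝ) :
    ∫ y, Real.cos (t * y) ∂(gaussianReal 0 1) = Real.exp (-t ^ 2 / 2) := by
  have h1 := integral_cexp_gaussianReal t
  have hi : Integrable (fun y : ℝ => Complex.exp (t * y * Complex.I)) (gaussianReal 0 1) :=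
    Integrable.of_bound (by fun_prop) 1 (Eventually.of_forall fun x => by
      have := Complex.norm_exp_ofReal_mul_I (t * x)
      push_cast at this
      exact this.le)
  have h2 := congrArg Complex.re h1
  have h3 : (Complex.exp (-(t : ℂ) ^ 2 / 2)).re = Real.exp (-t ^ 2 / 2) := by
    have : -(t : ℂ) ^ 2 / 2 = ((-t ^ 2 / 2 : ℝ) : ℂ) := by push_cast; ring
    rw [this, Complex.exp_ofReal_re]
  rw [h3] at h2
  rw [← h2]
  refine Eq.trans ?_ (integral_re (𝕜 := ℂ) hi)
  congr 1; ext y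
  change _ = (Complex.exp _).re
  rw [← Complex.ofReal_mul, Complex.exp_ofReal_mul_I_re]

lemma memLp_id_sq_sub_one_gaussianReal : MemLp (fun y : ℝ => y ^ 2 - 1) 2 (gaussianReal 0 1) := by
  have h4 := (memLp_id_gaussianReal' (μ := 0) (v := 1) 4 (by norm_num)).norm_rpow_div 2
  have : (4 : ENNReal) / 2 = 2 := by
    rw [show (4 : ENNReal) = 2 * 2 by norm_num]
    exact ENNReal.mul_div_cancel_right (by norm_num) (by norm_num)
  rw [this] at h4
  refine MemLp.sub (MemLp.ae_eq ?_ h4) (memLp_const 1)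
  refine Eventually.of_forall fun x => ?_
  simp

lemma integral_cos_mul_sq_sub_one_gaussianReal (t : ℝ) :
    ∫ y, Real.cos (t * y) * (y ^ 2 - 1) ∂(gaussianReal 0 1) = -t ^ 2 * Real.exp (-t ^ 2 / 2) := by
  have h0 := iteratedDeriv_charFun (μ := (gaussianReal 0 1)) (n := 2) (t := t) (by exact_mod_cast memLp_id_gaussianReal 2)
  have hc : charFun (gaussianReal 0 1) = fun t : ℝ => ((Real.exp (-t ^ 2 / 2) : ℝ) : ℂ) := by
    ext s
    rw [charFun_apply_real, integral_cexp_gaussianReal]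
    push_cast; rfl
  have d1 : ∀ s : ℝ, HasDerivAt (fun t : ℝ => Real.exp (-t ^ 2 / 2)) (-s * Real.exp (-s ^ 2 / 2)) s :=
    fun s => by
      have := (((hasDerivAt_pow 2 s).neg).div_const 2).exp
      exact this.congr_deriv (by norm_num; ring)
  have d2 : ∀ s : ℝ, HasDerivAt (fun s : ℝ => -s * Real.exp (-s ^ 2 / 2))
      ((s ^ 2 - 1) * Real.exp (-s ^ 2 / 2)) s := fun s => by
    have := ((hasDerivAt_id s).neg).mul (d1 s)
    exact this.congr_deriv (by simp; ring)
  have h1 : iteratedDeriv 2 (charFun (gaussianReal 0 1)) t = (((t ^ 2 - 1) * Real.exp (-t ^ 2 / 2) : ℝ) : ℂ) := by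
    rw [iteratedDeriv_succ, iteratedDeriv_one, hc]
    have e : deriv (fun t : ℝ => ((Real.exp (-t ^ 2 / 2) : ℝ) : ℂ)) =
        fun s : ℝ => ((-s * Real.exp (-s ^ 2 / 2) : ℝ) : ℂ) := funext fun s => ((d1 s).ofReal_comp).deriv
    rw [e]
    exact ((d2 t).ofReal_comp).deriv
  have hsq : Integrable (fun y : ℝ => y ^ 2) (gaussianReal 0 1) :=
    ((memLp_id_gaussianReal (μ := 0) (v := 1) 2).integrable_sq)
  have hEm : AEStronglyMeasurable (fun y : ℝ => Complex.exp (t * y * Complex.I)) (gaussianReal 0 1) := by fun_prop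
  have hi : Integrable (fun y : ℝ => (y : ℂ) ^ 2 * Complex.exp (t * y * Complex.I)) (gaussianReal 0 1) := by
    have : Integrable (fun y : ℝ => ((y ^ 2 : ℝ) : ℂ) * Complex.exp (t * y * Complex.I)) (gaussianReal 0 1) :=
      hsq.ofReal.mul_bdd (c := 1) hEm (Eventually.of_forall fun x => by
        have := Complex.norm_exp_ofReal_mul_I (t * x)
        push_cast at this
        exact this.le)
    simpa using this
  have h2 : ∫ y, y ^ 2 * Real.cos (t * y) ∂(gaussianReal 0 1) = (1 - t ^ 2) * Real.exp (-t ^ 2 / 2) := by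
    rw [h1, Complex.I_sq] at h0
    have h3 : ∫ y : ℝ, (y : ℂ) ^ 2 * Complex.exp (t * y * Complex.I) ∂(gaussianReal 0 1) =
        (((1 - t ^ 2) * Real.exp (-t ^ 2 / 2) : ℝ) : ℂ) := by
      have : (((1 - t ^ 2) * Real.exp (-t ^ 2 / 2) : ℝ) : ℂ) =
        -(((t ^ 2 - 1) * Real.exp (-t ^ 2 / 2) : ℝ) : ℂ) := by push_cast; ring
      rw [this, h0]; ring
    have h4 := congrArg Complex.re h3
    rw [Complex.ofReal_re] at h4
    rw [← h4]
    refine Eq.trans ?_ (integral_re (𝕜 := ℂ) hi)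
    congr 1; ext y
    change _ = ((y : ℂ) ^ 2 * Complex.exp _).re
    rw [← Complex.ofReal_mul, ← Complex.ofReal_pow, Complex.re_ofReal_mul,
      Complex.exp_ofReal_mul_I_re]
  have hcm : AEStronglyMeasurable (fun y : ℝ => Real.cos (t * y)) (gaussianReal 0 1) := by fun_prop
  have i1 : Integrable (fun y : ℝ => y ^ 2 * Real.cos (t * y)) (gaussianReal 0 1) :=
    hsq.mul_bdd (c := 1) hcm (Eventually.of_forall fun x => Real.abs_cos_le_one _)
  have i2 : Integrable (fun y : ℝ => Real.cos (t * y)) (gaussianReal 0 1) :=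
    Integrable.of_bound hcm 1 (Eventually.of_forall fun x => Real.abs_cos_le_one _)
  have e : ∀ y : ℝ, Real.cos (t * y) * (y ^ 2 - 1) = y ^ 2 * Real.cos (t * y) - Real.cos (t * y) :=
    fun y => by ring
  simp_rw [e]
  rw [integral_sub i1 i2, h2, integral_cos_gaussianReal]
  ring

variable {Z Z' Ω : Type*} [MeasurableSpace Z] [MeasurableSpace Z'] [MeasurableSpace Ω]
  {μ : Measure Ω} [IsProbabilityMeasure μ] {Y : Z → Ω → ℝ} {C : Z → Z → ℝ}

namespace IsGaussianField

/-- Rescaling and reindexing of a Gaussian field. -/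
lemma reindex (h : IsGaussianField Y C μ) {f : Z' → Z} (hf : Measurable f) {l : Z' → ℝ}
    (hl : Measurable l) : IsGaussianField (fun z ω => l z * Y (f z) ω)
      (fun z w => l z * l w * C (f z) (f w)) μ where
  measurable := by
    have h1 : Measurable (fun q : Z' × Ω => (f q.1, q.2)) := by fun_prop
    exact (hl.comp measurable_fst).mul (h.measurable.comp h1)
  measurable_cov := by
    have h1 : Measurable (fun q : Z' × Z' => (f q.1, f q.2)) := by fun_prop
    exact ((hl.comp measurable_fst).mul (hl.comp measurable_snd)).mul (h.measurable_cov.comp h1)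
  symm z w := by rw [h.symm (f z)]; ring
  integral_cexp ι _ z a := by
    have := h.integral_cexp ι (fun k => f (z k)) (fun k => a k * l (z k))
    simp only [mul_assoc] at this ⊢
    rw [this]
    congr 4
    refine Finset.sum_congr rfl fun k _ => Finset.sum_congr rfl fun j _ => by ring

lemma map_eq_gaussianReal (h : IsGaussianField Y C μ) {z : Z} (hz : C z z = 1) :
    μ.map (Y z) = (gaussianReal 0 1) := by
  have hm := h.measurable_apply z
  have : IsProbabilityMeasure (μ.map (Y z)) := Measure.isProbabilityMeasure_map hm.aemeasurable
  refine Measure.ext_of_charFun (funext fun t => ?_)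
  rw [charFun_apply_real, charFun_apply_real, integral_cexp_gaussianReal,
    integral_map hm.aemeasurable (by fun_prop)]
  have h1 := h.integral_cexp_pair z z t 0
  rw [hz] at h1
  have e : ∀ ω, Complex.exp (t * (Y z ω : ℂ) * Complex.I) =
      Complex.exp (Complex.I * ((t * Y z ω + 0 * Y z ω : ℝ) : ℂ)) := fun ω => by
    congr 1; push_cast; ring
  simp_rw [e, h1]
  push_cast; congr 1; ring

lemma measurePreserving (h : IsGaussianField Y C μ) {z : Z} (hz : C z z = 1) :
    MeasurePreserving (Y z) μ (gaussianReal 0 1) :=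
  ⟨h.measurable_apply z, h.map_eq_gaussianReal hz⟩

lemma integral_cos_mul_cos_eq (h : IsGaussianField Y C μ) {x y : Z} (hx : C x x = 1)
    (hy : C y y = 1) (a b : ℝ) :
    ∫ ω, Real.cos (a * Y x ω) * Real.cos (b * Y y ω) ∂μ =
      Real.exp (-a ^ 2 / 2) * Real.exp (-b ^ 2 / 2) * Real.cosh (a * b * C x y) := by
  have h1 := (h.reindex (Z' := Bool) (f := fun i => if i then x else y) (by fun_prop)
    (l := fun i => if i then a else b) (by fun_prop)).integral_cos_mul_cos true false
  simp only [if_true, Bool.false_eq_true, if_false, hx, hy, mul_one] at h1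
  rw [h1, ← Real.exp_add]
  congr 2; ring

lemma evenTrig_cov (h : IsGaussianField Y C μ) {x y : Z} (hx : C x x = 1)
    (hy : C y y = 1) {N : ℕ} (a l : Fin N → ℝ) :
    ∫ ω, evenTrig a l (Y x ω) * evenTrig a l (Y y ω) ∂μ - (∫ z, evenTrig a l z ∂(gaussianReal 0 1)) ^ 2 =
      ∑ j, ∑ k, (a j * Real.exp (-l j ^ 2 / 2)) * (a k * Real.exp (-l k ^ 2 / 2)) *
        (Real.cosh (l j * l k * C x y) - 1) := by
  have m1 := h.measurable_apply x
  have m2 := h.measurable_apply y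
  have e1 : ∫ ω, evenTrig a l (Y x ω) * evenTrig a l (Y y ω) ∂μ =
      ∑ j, ∑ k, (a j * Real.exp (-l j ^ 2 / 2)) * (a k * Real.exp (-l k ^ 2 / 2)) *
        Real.cosh (l j * l k * C x y) := by
    have i : ∀ j k, Integrable (fun ω => a j * Real.cos (l j * Y x ω) *
        (a k * Real.cos (l k * Y y ω))) μ := fun j k =>
      Integrable.of_bound (by fun_prop) (|a j| * |a k|) (Eventually.of_forall fun ω => by
        rw [norm_mul, norm_mul, norm_mul]
        have h1 := Real.abs_cos_le_one (l j * Y x ω)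
        have h2 := Real.abs_cos_le_one (l k * Y y ω)
        simp only [Real.norm_eq_abs]
        calc _ ≤ (|a j| * 1) * (|a k| * 1) := by gcongr
          _ = _ := by ring)
    simp_rw [evenTrig, Finset.sum_mul_sum]
    rw [integral_finsetSum _ fun j _ => integrable_finsetSum _ fun k _ => i j k]
    refine Finset.sum_congr rfl fun j _ => ?_
    rw [integral_finsetSum _ fun k _ => i j k]
    refine Finset.sum_congr rfl fun k _ => ?_
    have e : ∀ ω, a j * Real.cos (l j * Y x ω) * (a k * Real.cos (l k * Y y ω)) =
      a j * a k * (Real.cos (l j * Y x ω) * Real.cos (l k * Y y ω)) := fun ω => by ring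
    simp_rw [e]
    rw [integral_const_mul, h.integral_cos_mul_cos_eq hx hy]
    ring
  have e2 : ∫ z, evenTrig a l z ∂(gaussianReal 0 1) = ∑ j, a j * Real.exp (-l j ^ 2 / 2) := by
    simp_rw [evenTrig]
    rw [integral_finsetSum _ fun j _ => Integrable.of_bound (by fun_prop) |a j|
      (Eventually.of_forall fun ω => by
        rw [norm_mul]
        exact mul_le_of_le_one_right (norm_nonneg _) (Real.abs_cos_le_one _))]
    simp_rw [integral_const_mul, integral_cos_gaussianReal]
  rw [e1, e2, sq, Finset.sum_mul_sum, ← Finset.sum_sub_distrib]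
  refine Finset.sum_congr rfl fun j _ => ?_
  rw [← Finset.sum_sub_distrib]
  exact Finset.sum_congr rfl fun k _ => by ring

lemma abs_cov_le_one (h : IsGaussianField Y C μ) {x y : Z} (hx : C x x = 1)
    (hy : C y y = 1) : |C x y| ≤ 1 := by
  have := h.abs_cov_le x y
  rw [hx, hy] at this
  linarith

lemma evenTrig_cov_bounds (h : IsGaussianField Y C μ) {x y : Z} (hx : C x x = 1)
    (hy : C y y = 1) {N : ℕ} (a l : Fin N → ℝ) :
    C x y ^ 2 / 2 * (∫ z, evenTrig a l z * (z ^ 2 - 1) ∂(gaussianReal 0 1)) ^ 2 ≤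
      ∫ ω, evenTrig a l (Y x ω) * evenTrig a l (Y y ω) ∂μ - (∫ z, evenTrig a l z ∂(gaussianReal 0 1)) ^ 2 ∧
    ∫ ω, evenTrig a l (Y x ω) * evenTrig a l (Y y ω) ∂μ - (∫ z, evenTrig a l z ∂(gaussianReal 0 1)) ^ 2 ≤
      C x y ^ 2 * (∫ z, evenTrig a l z * evenTrig a l z ∂(gaussianReal 0 1) - (∫ z, evenTrig a l z ∂(gaussianReal 0 1)) ^ 2) := by
  have hb := cosh_quadratic_bounds (fun j => a j * Real.exp (-l j ^ 2 / 2)) l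
    (h.abs_cov_le_one hx hy)
  have h1 : ∫ z, evenTrig a l z * (z ^ 2 - 1) ∂(gaussianReal 0 1) =
      -∑ j, a j * Real.exp (-l j ^ 2 / 2) * l j ^ 2 := by
    simp_rw [evenTrig, Finset.sum_mul, mul_assoc]
    rw [integral_finsetSum, ← Finset.sum_neg_distrib]
    · refine Finset.sum_congr rfl fun j _ => ?_
      rw [integral_const_mul, integral_cos_mul_sq_sub_one_gaussianReal]; ring
    · intro j _
      refine Integrable.const_mul ?_ _
      exact (memLp_id_sq_sub_one_gaussianReal.integrable (by norm_num)).bdd_mul (c := 1)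
        (by fun_prop) (Eventually.of_forall fun x => Real.abs_cos_le_one _)
  have h2 : ∫ z, evenTrig a l z * evenTrig a l z ∂(gaussianReal 0 1) - (∫ z, evenTrig a l z ∂(gaussianReal 0 1)) ^ 2 =
      ∑ j, ∑ k, (a j * Real.exp (-l j ^ 2 / 2)) * (a k * Real.exp (-l k ^ 2 / 2)) *
        (Real.cosh (l j * l k) - 1) := by
    have h3 := h.evenTrig_cov hx hx a l
    rw [hx] at h3
    simp only [mul_one] at h3
    rw [← h3, ← h.map_eq_gaussianReal hx]
    have hc := continuous_evenTrig a l
    rw [integral_map (f := fun z => evenTrig a l z * evenTrig a l z)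
      (h.measurable_apply x).aemeasurable (hc.mul hc).aestronglyMeasurable]
  rw [h1, h2, h.evenTrig_cov hx hy, neg_sq]
  exact hb

/-- Covariances of even functions of a Gaussian pair are comparable to the squared correlation. -/
lemma even_cov_bounds (h : IsGaussianField Y C μ) {x y : Z} (hx : C x x = 1)
    (hy : C y y = 1) {u : ℝ → ℝ} (hu : MemLp u 2 (gaussianReal 0 1)) (heven : ∀ z, u (-z) = u z) :
    C x y ^ 2 / 2 * (∫ z, u z * (z ^ 2 - 1) ∂(gaussianReal 0 1)) ^ 2 ≤
      ∫ ω, u (Y x ω) * u (Y y ω) ∂μ - (∫ z, u z ∂(gaussianReal 0 1)) ^ 2 ∧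
    ∫ ω, u (Y x ω) * u (Y y ω) ∂μ - (∫ z, u z ∂(gaussianReal 0 1)) ^ 2 ≤
      C x y ^ 2 * (∫ z, u z * u z ∂(gaussianReal 0 1) - (∫ z, u z ∂(gaussianReal 0 1)) ^ 2) := by
  have hneg : MeasurePreserving (fun x : ℝ => -x) (gaussianReal 0 1) (gaussianReal 0 1) :=
    ⟨measurable_neg, by rw [gaussianReal_map_neg, neg_zero]⟩
  choose N a l hal using fun n : ℕ => exists_evenTrig_approx hneg hu heven
    (Nat.one_div_pos_of_nat (n := n) (α := ℝ))
  have hl : Tendsto (fun n => ∫ z, (u z - evenTrig (a n) (l n) z) ^ 2 ∂(gaussianReal 0 1)) atTop (𝓝 0) :=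
    squeeze_zero (fun n => integral_nonneg fun _ => sq_nonneg _) (fun n => (hal n).le)
      tendsto_one_div_add_atTop_nhds_zero_nat
  have hg : ∀ n, MemLp (evenTrig (a n) (l n)) 2 (gaussianReal 0 1) := fun n => memLp_evenTrig _ _ _
  have lc : ∀ v : ℝ → ℝ, MemLp v 2 (gaussianReal 0 1) → Tendsto (fun n => ∫ z, evenTrig (a n) (l n) z * v z ∂(gaussianReal 0 1)) atTop
      (𝓝 (∫ z, u z * v z ∂(gaussianReal 0 1))) := fun v hv =>
    tendsto_integral_mul_of_tendsto_sq (g := fun _ => v) hg (fun _ => hv) hu hv hl (by simp)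
  have l1 : Tendsto (fun n => ∫ z, evenTrig (a n) (l n) z ∂(gaussianReal 0 1)) atTop (𝓝 (∫ z, u z ∂(gaussianReal 0 1))) := by
    simpa using lc (fun _ => 1) (memLp_const 1)
  have l2 := lc _ memLp_id_sq_sub_one_gaussianReal
  have l3 : Tendsto (fun n => ∫ z, evenTrig (a n) (l n) z * evenTrig (a n) (l n) z ∂(gaussianReal 0 1)) atTop
      (𝓝 (∫ z, u z * u z ∂(gaussianReal 0 1))) := tendsto_integral_mul_of_tendsto_sq hg hg hu hu hl hl
  have px := h.measurePreserving hx
  have py := h.measurePreserving hy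
  have ltr : ∀ {z : Z} (_ : MeasurePreserving (Y z) μ (gaussianReal 0 1)), Tendsto (fun n =>
      ∫ ω, ((u ∘ Y z) ω - (evenTrig (a n) (l n) ∘ Y z) ω) ^ 2 ∂μ) atTop (𝓝 0) := fun {z} pz => by
    refine hl.congr fun n => ?_
    rw [← pz.map_eq, integral_map pz.measurable.aemeasurable]
    · rfl
    · rw [pz.map_eq]
      exact ((hu.sub (hg n)).integrable_sq).aestronglyMeasurable
  have l4 : Tendsto (fun n => ∫ ω, evenTrig (a n) (l n) (Y x ω) * evenTrig (a n) (l n) (Y y ω) ∂μ)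
      atTop (𝓝 (∫ ω, u (Y x ω) * u (Y y ω) ∂μ)) :=
    tendsto_integral_mul_of_tendsto_sq (fun n => (hg n).comp_measurePreserving px)
      (fun n => (hg n).comp_measurePreserving py) (hu.comp_measurePreserving px)
      (hu.comp_measurePreserving py) (ltr px) (ltr py)
  have hb := fun n => h.evenTrig_cov_bounds hx hy (a n) (l n)
  exact ⟨le_of_tendsto_of_tendsto' ((l2.pow 2).const_mul _) (l4.sub (l1.pow 2)) fun n => (hb n).1,
    le_of_tendsto_of_tendsto' (l4.sub (l1.pow 2)) ((l3.sub (l1.pow 2)).const_mul _)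
      fun n => (hb n).2⟩

end IsGaussianField
end

section

lemma abs_integral_mul_le_sqrt {α : Type*} [MeasurableSpace α] {P : Measure α} {f g : α → ℝ}
    (hf : MemLp f 2 P) (hg : MemLp g 2 P) :
    |∫ x, f x * g x ∂P| ≤ √(∫ x, f x ^ 2 ∂P) * √(∫ x, g x ^ 2 ∂P) := by
  have i1 := hf.integrable_sq
  have i2 := hg.integrable_sq
  have i3 : Integrable (fun x => f x * g x) P := hf.integrable_mul hg
  have hq : ∀ s : ℝ, 0 ≤ (∫ x, f x ^ 2 ∂P) * (s * s) + (2 * ∫ x, f x * g x ∂P) * s +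
      ∫ x, g x ^ 2 ∂P := fun s => by
    have e : ∫ x, (s * f x + g x) ^ 2 ∂P = (∫ x, f x ^ 2 ∂P) * (s * s) +
        (2 * ∫ x, f x * g x ∂P) * s + ∫ x, g x ^ 2 ∂P := by
      have : ∀ x, (s * f x + g x) ^ 2 = (s * s) * f x ^ 2 + (2 * s) * (f x * g x) + g x ^ 2 :=
        fun x => by ring
      simp_rw [this]
      have i4 : Integrable (fun x => (s * s) * f x ^ 2 + (2 * s) * (f x * g x)) P :=
        (i1.const_mul _).add (i3.const_mul _)
      rw [integral_add i4 i2,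
        integral_add (i1.const_mul _) (i3.const_mul _), integral_const_mul, integral_const_mul]
      ring
    rw [← e]
    exact integral_nonneg fun _ => sq_nonneg _
  have hd := discrim_le_zero hq
  rw [discrim] at hd
  rw [← Real.sqrt_mul (integral_nonneg fun _ => sq_nonneg _)]
  refine Real.abs_le_sqrt ?_
  nlinarith

lemma integral_abs_le_sqrt {α : Type*} [MeasurableSpace α] {P : Measure α}
    [IsProbabilityMeasure P] {f : α → ℝ} (hf : MemLp f 2 P) :
    ∫ x, |f x| ∂P ≤ √(∫ x, f x ^ 2 ∂P) := by
  have h := (le_abs_self _).trans (abs_integral_mul_le_sqrt hf.abs (memLp_const (1 : ℝ)))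
  simpa using h

lemma abs_exp_sub_exp_le {x y : ℝ} (hx : x ≤ 0) (hy : y ≤ 0) :
    |Real.exp x - Real.exp y| ≤ |x - y| := by
  wlog h : x ≤ y generalizing x y
  · rw [abs_sub_comm, abs_sub_comm x]
    exact this hy hx (le_of_not_ge h)
  have h1 := Real.add_one_le_exp (x - y)
  have h2 := Real.exp_le_one_iff.2 hy
  have h3 := Real.exp_pos y
  have h4 : Real.exp x = Real.exp y * Real.exp (x - y) := by rw [← Real.exp_add]; congr 1; ring
  rw [abs_sub_comm, abs_sub_comm x, abs_of_nonneg (sub_nonneg.2 (Real.exp_le_exp.2 h)),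
    abs_of_nonneg (sub_nonneg.2 h), h4]
  nlinarith

lemma norm_cexp_I_sub_le (x y : ℝ) :
    ‖Complex.exp (Complex.I * (x : ℂ)) - Complex.exp (Complex.I * (y : ℂ))‖ ≤ |x - y| := by
  have e : Complex.exp (Complex.I * (x : ℂ)) - Complex.exp (Complex.I * (y : ℂ)) =
      Complex.exp (Complex.I * (y : ℂ)) * (Complex.exp (Complex.I * ((x - y : ℝ) : ℂ)) - 1) := by
    rw [mul_sub, ← Complex.exp_add]
    congr 2
    · push_cast; ring
    · simp
  rw [e, norm_mul, norm_cexp_I_mul, one_mul]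
  exact Real.norm_exp_I_mul_ofReal_sub_one_le

variable {S Ω : Type*} [MeasurableSpace S] [MeasurableSpace Ω] {X : S → Ω → ℝ}
  {R : S → S → ℝ} {μ : Measure Ω} [IsProbabilityMeasure μ] {ν : Measure S} [IsFiniteMeasure ν]

/-- The centred functional `∫ (u(X_x) - E u(η)) dν(x)` for a standard normal `η`. -/
noncomputable def normalizedFunctional (ν : Measure S) (X : S → Ω → ℝ) (u : ℝ → ℝ) (ω : Ω) : ℝ :=
  ∫ x, (u (X x ω) - ∫ y, u y ∂(gaussianReal 0 1)) ∂ν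

namespace IsGaussianField

variable {u g : ℝ → ℝ}

lemma memLp_apply (h : IsGaussianField X R μ) (hR : ∀ x, R x x = 1)
    (hu : MemLp u 2 (gaussianReal 0 1)) (x : S) : MemLp (fun ω => u (X x ω)) 2 μ :=
  hu.comp_measurePreserving (h.measurePreserving (hR x))

lemma integral_apply (h : IsGaussianField X R μ) (hR : ∀ x, R x x = 1) (hum : Measurable u)
    (x : S) : ∫ ω, u (X x ω) ∂μ = ∫ y, u y ∂(gaussianReal 0 1) := by
  rw [← h.map_eq_gaussianReal (hR x), integral_map (h.measurable_apply x).aemeasurable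
    hum.aestronglyMeasurable]

lemma measurable_comp (h : IsGaussianField X R μ) (hum : Measurable u) :
    Measurable (fun q : S × Ω => u (X q.1 q.2) - ∫ y, u y ∂(gaussianReal 0 1)) :=
  (hum.comp h.measurable).sub_const _

lemma integral_centered_mul (h : IsGaussianField X R μ) (hR : ∀ x, R x x = 1) (hum : Measurable u)
    (hu : MemLp u 2 (gaussianReal 0 1)) (x y : S) :
    ∫ ω, (u (X x ω) - ∫ y, u y ∂(gaussianReal 0 1)) * (u (X y ω) - ∫ y, u y ∂(gaussianReal 0 1)) ∂μ =
      ∫ ω, u (X x ω) * u (X y ω) ∂μ - (∫ y, u y ∂(gaussianReal 0 1)) ^ 2 := by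
  set m := ∫ y, u y ∂(gaussianReal 0 1) with hm
  have i1 : Integrable (fun ω => u (X x ω) * u (X y ω)) μ :=
    (h.memLp_apply hR hu x).integrable_mul (h.memLp_apply hR hu y)
  have ix := (h.memLp_apply hR hu x).integrable (by norm_num)
  have iy := (h.memLp_apply hR hu y).integrable (by norm_num)
  have e : ∀ ω, (u (X x ω) - m) * (u (X y ω) - m) =
      u (X x ω) * u (X y ω) - m * u (X x ω) - (m * u (X y ω) - m ^ 2) := fun ω => by ring
  simp_rw [e]
  have i2 : Integrable (fun ω => u (X x ω) * u (X y ω) - m * u (X x ω)) μ :=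
    i1.sub (ix.const_mul m)
  have i3 : Integrable (fun ω => m * u (X y ω) - m ^ 2) μ :=
    (iy.const_mul m).sub (integrable_const _)
  rw [integral_sub i2 i3,
    integral_sub i1 (ix.const_mul m), integral_sub (iy.const_mul m) (integrable_const _),
    integral_const_mul, integral_const_mul, h.integral_apply hR hum, h.integral_apply hR hum, ← hm]
  simp; ring

lemma normalizedFunctional_sq (h : IsGaussianField X R μ) (hR : ∀ x, R x x = 1)
    (hum : Measurable u) (hu : MemLp u 2 (gaussianReal 0 1)) (heven : ∀ y, u (-y) = u y) :
    MemLp (normalizedFunctional ν X u) 2 μ ∧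
    (∫ q : S × S, R q.1 q.2 ^ 2 ∂(ν.prod ν)) * ((∫ z, u z * (z ^ 2 - 1) ∂(gaussianReal 0 1)) ^ 2 / 2) ≤
      ∫ ω, normalizedFunctional ν X u ω ^ 2 ∂μ ∧
    ∫ ω, normalizedFunctional ν X u ω ^ 2 ∂μ ≤
      (∫ q : S × S, R q.1 q.2 ^ 2 ∂(ν.prod ν)) * ∫ z, u z ^ 2 ∂(gaussianReal 0 1) := by
  have hm := h.measurable_comp hum
  have hR2 : Integrable (fun q : S × S => R q.1 q.2 ^ 2) (ν.prod ν) :=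
    Integrable.of_bound (h.measurable_cov.pow_const 2).aestronglyMeasurable 1
      (Eventually.of_forall fun q => by
        rw [Real.norm_eq_abs, abs_pow]
        exact pow_le_one₀ (abs_nonneg _) (h.abs_cov_le_one (hR _) (hR _)))
  have hb := fun x y => h.even_cov_bounds (hR x) (hR y) hu heven
  have hH : ∀ x, MemLp (fun ω => u (X x ω) - ∫ y, u y ∂(gaussianReal 0 1)) 2 μ := fun x =>
    (h.memLp_apply hR hu x).sub (memLp_const _)
  obtain ⟨h1, h2, h3⟩ := integral_sq_integral_eq (ν := ν) (μ := μ)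
    (M := ∫ z, u z * u z ∂(gaussianReal 0 1) - (∫ z, u z ∂(gaussianReal 0 1)) ^ 2) hm
    (fun x => (hH x).integrable_sq) (fun x => by
      have e1 := h.integral_centered_mul hR hum hu x x
      have e2 := (hb x x).2
      simp_rw [sq (u _ - _)]
      rw [e1]
      rw [hR] at e2
      linarith)
  have hFm : Measurable (normalizedFunctional ν X u) :=
    (hm.stronglyMeasurable.integral_prod_left' (μ := ν)).measurable
  refine ⟨(memLp_two_iff_integrable_sq hFm.aestronglyMeasurable).2 h1, ?_, ?_⟩
  · refine le_trans ?_ h3.ge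
    rw [← integral_mul_const]
    refine integral_mono (hR2.mul_const _) h2 fun q => ?_
    dsimp only
    rw [h.integral_centered_mul hR hum hu]
    have := (hb q.1 q.2).1
    linarith
  · refine h3.le.trans ?_
    rw [← integral_mul_const]
    refine integral_mono h2 (hR2.mul_const _) fun q => ?_
    dsimp only
    rw [h.integral_centered_mul hR hum hu]
    refine (hb q.1 q.2).2.trans (mul_le_mul_of_nonneg_left ?_ (sq_nonneg _))
    simp_rw [← sq]
    linarith [sq_nonneg (∫ z, u z ∂(gaussianReal 0 1))]

lemma ae_integrable_apply (h : IsGaussianField X R μ) (hR : ∀ x, R x x = 1) (hum : Measurable u)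
    (hu : MemLp u 2 (gaussianReal 0 1)) :
    Integrable (fun q : S × Ω => u (X q.1 q.2)) (ν.prod μ) ∧
      ∀ᵐ ω ∂μ, Integrable (fun x => u (X x ω)) ν := by
  have hm : Measurable (fun q : S × Ω => u (X q.1 q.2)) := hum.comp h.measurable
  have : Integrable (fun q : S × Ω => u (X q.1 q.2)) (ν.prod μ) := by
    refine (integrable_prod_iff hm.aestronglyMeasurable).2 ⟨Eventually.of_forall fun x =>
      (h.memLp_apply hR hu x).integrable (by norm_num), ?_⟩
    have e : ∀ x, ∫ ω, ‖u (X x ω)‖ ∂μ = ∫ y, ‖u y‖ ∂(gaussianReal 0 1) := fun x =>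
      h.integral_apply hR hum.norm x
    simp_rw [e]
    exact integrable_const _
  exact ⟨this, this.prod_left_ae⟩

lemma integral_normalizedFunctional (h : IsGaussianField X R μ) (hR : ∀ x, R x x = 1)
    (hum : Measurable u) (hu : MemLp u 2 (gaussianReal 0 1)) :
    ∫ ω, normalizedFunctional ν X u ω ∂μ = 0 := by
  have i1 := ((h.ae_integrable_apply (ν := ν) hR hum hu).1.sub
    (integrable_const (∫ y, u y ∂(gaussianReal 0 1)))).swap
  simp only [normalizedFunctional]
  rw [integral_integral_swap (f := fun ω x => u (X x ω) - ∫ y, u y ∂(gaussianReal 0 1)) i1]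
  have e : ∀ x, ∫ ω, (u (X x ω) - ∫ y, u y ∂(gaussianReal 0 1)) ∂μ = 0 := fun x => by
    rw [integral_sub ((h.memLp_apply hR hu x).integrable (by norm_num)) (integrable_const _),
      h.integral_apply hR hum]
    simp
  simp_rw [e, integral_zero]

lemma normalizedFunctional_sub (h : IsGaussianField X R μ) (hR : ∀ x, R x x = 1)
    (hum : Measurable u) (hgm : Measurable g) (hu : MemLp u 2 (gaussianReal 0 1))
    (hg : MemLp g 2 (gaussianReal 0 1)) :
    (fun ω => normalizedFunctional ν X u ω - normalizedFunctional ν X g ω) =ᵐ[μ]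
      normalizedFunctional ν X (fun y => u y - g y) := by
  filter_upwards [(h.ae_integrable_apply (ν := ν) hR hum hu).2,
    (h.ae_integrable_apply (ν := ν) hR hgm hg).2] with ω h1 h2
  simp only [normalizedFunctional]
  have i1 : Integrable (fun x => u (X x ω) - ∫ y, u y ∂(gaussianReal 0 1)) ν :=
    h1.sub (integrable_const _)
  have i2 : Integrable (fun x => g (X x ω) - ∫ y, g y ∂(gaussianReal 0 1)) ν :=
    h2.sub (integrable_const _)
  rw [← integral_sub i1 i2,
    integral_sub (hu.integrable (by norm_num)) (hg.integrable (by norm_num))]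
  congr 1; ext x; ring

end IsGaussianField
end

section

lemma measurePreserving_count_equiv {κ : Type*} [Fintype κ] [MeasurableSpace κ]
    [MeasurableSingletonClass κ] (e : κ ≃ κ) :
    MeasurePreserving e (Measure.count : Measure κ) Measure.count := by
  refine ⟨measurable_of_finite _, Measure.ext fun s hs => ?_⟩
  rw [Measure.map_apply (measurable_of_finite _) hs, Measure.count_apply hs,
    Measure.count_apply (measurable_of_finite _ hs), ← e.image_symm_eq_preimage,
    e.symm.injective.encard_image]

variable {S Ω : Type*} [MeasurableSpace S] [MeasurableSpace Ω] {X : S → Ω → ℝ}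
  {R : S → S → ℝ} {μ : Measure Ω} [IsProbabilityMeasure μ] {ν : Measure S} [IsFiniteMeasure ν]

lemma integral_prod_count {κ : Type*} [Fintype κ] [MeasurableSpace κ]
    [MeasurableSingletonClass κ] {f : S × κ → ℝ} (hf : Integrable f (ν.prod Measure.count)) :
    ∫ z, f z ∂(ν.prod Measure.count) = ∫ x, ∑ k, f (x, k) ∂ν := by
  rw [integral_prod _ hf]
  simp_rw [integral_count]

namespace IsGaussianField

lemma norm_charFun_evenTrig_sub_le (h : IsGaussianField X R μ) (hR : ∀ x, R x x = 1) {A : ℝ}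
    (hA0 : 0 ≤ A) (hA : ∀ x, ∫ y, |R x y| ∂ν ≤ A) {N : ℕ} (a l : Fin N → ℝ) (t : ℝ) :
    ‖∫ ω, Complex.exp (Complex.I * ((t * normalizedFunctional ν X (evenTrig a l) ω : ℝ) : ℂ)) ∂μ -
      ((Real.exp (-(∫ ω, normalizedFunctional ν X (evenTrig a l) ω ^ 2 ∂μ) * t ^ 2 / 2) : ℝ) : ℂ)‖ ≤
      t ^ 2 * (4 * (∑ j, |a j|) ^ 2 * (2 * (∑ j, |l j|) ^ 2 * A) *
        (2 * ∑ j, l j ^ 2) * √(∫ q : S × S, R q.1 q.2 ^ 2 ∂(ν.prod ν))) := by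
  set sl : Fin N × Bool → ℝ := fun k => if k.2 then l k.1 else -l k.1 with hsl
  have hsl2 : ∀ k, sl k ^ 2 = l k.1 ^ 2 := by rintro ⟨j, s⟩; cases s <;> simp [hsl]
  have hsla : ∀ k, |sl k| = |l k.1| := by rintro ⟨j, s⟩; cases s <;> simp [hsl]
  have hslm : Measurable (fun z : S × (Fin N × Bool) => sl z.2) :=
    (measurable_of_finite sl).comp measurable_snd
  have hfm : Measurable (fun z : S × (Fin N × Bool) => z.1) := measurable_fst
  have hf := h.reindex hfm hslm
  set Y : S × (Fin N × Bool) → Ω → ℝ := fun z ω => sl z.2 * X z.1 ω with hY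
  set C : S × (Fin N × Bool) → S × (Fin N × Bool) → ℝ :=
    fun z w => sl z.2 * sl w.2 * R z.1 w.1 with hC
  set c : S × (Fin N × Bool) → ℝ := fun z => a z.2.1 / 2 with hc
  have hcm : Measurable c := (measurable_of_finite fun k : Fin N × Bool => a k.1 / 2).comp
    measurable_snd
  have hl1 : ∀ j, |l j| ≤ ∑ j, |l j| := fun j =>
    Finset.single_le_sum (f := fun j => |l j|) (fun _ _ => abs_nonneg _) (Finset.mem_univ j)
  have ha1 : ∀ j, |a j| ≤ ∑ j, |a j| := fun j =>
    Finset.single_le_sum (f := fun j => |a j|) (fun _ _ => abs_nonneg _) (Finset.mem_univ j)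
  have hl0 : 0 ≤ ∑ j, |l j| := Finset.sum_nonneg fun _ _ => abs_nonneg _
  have hR1 : ∀ x y, |R x y| ≤ 1 := fun x y => h.abs_cov_le_one (hR _) (hR _)
  have hCb : ∀ z w, |C z w| ≤ (∑ j, |l j|) ^ 2 := fun z w => by
    simp only [hC, abs_mul, hsla]
    calc _ ≤ (∑ j, |l j|) * (∑ j, |l j|) * 1 :=
          mul_le_mul (mul_le_mul (hl1 _) (hl1 _) (abs_nonneg _) hl0) (hR1 _ _) (abs_nonneg _)
            (mul_nonneg hl0 hl0)
      _ = _ := by ring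
  have hK : ∀ z, C z z ≤ (∑ j, |l j|) ^ 2 := fun z => (le_abs_self _).trans (hCb z z)
  have hB : ∀ z, |c z| ≤ ∑ j, |a j| := fun z => by
    simp only [hc, abs_div, abs_two]
    linarith [ha1 z.2.1, abs_nonneg (a z.2.1)]
  have hτ : MeasurePreserving (Prod.map id (Equiv.prodCongr (Equiv.refl (Fin N)) Equiv.boolNot))
      (ν.prod Measure.count) (ν.prod Measure.count) :=
    (MeasurePreserving.id ν).prod (measurePreserving_count_equiv _)
  have hτl : ∀ k, sl (Equiv.prodCongr (Equiv.refl (Fin N)) Equiv.boolNot k) = -sl k := by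
    rintro ⟨j, s⟩; cases s <;> simp [hsl]
  have hsum : ∀ f : Fin N → ℝ, ∑ k : Fin N × Bool, f k.1 = 2 * ∑ j, f j := fun f => by
    rw [Fintype.sum_prod_type, Finset.mul_sum]
    simp [two_mul]
  have hCm := hf.measurable_cov
  have hA' : ∀ z, ∫ w, |C z w| ∂(ν.prod Measure.count) ≤ 2 * (∑ j, |l j|) ^ 2 * A := fun z => by
    rw [integral_prod_count (f := fun w => |C z w|) (Integrable.of_bound
      (hCm.comp measurable_prodMk_left).abs.aestronglyMeasurable ((∑ j, |l j|) ^ 2)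
      (Eventually.of_forall fun y => by rw [Real.norm_eq_abs, abs_abs]; exact hCb z y))]
    have e : ∀ y, ∑ k : Fin N × Bool, |C z (y, k)| = |l z.2.1| * (2 * ∑ j, |l j|) * |R z.1 y| :=
      fun y => by
        rw [← hsum (fun j => |l j|), Finset.mul_sum, Finset.sum_mul]
        refine Finset.sum_congr rfl fun k _ => ?_
        simp only [hC, abs_mul, hsla]
    simp_rw [e]
    rw [integral_const_mul]
    have h0 : 0 ≤ ∫ y, |R z.1 y| ∂ν := integral_nonneg fun _ => abs_nonneg _
    calc _ ≤ (∑ j, |l j|) * (2 * ∑ j, |l j|) * A := by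
          refine mul_le_mul (mul_le_mul_of_nonneg_right (hl1 _) (by positivity)) (hA _) h0
            (by positivity)
      _ = _ := by ring
  have hQ : ∫ q : (S × (Fin N × Bool)) × (S × (Fin N × Bool)), C q.1 q.2 ^ 2
      ∂((ν.prod Measure.count).prod (ν.prod Measure.count)) =
      (2 * ∑ j, l j ^ 2) ^ 2 * ∫ q : S × S, R q.1 q.2 ^ 2 ∂(ν.prod ν) := by
    have hb2 : ∀ z w, ‖C z w ^ 2‖ ≤ ((∑ j, |l j|) ^ 2) ^ 2 := fun z w => by
      rw [Real.norm_eq_abs, abs_pow]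
      exact pow_le_pow_left₀ (abs_nonneg _) (hCb z w) 2
    have hb1 : ∀ x y, ‖R x y ^ 2‖ ≤ 1 := fun x y => by
      rw [Real.norm_eq_abs, abs_pow]
      exact pow_le_one₀ (abs_nonneg _) (hR1 x y)
    have i1 : Integrable (fun q : (S × (Fin N × Bool)) × (S × (Fin N × Bool)) => C q.1 q.2 ^ 2)
        ((ν.prod Measure.count).prod (ν.prod Measure.count)) :=
      Integrable.of_bound (hCm.pow_const 2).aestronglyMeasurable (((∑ j, |l j|) ^ 2) ^ 2)
        (Eventually.of_forall fun q => hb2 _ _)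
    have i2 : ∀ z, Integrable (fun w => C z w ^ 2) (ν.prod Measure.count) := fun z =>
      Integrable.of_bound ((hCm.comp measurable_prodMk_left).pow_const 2).aestronglyMeasurable
        (((∑ j, |l j|) ^ 2) ^ 2) (Eventually.of_forall fun q => hb2 _ _)
    have i3 : Integrable (fun q : S × S => R q.1 q.2 ^ 2) (ν.prod ν) :=
      Integrable.of_bound (h.measurable_cov.pow_const 2).aestronglyMeasurable 1
        (Eventually.of_forall fun q => hb1 _ _)
    have e : ∀ z, ∫ w, C z w ^ 2 ∂(ν.prod Measure.count) =
        l z.2.1 ^ 2 * ((2 * ∑ j, l j ^ 2) * ∫ y, R z.1 y ^ 2 ∂ν) := fun z => by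
      rw [integral_prod_count (i2 z), ← integral_const_mul, ← integral_const_mul]
      congr 1; ext y
      rw [← hsum (fun j => l j ^ 2), Finset.sum_mul, Finset.mul_sum]
      refine Finset.sum_congr rfl fun k _ => ?_
      simp only [hC, mul_pow, hsl2]
      ring
    have i4 := i1.integral_prod_left
    rw [integral_prod _ i1]
    simp only [e] at i4 ⊢
    rw [integral_prod_count i4, integral_prod _ i3, ← integral_const_mul]
    congr 1; ext x
    dsimp only
    rw [← Finset.sum_mul, hsum (fun j => l j ^ 2)]
    ring
  have hF : ∀ ω, cosFunctional (ν.prod Measure.count) Y C c ω =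
      normalizedFunctional ν X (evenTrig a l) ω := fun ω => by
    have hm1 := hf.measurable_cov_diag
    have hm2 : Measurable (fun z => Y z ω) := hf.measurable.comp measurable_prodMk_right
    rw [cosFunctional, integral_prod_count
      (f := fun z => c z * (Real.cos (Y z ω) - Real.exp (-C z z / 2))) (Integrable.of_bound (Measurable.aestronglyMeasurable
      (hcm.mul ((Real.measurable_cos.comp hm2).sub
        (Real.measurable_exp.comp (hm1.neg.div_const 2)))))
      ((∑ j, |a j|) * 2) (Eventually.of_forall fun z => by
        rw [norm_mul]
        exact mul_le_mul (hB z) (hf.abs_cos_sub_le z ω) (norm_nonneg _)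
          ((abs_nonneg _).trans (hB z))))]
    rw [normalizedFunctional]
    congr 1; ext x
    have e2 : ∫ z, evenTrig a l z ∂(gaussianReal 0 1) = ∑ j, a j * Real.exp (-l j ^ 2 / 2) := by
      simp_rw [evenTrig]
      rw [integral_finsetSum _ fun j _ => Integrable.of_bound (by fun_prop) |a j|
        (Eventually.of_forall fun ω => by
          rw [norm_mul]
          exact mul_le_of_le_one_right (norm_nonneg _) (Real.abs_cos_le_one _))]
      simp_rw [integral_const_mul, integral_cos_gaussianReal]
    rw [e2, evenTrig, ← Finset.sum_sub_distrib]
    have e3 : ∀ k : Fin N × Bool, c (x, k) * (Real.cos (Y (x, k) ω) - Real.exp (-C (x, k) (x, k) / 2)) =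
        a k.1 / 2 * (Real.cos (l k.1 * X x ω) - Real.exp (-l k.1 ^ 2 / 2)) := by
      rintro ⟨j, s⟩
      cases s <;> simp [hC, hY, hc, hsl, hR, sq]
    simp_rw [e3]
    rw [hsum (fun j => a j / 2 * (Real.cos (l j * X x ω) - Real.exp (-l j ^ 2 / 2))),
      Finset.mul_sum]
    exact Finset.sum_congr rfl fun j _ => by ring
  have key := hf.norm_charFun_cosFunctional_sub_le (ν := ν.prod Measure.count) hK hcm hB hτ
    (fun z ω => by simp only [hY, Prod.map_fst, Prod.map_snd, hτl, id]; ring) (fun z => rfl)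
    (fun z w => by simp only [hC, Prod.map_fst, Prod.map_snd, hτl, id]; ring) hA' (by positivity) t
  simp only [hF] at key
  rw [hQ, Real.sqrt_mul (sq_nonneg _), Real.sqrt_sq (by positivity)] at key
  refine key.trans (le_of_eq (by ring))

end IsGaussianField
end

section

variable {S Ω : Type*} [MeasurableSpace S] [MeasurableSpace Ω] {μ : Measure Ω}
  [IsProbabilityMeasure μ] {ν : Measure S} [IsFiniteMeasure ν]

lemma abs_integral_sq_sub_integral_sq_le {F G : Ω → ℝ} (hF : MemLp F 2 μ) (hG : MemLp G 2 μ) :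
    |∫ ω, F ω ^ 2 ∂μ - ∫ ω, G ω ^ 2 ∂μ| ≤ ∫ ω, (F ω - G ω) ^ 2 ∂μ +
      2 * (√(∫ ω, F ω ^ 2 ∂μ) * √(∫ ω, (F ω - G ω) ^ 2 ∂μ)) := by
  have hD : MemLp (fun ω => F ω - G ω) 2 μ := hF.sub hG
  have i1 : Integrable (fun ω => F ω * (F ω - G ω)) μ := hF.integrable_mul hD
  have e : ∫ ω, F ω ^ 2 ∂μ - ∫ ω, G ω ^ 2 ∂μ =
      2 * (∫ ω, F ω * (F ω - G ω) ∂μ) - ∫ ω, (F ω - G ω) ^ 2 ∂μ := by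
    rw [← integral_sub hF.integrable_sq hG.integrable_sq, ← integral_const_mul,
      ← integral_sub (i1.const_mul 2) hD.integrable_sq]
    congr 1; ext ω; ring
  have h1 := abs_le.1 (abs_integral_mul_le_sqrt hF hD)
  have h2 : 0 ≤ ∫ ω, (F ω - G ω) ^ 2 ∂μ := integral_nonneg fun _ => sq_nonneg _
  rw [e, abs_le]
  constructor <;> linarith [h1.1, h1.2]

lemma norm_charFun_sub_charFun_le {F G : Ω → ℝ} (hF : MemLp F 2 μ) (hG : MemLp G 2 μ) (t : ℝ) :
    ‖∫ ω, Complex.exp (Complex.I * ((t * F ω : ℝ) : ℂ)) ∂μ -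
      ∫ ω, Complex.exp (Complex.I * ((t * G ω : ℝ) : ℂ)) ∂μ‖ ≤
      |t| * √(∫ ω, (F ω - G ω) ^ 2 ∂μ) := by
  have hD : MemLp (fun ω => F ω - G ω) 2 μ := hF.sub hG
  have hi : ∀ {H : Ω → ℝ}, MemLp H 2 μ →
      Integrable (fun ω => Complex.exp (Complex.I * ((t * H ω : ℝ) : ℂ))) μ := fun {H} hH => by
    have hm : AEMeasurable H μ := hH.aestronglyMeasurable.aemeasurable
    exact Integrable.of_bound (AEMeasurable.aestronglyMeasurable (by fun_prop)) 1
      (Eventually.of_forall fun ω => (norm_cexp_I_mul _).le)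
  rw [← integral_sub (hi hF) (hi hG)]
  calc _ ≤ ∫ ω, |t| * |F ω - G ω| ∂μ := by
        refine norm_integral_le_of_norm_le ((hD.integrable (by norm_num)).abs.const_mul _)
          (Eventually.of_forall fun ω => ?_)
        rw [← abs_mul, mul_sub]
        exact norm_cexp_I_sub_le _ _
    _ ≤ _ := by
        rw [integral_const_mul]
        exact mul_le_mul_of_nonneg_left (integral_abs_le_sqrt hD) (abs_nonneg _)

variable {u : ℝ → ℝ}

set_option maxHeartbeats 1000000 in
/-- Central limit theorem for normalized even functionals of a stationary Gaussian field, in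
terms of characteristic functions: the only smallness required is that of
`sup_x ∫ |R(x, y)| dν(y)` compared to `(∫∫ R²)^(1/2)`. -/
theorem exists_norm_charFun_normalizedFunctional_sub_le (μ : Measure Ω) [IsProbabilityMeasure μ]
    (ν : Measure S) [IsFiniteMeasure ν] (hum : Measurable u)
    (hu : MemLp u 2 (gaussianReal 0 1)) (heven : ∀ y, u (-y) = u y)
    (hκ : ∫ z, u z * (z ^ 2 - 1) ∂(gaussianReal 0 1) ≠ 0) (t : ℝ) {δ : ℝ} (hδ : 0 < δ) :
    ∃ η > 0, ∀ (X : S → Ω → ℝ) (R : S → S → ℝ) (A : ℝ), IsGaussianField X R μ →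
      (∀ x, R x x = 1) → 0 ≤ A → (∀ x, ∫ y, |R x y| ∂ν ≤ A) →
      0 < ∫ q : S × S, R q.1 q.2 ^ 2 ∂(ν.prod ν) →
      A ≤ η * √(∫ q : S × S, R q.1 q.2 ^ 2 ∂(ν.prod ν)) →
      ‖∫ ω, Complex.exp (Complex.I * ((t / √(∫ ω, normalizedFunctional ν X u ω ^ 2 ∂μ) *
        normalizedFunctional ν X u ω : ℝ) : ℂ)) ∂μ - ((Real.exp (-t ^ 2 / 2) : ℝ) : ℂ)‖ ≤ δ := by
  set κ := ∫ z, u z * (z ^ 2 - 1) ∂(gaussianReal 0 1) with hκd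
  set s := √(∫ z, u z ^ 2 ∂(gaussianReal 0 1)) with hs
  have hs0 : 0 ≤ s := Real.sqrt_nonneg _
  have hκ2 : 0 < κ ^ 2 := by positivity
  set b := 2 * t ^ 2 / κ ^ 2 with hb
  have hb0 : 0 ≤ b := by positivity
  set D := √b + b * (1 / 2 + s) with hD
  have hD0 : 0 ≤ D := by positivity
  set e := min 1 (δ / (2 * (D + 1))) with he
  have he0 : 0 < e := lt_min one_pos (by positivity)
  have he1 : e ≤ 1 := min_le_left _ _
  have heD : D * e ≤ δ / 2 := by
    have h1 : e ≤ δ / (2 * (D + 1)) := min_le_right _ _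
    rw [le_div_iff₀ (by positivity)] at h1
    nlinarith
  have hneg : MeasurePreserving (fun x : ℝ => -x) (gaussianReal 0 1) (gaussianReal 0 1) :=
    ⟨measurable_neg, by rw [gaussianReal_map_neg, neg_zero]⟩
  obtain ⟨N, a, l, hg⟩ := exists_evenTrig_approx hneg hu heven (pow_pos he0 2)
  set g := evenTrig a l with hgd
  have hgm : Measurable g := (continuous_evenTrig a l).measurable
  have hgL : MemLp g 2 (gaussianReal 0 1) := memLp_evenTrig a l _
  have hge : ∀ y, g (-y) = g y := fun y => by simp [hgd, evenTrig]
  set K := 4 * (∑ j, |a j|) ^ 2 * (2 * (∑ j, |l j|) ^ 2) * (2 * ∑ j, l j ^ 2) with hK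
  have hK0 : 0 ≤ K := by positivity
  refine ⟨δ / (2 * (b * K + 1)), by positivity, fun X R A h hR hA0 hA hV hAV => ?_⟩
  set V := ∫ q : S × S, R q.1 q.2 ^ 2 ∂(ν.prod ν) with hVd
  obtain ⟨hF, hF1, hF2⟩ := h.normalizedFunctional_sq (ν := ν) hR hum hu heven
  obtain ⟨hG, -, -⟩ := h.normalizedFunctional_sq (ν := ν) hR hgm hgL hge
  obtain ⟨-, -, hE2⟩ := h.normalizedFunctional_sq (ν := ν) hR (hum.sub hgm) (hu.sub hgL)
    (fun y => by simp only [Pi.sub_apply, heven, hge])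
  have hsub := h.normalizedFunctional_sub (ν := ν) hR hum hgm hu hgL
  have htr := h.norm_charFun_evenTrig_sub_le hR hA0 hA a l
  rw [← hgd, ← hVd] at htr
  rw [← hVd] at hF1 hF2 hE2
  set F := normalizedFunctional ν X u with hFd
  set G := normalizedFunctional ν X g with hGd
  set Φ := ∫ ω, F ω ^ 2 ∂μ with hΦ
  have hΦ0 : 0 < Φ := lt_of_lt_of_le (by positivity) hF1
  set τ := t / √Φ with hτ
  have hτ2 : τ ^ 2 = t ^ 2 / Φ := by rw [hτ, div_pow, Real.sq_sqrt hΦ0.le]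
  have hτV : τ ^ 2 * V ≤ b := by
    rw [hτ2, div_mul_eq_mul_div, hb, div_le_div_iff₀ hΦ0 hκ2]
    have := mul_le_mul_of_nonneg_left hF1 (sq_nonneg t)
    linarith
  have hV0 := Real.sqrt_nonneg V
  have hV2 := Real.sq_sqrt hV.le
  have hτV' : |τ| * √V ≤ √b := by
    rw [← Real.sqrt_sq_eq_abs, ← Real.sqrt_mul (sq_nonneg _)]
    exact Real.sqrt_le_sqrt hτV
  have hFG : ∫ ω, (F ω - G ω) ^ 2 ∂μ ≤ V * e ^ 2 := by
    have e1 : ∫ ω, (F ω - G ω) ^ 2 ∂μ =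
        ∫ ω, normalizedFunctional ν X (u - g) ω ^ 2 ∂μ :=
      integral_congr_ae (hsub.mono fun ω hω => by
        dsimp only at hω ⊢
        rw [hω]; rfl)
    rw [e1]
    exact hE2.trans (mul_le_mul_of_nonneg_left hg.le hV.le)
  have hFGs : √(∫ ω, (F ω - G ω) ^ 2 ∂μ) ≤ √V * e := by
    refine (Real.sqrt_le_sqrt hFG).trans ?_
    rw [Real.sqrt_mul hV.le, Real.sqrt_sq he0.le]
  have hFs : √Φ ≤ √V * s := by
    rw [hs, ← Real.sqrt_mul hV.le]
    exact Real.sqrt_le_sqrt hF2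
  set Ψ := ∫ ω, G ω ^ 2 ∂μ with hΨ
  have hΨ0 : 0 ≤ Ψ := integral_nonneg fun _ => sq_nonneg _
  have hΦΨ : |Ψ - Φ| ≤ V * (e * (1 + 2 * s)) := by
    have h1 := abs_integral_sq_sub_integral_sq_le hF hG
    rw [← hΦ, ← hΨ] at h1
    rw [abs_sub_comm]
    have h2 : √Φ * √(∫ ω, (F ω - G ω) ^ 2 ∂μ) ≤ (√V * s) * (√V * e) :=
      mul_le_mul hFs hFGs (Real.sqrt_nonneg _) (by positivity)
    have h3 : V * e ^ 2 ≤ V * e :=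
      mul_le_mul_of_nonneg_left (pow_le_of_le_one he0.le he1 two_ne_zero) hV.le
    have h4 : (√V * s) * (√V * e) = V * (s * e) := by
      calc _ = √V ^ 2 * (s * e) := by ring
        _ = _ := by rw [hV2]
    rw [h4] at h2
    calc _ ≤ V * e + 2 * (V * (s * e)) := by linarith
      _ = _ := by ring
  have hexp : Real.exp (-Φ * τ ^ 2 / 2) = Real.exp (-t ^ 2 / 2) := by
    congr 1; rw [hτ2]; field_simp
  have b1 := norm_charFun_sub_charFun_le hF hG τ
  have b2 := htr τ
  have b3 : |Real.exp (-Ψ * τ ^ 2 / 2) - Real.exp (-Φ * τ ^ 2 / 2)| ≤ b * (e * (1 / 2 + s)) := by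
    refine (abs_exp_sub_exp_le (by linarith [mul_nonneg hΨ0 (sq_nonneg τ)])
      (by linarith [mul_nonneg hΦ0.le (sq_nonneg τ)])).trans ?_
    have e2 : -Ψ * τ ^ 2 / 2 - -Φ * τ ^ 2 / 2 = (-(τ ^ 2 / 2)) * (Ψ - Φ) := by ring
    rw [e2, abs_mul, abs_neg, abs_of_nonneg (by positivity : 0 ≤ τ ^ 2 / 2)]
    calc _ ≤ τ ^ 2 / 2 * (V * (e * (1 + 2 * s))) := by gcongr
      _ = (τ ^ 2 * V) * (e * (1 / 2 + s)) := by ring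
      _ ≤ _ := by gcongr
  have b1' : |τ| * √(∫ ω, (F ω - G ω) ^ 2 ∂μ) ≤ √b * e := by
    calc _ ≤ |τ| * (√V * e) := by gcongr
      _ = (|τ| * √V) * e := by ring
      _ ≤ _ := by gcongr
  have b2' : τ ^ 2 * (4 * (∑ j, |a j|) ^ 2 * (2 * (∑ j, |l j|) ^ 2 * A) * (2 * ∑ j, l j ^ 2) * √V)
      ≤ δ / 2 := by
    calc _ = τ ^ 2 * (K * A * √V) := by rw [hK]; ring
      _ ≤ τ ^ 2 * (K * (δ / (2 * (b * K + 1)) * √V) * √V) := by gcongr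
      _ = (τ ^ 2 * √V ^ 2) * (K * (δ / (2 * (b * K + 1)))) := by ring
      _ = (τ ^ 2 * V) * (K * (δ / (2 * (b * K + 1)))) := by rw [hV2]
      _ ≤ b * (K * (δ / (2 * (b * K + 1)))) := by gcongr
      _ = (b * K) / (b * K + 1) * (δ / 2) := by field_simp
      _ ≤ 1 * (δ / 2) := by
        gcongr
        rw [div_le_one (by positivity)]; linarith
      _ = _ := one_mul _
  rw [← hexp]
  have tri : ∀ p q r w : ℂ, ‖p - w‖ ≤ ‖p - q‖ + ‖q - r‖ + ‖r - w‖ := fun p q r w => by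
    calc _ = ‖(p - q) + (q - r) + (r - w)‖ := by congr 1; ring
      _ ≤ _ := norm_add₃_le
  refine (tri _ _ _ _).trans ((add_le_add (add_le_add (b1.trans b1') (b2.trans b2'))
    (le_trans (le_of_eq ?_) b3)).trans ?_)
  · rw [← Complex.ofReal_sub, Complex.norm_real, Real.norm_eq_abs]
  · rw [hD] at heD
    linarith
end

section

lemma tendsto_integral_norm_translate_sub {f : ℝ → ℂ} (hf : Integrable f) :
    Tendsto (fun h : ℝ => ∫ x, ‖f (h + x) - f x‖) (𝓝 0) (𝓝 0) := by
  have hm : MemLp f 1 (volume : Measure ℝ) := memLp_one_iff_integrable.2 hf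
  have : Fact ((1 : ENNReal) ≠ ⊤) := ⟨ENNReal.one_ne_top⟩
  have hc : Continuous fun h : ℝ => (DomAddAct.mk h +ᵥ hm.toLp f : Lp ℂ 1 (volume : Measure ℝ)) := by
    have h1 : Continuous fun h : ℝ => (DomAddAct.mk h : ℝᵈᵃᵃ) := DomAddAct.continuous_mk
    exact h1.vadd continuous_const
  have ht := (tendsto_iff_dist_tendsto_zero.1 (hc.tendsto 0))
  refine ht.congr fun h => ?_
  rw [DomAddAct.mk_vadd_toLp, DomAddAct.mk_vadd_toLp, dist_eq_norm, ← MemLp.toLp_sub,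
    Lp.norm_toLp, eLpNorm_one_eq_lintegral_enorm,
    integral_norm_eq_lintegral_enorm]
  · simp [vadd_eq_add]
  · exact ((hf.comp_add_left h).sub hf).aestronglyMeasurable

variable {Z Ω : Type*} [MeasurableSpace Z] [MeasurableSpace Ω] {μ : Measure Ω}
  [IsProbabilityMeasure μ]

/-- A centred jointly measurable Gaussian process is a Gaussian field. -/
lemma ProbabilityTheory.IsGaussianProcess.isGaussianField {X : Z → Ω → ℝ}
    (hX : IsGaussianProcess X μ) (hm : Measurable (fun q : Z × Ω => X q.1 q.2))
    (h0 : ∀ z, ∫ ω, X z ω ∂μ = 0) :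
    IsGaussianField X (fun z w => ∫ ω, X z ω * X w ω ∂μ) μ where
  measurable := hm
  measurable_cov := by
    have h1 : Measurable (fun p : (Z × Z) × Ω => (p.1.1, p.2)) := by fun_prop
    have h2 : Measurable (fun p : (Z × Z) × Ω => (p.1.2, p.2)) := by fun_prop
    exact ((hm.comp h1).mul (hm.comp h2)).stronglyMeasurable.integral_prod_right'.measurable
  symm z w := by simp_rw [mul_comm]
  integral_cexp ι _ z a := by
    have hL : ∀ z, MemLp (X z) 2 μ := fun z => (hX.hasGaussianLaw_eval z).memLp_two
    have hg := ((hX.comp_right z).smul a).hasGaussianLaw_fun_sum (I := Finset.univ)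
    simp only [Function.comp_apply, smul_eq_mul] at hg
    have hl := hg.map_eq_gaussianReal
    have hY2 : MemLp (fun ω => ∑ k, a k * X (z k) ω) 2 μ := hg.memLp_two
    have hmean : ∫ ω, ∑ k, a k * X (z k) ω ∂μ = 0 := by
      rw [integral_finsetSum _ fun k _ => ((hL (z k)).integrable (by norm_num)).const_mul _]
      simp_rw [integral_const_mul, h0, mul_zero, Finset.sum_const_zero]
    have hvar : Var[fun ω => ∑ k, a k * X (z k) ω; μ] =
        ∑ k, ∑ l, a k * a l * ∫ ω, X (z k) ω * X (z l) ω ∂μ := by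
      rw [variance_of_integral_eq_zero hY2.aestronglyMeasurable.aemeasurable hmean]
      have i : ∀ k l, Integrable (fun ω => a k * X (z k) ω * (a l * X (z l) ω)) μ := fun k l =>
        ((hL (z k)).const_mul (a k)).integrable_mul ((hL (z l)).const_mul (a l))
      simp_rw [sq, Finset.sum_mul_sum]
      rw [integral_finsetSum _ fun k _ => integrable_finsetSum _ fun l _ => i k l]
      refine Finset.sum_congr rfl fun k _ => ?_
      rw [integral_finsetSum _ fun l _ => i k l]
      refine Finset.sum_congr rfl fun l _ => ?_
      rw [← integral_const_mul]
      congr 1; ext ω; ring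
    have hc := congrArg (fun P : Measure ℝ => charFun P 1) hl
    rw [charFun_gaussianReal, charFun_apply_real, integral_map hY2.aestronglyMeasurable.aemeasurable (by fun_prop), hmean,
      Real.coe_toNNReal _ (variance_nonneg _ _), hvar] at hc
    have e : ∀ ω, Complex.exp (Complex.I * ((∑ k, a k * X (z k) ω : ℝ) : ℂ)) =
        Complex.exp (((1 : ℝ) : ℂ) * ((∑ k, a k * X (z k) ω : ℝ) : ℂ) * Complex.I) := fun ω => by
      congr 1; push_cast; ring
    simp_rw [e]
    rw [hc]
    push_cast
    congr 1; ring

/-- The increment variance of a jointly measurable Gaussian process with stationary increments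
vanishes at the origin. -/
lemma tendsto_increment_variance {G : ℝ → Ω → ℝ} (hG : Measurable (fun q : ℝ × Ω => G q.1 q.2))
    {a b d : ℝ} (hab : a < b) (hd : 0 < d) {v : ℝ → ℝ}
    (hv : ∀ h ∈ Ioc 0 d, ∀ x ∈ Icc a b, ∫ ω, Real.cos (G (x + h) ω - G x ω) ∂μ =
      Real.exp (-(v h) / 2)) :
    Tendsto v (𝓝[>] 0) (𝓝 0) := by
  set f : Ω → ℝ → ℂ := fun ω => (Icc a (b + d)).indicator
    (fun x => Complex.exp (Complex.I * (G x ω : ℂ))) with hf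
  have hfm : Measurable (fun q : Ω × ℝ => f q.1 q.2) := by
    have h1 : Measurable (fun q : Ω × ℝ => Complex.exp (Complex.I * (G q.2 q.1 : ℂ))) := by
      have h2 := hG.comp measurable_swap (α := Ω × ℝ)
      have h3 : Measurable (fun q : Ω × ℝ => G q.2 q.1) := h2
      fun_prop
    exact h1.indicator (measurableSet_Icc.preimage measurable_snd)
  have hfb : ∀ ω x, ‖f ω x‖ ≤ (Icc a (b + d)).indicator (fun _ => (1 : ℝ)) x := fun ω x => by
    simp only [hf]
    by_cases hx : x ∈ Icc a (b + d)
    · simp only [indicator_of_mem hx]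
      exact (norm_cexp_I_mul _).le
    · simp [indicator_of_notMem hx]
  have i1 : Integrable ((Icc a (b + d)).indicator (fun _ => (1 : ℝ))) :=
    (integrable_indicator_iff measurableSet_Icc).2 (integrableOn_const (by simp))
  have hfi : ∀ ω, Integrable (f ω) := fun ω =>
    i1.mono' (hfm.comp measurable_prodMk_left).aestronglyMeasurable (Eventually.of_forall (hfb ω))
  set K := ∫ x, (Icc a (b + d)).indicator (fun _ => (1 : ℝ)) x with hK
  have hg : Tendsto (fun h : ℝ => ∫ ω, (∫ x, ‖f ω (h + x) - f ω x‖) ∂μ) (𝓝 0) (𝓝 0) := by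
    have := tendsto_integral_filter_of_dominated_convergence (μ := μ) (l := 𝓝 (0 : ℝ))
      (F := fun h ω => ∫ x, ‖f ω (h + x) - f ω x‖) (f := fun _ => 0) (fun _ => K + K)
      (Eventually.of_forall fun h => by
        have h1 : Measurable (fun q : Ω × ℝ => (q.1, h + q.2)) := by fun_prop
        have h2 : Measurable (fun q : Ω × ℝ => ‖f q.1 (h + q.2) - f q.1 q.2‖) :=
          ((hfm.comp h1).sub hfm).norm
        exact h2.stronglyMeasurable.integral_prod_right'.aestronglyMeasurable)
      (Eventually.of_forall fun h => Eventually.of_forall fun ω => by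
        rw [Real.norm_eq_abs, abs_of_nonneg (integral_nonneg fun _ => norm_nonneg _)]
        have i2 := i1.comp_add_left h
        calc _ ≤ ∫ x, ((Icc a (b + d)).indicator (fun _ => (1 : ℝ)) (h + x) +
              (Icc a (b + d)).indicator (fun _ => (1 : ℝ)) x) :=
            integral_mono (((hfi ω).comp_add_left h).sub (hfi ω)).norm (i2.add i1) fun x =>
              (norm_sub_le _ _).trans (add_le_add (hfb _ _) (hfb _ _))
          _ = _ := by rw [integral_add i2 i1, integral_add_left_eq_self])
      (integrable_const _) (Eventually.of_forall fun ω =>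
        tendsto_integral_norm_translate_sub (hfi ω))
    simpa using this
  have hlow : ∀ h ∈ Ioc 0 d, (b - a) * (1 - Real.exp (-(v h) / 2)) ≤
      ∫ ω, (∫ x, ‖f ω (h + x) - f ω x‖) ∂μ := fun h hh => by
    have hcm : Measurable (fun q : ℝ × Ω => Real.cos (G (q.1 + h) q.2 - G q.1 q.2)) := by
      have h1 : Measurable (fun q : ℝ × Ω => (q.1 + h, q.2)) := by fun_prop
      exact Real.measurable_cos.comp ((hG.comp h1).sub hG)
    have hci : Integrable (fun q : Ω × ℝ => 1 - Real.cos (G (q.2 + h) q.1 - G q.2 q.1))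
        (μ.prod (volume.restrict (Icc a b))) := by
      refine (integrable_const _).sub (Integrable.of_bound
        (hcm.comp measurable_swap).aestronglyMeasurable 1 (Eventually.of_forall fun q => ?_))
      exact Real.abs_cos_le_one _
    have e1 : (b - a) * (1 - Real.exp (-(v h) / 2)) =
        ∫ ω, (∫ x in Icc a b, (1 - Real.cos (G (x + h) ω - G x ω))) ∂μ := by
      rw [integral_integral_swap (f := fun ω x => 1 - Real.cos (G (x + h) ω - G x ω)) hci]
      have : ∀ x ∈ Icc a b, ∫ ω, (1 - Real.cos (G (x + h) ω - G x ω)) ∂μ =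
          1 - Real.exp (-(v h) / 2) := fun x hx => by
        rw [integral_sub (g := fun ω => Real.cos (G (x + h) ω - G x ω)) (integrable_const _)
          (Integrable.of_bound
          (hcm.comp measurable_prodMk_left).aestronglyMeasurable 1
          (Eventually.of_forall fun q => Real.abs_cos_le_one _)), hv h hh x hx]
        simp
      rw [setIntegral_congr_fun measurableSet_Icc this]
      simp [hab.le]
    rw [e1]
    refine integral_mono hci.integral_prod_left ?_ fun ω => ?_
    · refine Integrable.of_bound ?_ (K + K) (Eventually.of_forall fun ω => ?_)
      · have h1 : Measurable (fun q : Ω × ℝ => (q.1, h + q.2)) := by fun_prop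
        have h2 : Measurable (fun q : Ω × ℝ => ‖f q.1 (h + q.2) - f q.1 q.2‖) :=
          ((hfm.comp h1).sub hfm).norm
        exact h2.stronglyMeasurable.integral_prod_right'.aestronglyMeasurable
      · rw [Real.norm_eq_abs, abs_of_nonneg (integral_nonneg fun _ => norm_nonneg _)]
        have i2 := i1.comp_add_left h
        calc _ ≤ ∫ x, ((Icc a (b + d)).indicator (fun _ => (1 : ℝ)) (h + x) +
              (Icc a (b + d)).indicator (fun _ => (1 : ℝ)) x) :=
            integral_mono (((hfi ω).comp_add_left h).sub (hfi ω)).norm (i2.add i1) fun x =>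
              (norm_sub_le _ _).trans (add_le_add (hfb _ _) (hfb _ _))
          _ = _ := by rw [integral_add i2 i1, integral_add_left_eq_self]
    · have i3 : Integrable (fun x => ‖f ω (h + x) - f ω x‖) :=
        (((hfi ω).comp_add_left h).sub (hfi ω)).norm
      dsimp only
      refine le_trans ?_ (setIntegral_le_integral (s := Icc a b) i3
        (Eventually.of_forall fun _ => norm_nonneg _))
      refine setIntegral_mono_on ?_ i3.integrableOn measurableSet_Icc fun x hx => ?_
      · refine (integrable_const _).sub (Integrable.of_bound
          (hcm.comp measurable_prodMk_right).aestronglyMeasurable 1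
          (Eventually.of_forall fun q => Real.abs_cos_le_one _))
      · have hx1 : x ∈ Icc a (b + d) := ⟨hx.1, by linarith [hx.2]⟩
        have hx2 : x + h ∈ Icc a (b + d) := ⟨by linarith [hx.1, hh.1], by linarith [hx.2, hh.2]⟩
        simp only [hf, add_comm h x, indicator_of_mem hx1, indicator_of_mem hx2]
        set A := G (x + h) ω
        set B := G x ω
        have h1 : ‖Complex.exp (Complex.I * (A : ℂ)) - Complex.exp (Complex.I * (B : ℂ))‖ =
            ‖Complex.exp (Complex.I * ((A - B : ℝ) : ℂ)) - 1‖ := by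
          have : Complex.exp (Complex.I * (A : ℂ)) - Complex.exp (Complex.I * (B : ℂ)) =
            Complex.exp (Complex.I * (B : ℂ)) * (Complex.exp (Complex.I * ((A - B : ℝ) : ℂ)) - 1) := by
            rw [mul_sub, ← Complex.exp_add]
            congr 2
            · push_cast; ring
            · simp
          rw [this, norm_mul, norm_cexp_I_mul, one_mul]
        rw [h1]
        refine le_trans ?_ (Complex.abs_re_le_norm _)
        rw [Complex.sub_re, Complex.one_re, mul_comm, Complex.exp_ofReal_mul_I_re, abs_sub_comm]
        exact le_abs_self _
  have hg' : Tendsto (fun h : ℝ => (∫ ω, (∫ x, ‖f ω (h + x) - f ω x‖) ∂μ) / (b - a)) (𝓝[>] 0)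
      (𝓝 0) := by
    have := (hg.mono_left (nhdsWithin_le_nhds (s := Ioi (0 : ℝ)))).div_const (b - a)
    simpa using this
  have hev : ∀ᶠ h in 𝓝[>] (0 : ℝ), h ∈ Ioc 0 d := Ioc_mem_nhdsGT hd
  have hv0 : ∀ h ∈ Ioc 0 d, 0 ≤ v h := fun h hh => by
    have h1 := hv h hh a ⟨le_rfl, hab.le⟩
    have h2 : ∫ ω, Real.cos (G (a + h) ω - G a ω) ∂μ ≤ 1 := by
      have := norm_integral_le_of_norm_le_const (μ := μ) (C := 1)
        (f := fun ω => Real.cos (G (a + h) ω - G a ω))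
        (Eventually.of_forall fun ω => Real.abs_cos_le_one _)
      simp only [probReal_univ, mul_one] at this
      exact (le_abs_self _).trans this
    rw [h1, Real.exp_le_one_iff] at h2
    linarith
  have hexp : Tendsto (fun h => Real.exp (-(v h) / 2)) (𝓝[>] 0) (𝓝 1) := by
    have h1 : Tendsto (fun h => 1 - Real.exp (-(v h) / 2)) (𝓝[>] 0) (𝓝 0) := by
      refine squeeze_zero' ?_ ?_ hg'
      · filter_upwards [hev] with h hh
        have := hv0 h hh
        rw [sub_nonneg, Real.exp_le_one_iff]; linarith
      · filter_upwards [hev] with h hh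
        rw [le_div_iff₀ (sub_pos.2 hab), mul_comm]
        exact hlow h hh
    have h2 := h1.const_sub 1
    simpa using h2
  have h3 := (Real.continuousAt_log one_ne_zero).tendsto.comp hexp
  simp only [Real.log_one, Function.comp_def, Real.log_exp] at h3
  have h4 := h3.const_mul (-2)
  simp only [mul_zero] at h4
  refine h4.congr fun h => by ring
end

section

/-- The correlation of two normalized increments of length `h` at distance `s`, for a process
with increment variance `v`. -/
noncomputable def incrementCorr (v : ℝ → ℝ) (h s : ℝ) : ℝ :=
  (v |s + h| + v |s - h| - 2 * v |s|) / (2 * v h)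

variable {w : ℝ → ℝ} {L M h : ℝ}

lemma continuous_incrementCorr (hw : Continuous w) (h : ℝ) : Continuous (incrementCorr w h) := by
  unfold incrementCorr; fun_prop

lemma integral_incrementCorr (w : ℝ → ℝ) (h x : ℝ) :
    ∫ s in (0 : ℝ)..x, incrementCorr w h s = (∫ s in (0 : ℝ)..x, (w |s + h| + w |s - h| - 2 * w |s|))
      / (2 * w h) := by
  simp only [incrementCorr, intervalIntegral.integral_div]

lemma integral_abs_shift_left (hw : Continuous w) (hh : 0 ≤ h) {x : ℝ} (hx : h ≤ x) :
    ∫ s in (0 : ℝ)..x, w |s - h| = (∫ s in (0 : ℝ)..h, w s) + ∫ s in (0 : ℝ)..(x - h), w s := by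
  have hc : Continuous fun s => w |s| := by fun_prop
  rw [intervalIntegral.integral_comp_sub_right (fun s => w |s|) h, zero_sub,
    ← intervalIntegral.integral_add_adjacent_intervals (b := 0) (hc.intervalIntegrable _ _)
      (hc.intervalIntegrable _ _)]
  congr 1
  · rw [← neg_zero, ← intervalIntegral.integral_comp_neg, neg_zero]
    refine intervalIntegral.integral_congr fun s hs => ?_
    rw [uIcc_of_le hh] at hs
    simp only [abs_neg, abs_of_nonneg hs.1]
  · refine intervalIntegral.integral_congr fun s hs => ?_
    rw [uIcc_of_le (sub_nonneg.2 hx)] at hs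
    simp only [abs_of_nonneg hs.1]

lemma integral_secondDifference (hw : Continuous w) (hh : 0 ≤ h) {x : ℝ} (hx : h ≤ x) :
    ∫ s in (0 : ℝ)..x, (w |s + h| + w |s - h| - 2 * w |s|) =
      ∫ s in (0 : ℝ)..h, (w (s + x) - w (s + (x - h))) := by
  have hc : Continuous fun s => w |s| := by fun_prop
  have ii : ∀ p q : ℝ, IntervalIntegrable w volume p q := fun p q => hw.intervalIntegrable _ _
  have hx0 := hh.trans hx
  have c1 : Continuous fun s => w |s + h| := by fun_prop
  have c2 : Continuous fun s => w |s - h| := by fun_prop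
  have c3 : Continuous fun s => 2 * w |s| := by fun_prop
  have c4 : Continuous fun s => w (s + x) := by fun_prop
  have c5 : Continuous fun s => w (s + (x - h)) := by fun_prop
  have e1 : ∫ s in (0 : ℝ)..x, w |s + h| = ∫ s in h..(x + h), w s := by
    rw [intervalIntegral.integral_comp_add_right (fun s => w |s|) h, zero_add]
    refine intervalIntegral.integral_congr fun s hs => ?_
    rw [uIcc_of_le (by linarith)] at hs
    simp only [abs_of_nonneg (hh.trans hs.1)]
  have e3 : ∫ s in (0 : ℝ)..x, w |s| = ∫ s in (0 : ℝ)..x, w s := by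
    refine intervalIntegral.integral_congr fun s hs => ?_
    rw [uIcc_of_le hx0] at hs
    simp only [abs_of_nonneg hs.1]
  have c12 : Continuous fun s => w |s + h| + w |s - h| := c1.add c2
  rw [intervalIntegral.integral_sub (c12.intervalIntegrable _ _)
    (c3.intervalIntegrable _ _), intervalIntegral.integral_add (c1.intervalIntegrable _ _)
    (c2.intervalIntegrable _ _), intervalIntegral.integral_const_mul, e1, e3,
    integral_abs_shift_left hw hh hx, intervalIntegral.integral_sub (c4.intervalIntegrable _ _)
    (c5.intervalIntegrable _ _), intervalIntegral.integral_comp_add_right,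
    intervalIntegral.integral_comp_add_right, zero_add, zero_add, add_sub_cancel,
    add_comm h x]
  have a1 := intervalIntegral.integral_add_adjacent_intervals (ii 0 h) (ii h (x + h))
  have a2 := intervalIntegral.integral_add_adjacent_intervals (ii 0 x) (ii x (x + h))
  have a3 := intervalIntegral.integral_add_adjacent_intervals (ii 0 (x - h)) (ii (x - h) x)
  linarith

lemma intervalIntegral_abs_le_sqrt {f : ℝ → ℝ} (hf : Continuous f) (hh : 0 ≤ h) :
    ∫ s in (0 : ℝ)..h, |f s| ≤ √h * √(∫ s in (0 : ℝ)..h, f s ^ 2) := by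
  have hm : ∀ {g : ℝ → ℝ}, Continuous g → MemLp g 2 (volume.restrict (Ioc 0 h)) := fun {g} hg => by
    refine (memLp_two_iff_integrable_sq hg.aestronglyMeasurable).2 ?_
    exact ((hg.pow 2).integrableOn_Icc (a := 0) (b := h)).mono_set Ioc_subset_Icc_self
  have := (le_abs_self _).trans (abs_integral_mul_le_sqrt (hm hf.abs) (hm (continuous_const (y := (1 : ℝ)))))
  simp only [mul_one, sq_abs, one_pow] at this
  rw [intervalIntegral.integral_of_le hh, intervalIntegral.integral_of_le hh, mul_comm]
  refine this.trans (le_of_eq ?_)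
  simp [hh]

lemma intervalIntegral_sq_mono {f : ℝ → ℝ} (hf : Continuous f) {x y : ℝ} (hx : 0 ≤ x) (hxy : x ≤ y) :
    ∫ s in (0 : ℝ)..x, f s ^ 2 ≤ ∫ s in (0 : ℝ)..y, f s ^ 2 :=
  intervalIntegral.integral_mono_interval le_rfl hx hxy
    (Eventually.of_forall fun _ => sq_nonneg _) ((hf.pow 2).intervalIntegrable _ _)

/-- Smallness criterion when the mass of the correlation is carried by `[0, h]`. -/
lemma eventually_integral_abs_incrementCorr_le (hw : Continuous w) (hL : 0 < L) {K : ℝ}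
    (hK : ∀ᶠ h in 𝓝[>] (0 : ℝ), 0 < ∫ s in (0 : ℝ)..h, |incrementCorr w h s| ∧
      ∫ s in (0 : ℝ)..L, |incrementCorr w h s| ≤ K * ∫ s in (0 : ℝ)..h, |incrementCorr w h s|)
    {η : ℝ} (hη : 0 < η) :
    ∀ᶠ h in 𝓝[>] (0 : ℝ), 0 < ∫ s in (0 : ℝ)..(L / 2), incrementCorr w h s ^ 2 ∧
      ∫ s in (0 : ℝ)..L, |incrementCorr w h s| ≤
        η * √(∫ s in (0 : ℝ)..(L / 2), incrementCorr w h s ^ 2) := by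
  have hs : ∀ᶠ h in 𝓝[>] (0 : ℝ), |K| * √h ≤ η := by
    have : Tendsto (fun h : ℝ => |K| * √h) (𝓝[>] 0) (𝓝 0) := by
      have hc : Continuous fun h : ℝ => |K| * √h := by fun_prop
      have := (hc.tendsto 0).mono_left (nhdsWithin_le_nhds (s := Ioi (0 : ℝ)))
      simpa using this
    exact this.eventually_le_const hη
  filter_upwards [hK, hs, Ioc_mem_nhdsGT (half_pos hL)] with h h1 h2 h3
  have hc := continuous_incrementCorr hw h
  have b1 := intervalIntegral_abs_le_sqrt hc h3.1.le
  have b2 := Real.sqrt_le_sqrt (intervalIntegral_sq_mono hc h3.1.le h3.2)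
  set I := ∫ s in (0 : ℝ)..h, |incrementCorr w h s|
  set B := ∫ s in (0 : ℝ)..(L / 2), incrementCorr w h s ^ 2
  have b3 : I ≤ √h * √B := b1.trans (mul_le_mul_of_nonneg_left b2 (Real.sqrt_nonneg _))
  constructor
  · by_contra hB
    rw [Real.sqrt_eq_zero_of_nonpos (not_lt.1 hB), mul_zero] at b3
    linarith [h1.1]
  · calc _ ≤ K * I := h1.2
      _ ≤ |K| * I := mul_le_mul_of_nonneg_right (le_abs_self _) h1.1.le
      _ ≤ |K| * (√h * √B) := by gcongr
      _ = (|K| * √h) * √B := by ring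
      _ ≤ _ := by gcongr

/-- Concave increment variances. -/
lemma ConcaveOn.eventually_integral_abs_incrementCorr_le (hconc : ConcaveOn ℝ (Icc 0 M) w)
    (hw : Continuous w) (hL : 0 < L) (hLM : L < M) (w0 : w 0 = 0) (hnn : ∀ s ∈ Icc 0 M, 0 ≤ w s)
    {q : ℝ} (hq : q ∈ Ioc 0 L) (hwq : 0 < w q) {η : ℝ} (hη : 0 < η) :
    ∀ᶠ h in 𝓝[>] (0 : ℝ), 0 < ∫ s in (0 : ℝ)..(L / 2), incrementCorr w h s ^ 2 ∧
      ∫ s in (0 : ℝ)..L, |incrementCorr w h s| ≤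
        η * √(∫ s in (0 : ℝ)..(L / 2), incrementCorr w h s ^ 2) := by
  have hqM : q < M := hq.2.trans_lt hLM
  obtain ⟨s₁, hs₁, hws₁⟩ : ∃ s₁ ∈ Ioo 0 q, w s₁ ≤ w q / 2 := by
    have h1 : ∀ᶠ s in 𝓝[>] (0 : ℝ), w s < w q / 2 :=
      ((hw.tendsto 0).mono_left nhdsWithin_le_nhds).eventually_lt_const (by rw [w0]; linarith)
    obtain ⟨s, hs, hs'⟩ := (h1.and (Ioo_mem_nhdsGT hq.1)).exists
    exact ⟨s, hs', hs.le⟩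
  set c := (w q - w s₁) / (q - s₁) with hc
  have hc0 : 0 < c := div_pos (by linarith) (sub_pos.2 hs₁.2)
  have hslope : ∀ s t, 0 ≤ s → s < t → t ≤ s₁ → c * (t - s) ≤ w t - w s := fun s t h0 h1 h2 => by
    have m : ∀ {x}, 0 ≤ x → x ≤ q → x ∈ Icc 0 M := fun h h' => ⟨h, h'.trans hqM.le⟩
    have a1 : c ≤ (w t - w s) / (t - s) := by
      rcases h2.eq_or_lt with rfl | h2
      · exact hconc.slope_anti_adjacent (m h0 (by linarith [hs₁.2])) (m hq.1.le le_rfl) h1 hs₁.2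
      · refine le_trans (hconc.slope_anti_adjacent (m (h0.trans h1.le) (by linarith [hs₁.2]))
          (m hq.1.le le_rfl) h2 hs₁.2) ?_
        exact hconc.slope_anti_adjacent (m h0 (by linarith [hs₁.2])) (m hs₁.1.le hs₁.2.le) h1 h2
    exact (le_div_iff₀ (sub_pos.2 h1)).1 a1
  obtain ⟨D, hD⟩ := (isCompact_Icc (a := (0 : ℝ)) (b := M)).bddAbove_image hw.continuousOn
  have hD' : ∀ s ∈ Icc 0 M, w s ≤ D := fun s hs => hD ⟨s, hs, rfl⟩
  have hD0 : 0 ≤ D := (hnn _ ⟨hq.1.le, hqM.le⟩).trans (hD' _ ⟨hq.1.le, hqM.le⟩)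
  set C := 2 * D / (M - L) with hC
  have hML : 0 < M - L := sub_pos.2 hLM
  have hC0 : 0 ≤ C := by positivity
  have hdec : ∀ x y, 0 ≤ x → x < y → y ≤ (L + M) / 2 → -(C * (y - x)) ≤ w y - w x :=
    fun x y h0 h1 h2 => by
      have hyM : y < M := by linarith
      have a1 := hconc.slope_anti_adjacent (x := x) (y := y) (z := M) ⟨h0, by linarith⟩
        ⟨by linarith, le_rfl⟩ h1 hyM
      have a2 : -C ≤ (w M - w y) / (M - y) := by
        rw [le_div_iff₀ (sub_pos.2 hyM)]
        have a3 := hnn M ⟨by linarith, le_rfl⟩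
        have a4 := hD' y ⟨by linarith, hyM.le⟩
        have a5 : D ≤ C * (M - y) := by
          rw [hC, div_mul_eq_mul_div, le_div_iff₀ hML]
          nlinarith
        linarith
      have a6 := a2.trans a1
      rw [le_div_iff₀ (sub_pos.2 h1)] at a6
      linarith
  refine _root_.eventually_integral_abs_incrementCorr_le hw hL (K := 2 + C / c) ?_ hη
  filter_upwards [Ioc_mem_nhdsGT (half_pos hs₁.1), Ioc_mem_nhdsGT (half_pos hL),
    Ioc_mem_nhdsGT (half_pos hML)] with h h1 h2 h3
  have hh := h1.1
  have hwh : 0 < w h := by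
    have := hslope 0 h le_rfl hh (by linarith [h1.2, hs₁.1])
    rw [w0] at this
    have : 0 < c * (h - 0) := by positivity
    linarith
  have hcρ := continuous_incrementCorr hw h
  have i1 : ∀ x y : ℝ, IntervalIntegrable (incrementCorr w h) volume x y := fun x y =>
    hcρ.intervalIntegrable _ _
  have i2 : ∀ x y : ℝ, IntervalIntegrable (fun s => |incrementCorr w h s|) volume x y := fun x y =>
    hcρ.abs.intervalIntegrable _ _
  have n1 : c * h ^ 2 / (2 * w h) ≤ ∫ s in (0 : ℝ)..h, incrementCorr w h s := by
    rw [integral_incrementCorr, integral_secondDifference hw hh.le le_rfl]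
    gcongr
    calc c * h ^ 2 = ∫ s in (0 : ℝ)..h, c * h := by
          rw [intervalIntegral.integral_const, smul_eq_mul]; ring
      _ ≤ _ := by
        refine intervalIntegral.integral_mono_on hh.le (by simp)
          (Continuous.intervalIntegrable (by fun_prop) _ _) fun s hs => ?_
        have := hslope s (s + h) hs.1 (by linarith) (by linarith [hs.2, h1.2])
        simpa using this
  have n2 : -(C * h ^ 2 / (2 * w h)) ≤ ∫ s in (0 : ℝ)..L, incrementCorr w h s := by
    rw [integral_incrementCorr, integral_secondDifference hw hh.le (by linarith [h2.2]), ← neg_div]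
    gcongr
    calc -(C * h ^ 2) = ∫ s in (0 : ℝ)..h, -(C * h) := by
          rw [intervalIntegral.integral_const, smul_eq_mul]; ring
      _ ≤ _ := by
        refine intervalIntegral.integral_mono_on hh.le (by simp)
          (Continuous.intervalIntegrable (by fun_prop) _ _) fun s hs => ?_
        have := hdec (s + (L - h)) (s + L) (by linarith [hs.1, h2.2]) (by linarith)
          (by linarith [hs.2, h3.2])
        have e : s + L - (s + (L - h)) = h := by ring
        rwa [e] at this
  have n3 : ∫ s in h..L, |incrementCorr w h s| = -∫ s in h..L, incrementCorr w h s := by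
    rw [← intervalIntegral.integral_neg]
    refine intervalIntegral.integral_congr fun s hs => abs_of_nonpos ?_
    rw [uIcc_of_le (by linarith [h2.2])] at hs
    refine div_nonpos_of_nonpos_of_nonneg ?_ (by positivity)
    rw [abs_of_nonneg (by linarith [hs.1]), abs_of_nonneg (by linarith [hs.1]),
      abs_of_nonneg (by linarith [hs.1])]
    have m1 : s + h ∈ Icc 0 M := ⟨by linarith [hs.1], by linarith [hs.2, h3.2]⟩
    have m2 : s - h ∈ Icc 0 M := ⟨by linarith [hs.1], by linarith [hs.2, h3.2]⟩
    have := hconc.2 m1 m2 (by norm_num : (0 : ℝ) ≤ 1 / 2) (by norm_num : (0 : ℝ) ≤ 1 / 2)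
      (by norm_num)
    simp only [smul_eq_mul] at this
    rw [show 1 / 2 * (s + h) + 1 / 2 * (s - h) = s by ring] at this
    linarith
  have n4 := intervalIntegral.integral_add_adjacent_intervals (i1 0 h) (i1 h L)
  have n5 := intervalIntegral.integral_add_adjacent_intervals (i2 0 h) (i2 h L)
  have n6 : ∫ s in (0 : ℝ)..h, incrementCorr w h s ≤ ∫ s in (0 : ℝ)..h, |incrementCorr w h s| :=
    intervalIntegral.integral_mono_on hh.le (i1 _ _) (i2 _ _) fun s _ => le_abs_self _
  have n7 : 0 < c * h ^ 2 / (2 * w h) := by positivity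
  refine ⟨by linarith, ?_⟩
  have n8 : C * h ^ 2 / (2 * w h) ≤ C / c * ∫ s in (0 : ℝ)..h, |incrementCorr w h s| := by
    calc C * h ^ 2 / (2 * w h) = C / c * (c * h ^ 2 / (2 * w h)) := by field_simp
      _ ≤ _ := by
        refine mul_le_mul_of_nonneg_left (n1.trans n6) (by positivity)
  rw [← n5, n3]
  linarith
end

section

lemma rpow_three_halves {x : ℝ} (hx : 0 ≤ x) : x ^ (3 / 2 : ℝ) = √x ^ 3 := by
  rw [Real.rpow_div_two_eq_sqrt 3 hx]
  exact_mod_cast Real.rpow_natCast (√x) 3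

lemma two_add_sq_div_four_le {t : ℝ} (h0 : 0 ≤ t) (h1 : t ≤ 1) :
    2 + t ^ 2 / 4 ≤ (1 + t) ^ (3 / 2 : ℝ) + (1 - t) ^ (3 / 2 : ℝ) := by
  rw [rpow_three_halves (by linarith), rpow_three_halves (by linarith)]
  have hP := Real.sq_sqrt (by linarith : 0 ≤ 1 + t)
  have hQ := Real.sq_sqrt (by linarith : 0 ≤ 1 - t)
  have hP0 := Real.sqrt_nonneg (1 + t)
  have hQ0 := Real.sqrt_nonneg (1 - t)
  set P := √(1 + t)
  set Q := √(1 - t)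
  have hm : (P * Q) ^ 2 = 1 - t ^ 2 := by rw [mul_pow, hP, hQ]; ring
  have hm0 : 0 ≤ P * Q := mul_nonneg hP0 hQ0
  have e : (P ^ 3 + Q ^ 3) ^ 2 = 8 - 6 * (P * Q) ^ 2 + 2 * (P * Q) ^ 3 := by
    have : (P ^ 3 + Q ^ 3) ^ 2 = (P ^ 2) ^ 3 + (Q ^ 2) ^ 3 + 2 * (P * Q) ^ 3 := by ring
    rw [this, hP, hQ, hm]; ring
  set m := P * Q
  have hm1 : m ≤ 1 := by nlinarith
  refine abs_le_of_sq_le_sq' ?_ (by positivity) |>.2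
  rw [e]
  have ht : t ^ 2 = (1 - m) * (1 + m) := by linarith
  have k1 : (2 + t ^ 2 / 4) ^ 2 ≤ 4 + 17 / 16 * ((1 - m) * (1 + m)) := by
    have h2 : t ^ 2 ≤ 1 := by nlinarith
    have h3 := sq_nonneg t
    rw [← ht]
    nlinarith
  have k2 : 0 ≤ (1 - m) * (2 * (2 + 2 * m - m ^ 2) - 17 / 16 * (1 + m)) :=
    mul_nonneg (by linarith) (by nlinarith)
  nlinarith

variable {r L h : ℝ}

lemma incrementCorr_rpow_nonneg (hr : 1 ≤ r) (hh : 0 < h) (s : ℝ) :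
    0 ≤ incrementCorr (fun x => |x| ^ r) h s := by
  refine div_nonneg ?_ (by positivity)
  simp only [abs_abs]
  have h1 : |s| ≤ 1 / 2 * |s + h| + 1 / 2 * |s - h| := by
    have := abs_add_le (s + h) (s - h)
    rw [show s + h + (s - h) = 2 * s by ring, abs_mul, abs_two] at this
    linarith
  have h2 := (convexOn_rpow hr).2 (mem_Ici.2 (abs_nonneg (s + h))) (mem_Ici.2 (abs_nonneg (s - h)))
    (by norm_num : (0 : ℝ) ≤ 1 / 2) (by norm_num : (0 : ℝ) ≤ 1 / 2) (by norm_num)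
  simp only [smul_eq_mul] at h2
  have h3 := Real.rpow_le_rpow (abs_nonneg s) h1 (by linarith : 0 ≤ r)
  linarith

lemma rpow_sub_rpow_le (hr : 1 ≤ r) {x y : ℝ} (hx : 0 ≤ x) (hxy : x < y) (hy : y ≤ 2 * L) :
    y ^ r - x ^ r ≤ (2 * L + 1) ^ r * (y - x) := by
  have h1 := (convexOn_rpow hr).slope_mono_adjacent (x := x) (y := y) (z := 2 * L + 1)
    hx (show (0 : ℝ) ≤ 2 * L + 1 by linarith) hxy (by linarith)
  have h2 : ((2 * L + 1) ^ r - y ^ r) / (2 * L + 1 - y) ≤ (2 * L + 1) ^ r := by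
    rw [div_le_iff₀ (by linarith)]
    have h3 : 0 ≤ y ^ r := Real.rpow_nonneg (by linarith) r
    have h4 : 0 ≤ (2 * L + 1) ^ r := Real.rpow_nonneg (by linarith) r
    nlinarith
  exact (div_le_iff₀ (sub_pos.2 hxy)).1 (h1.trans h2)

lemma continuous_abs_rpow (hr : 0 ≤ r) : Continuous fun x : ℝ => |x| ^ r :=
  continuous_abs.rpow_const fun _ => Or.inr hr

lemma integral_abs_incrementCorr_rpow_le (hr : 1 ≤ r) (hh : 0 < h) (hhL : h ≤ L) :
    ∫ s in (0 : ℝ)..L, |incrementCorr (fun x => |x| ^ r) h s| ≤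
      (2 * L + 1) ^ r * h ^ 2 / (2 * h ^ r) := by
  have hw := continuous_abs_rpow (r := r) (by linarith)
  simp_rw [abs_of_nonneg (incrementCorr_rpow_nonneg hr hh _)]
  rw [integral_incrementCorr, integral_secondDifference hw hh.le hhL, abs_of_pos hh]
  gcongr
  calc _ ≤ ∫ s in (0 : ℝ)..h, (2 * L + 1) ^ r * h := by
        refine intervalIntegral.integral_mono_on hh.le
          (Continuous.intervalIntegrable ?_ _ _) (by simp) fun s hs => ?_
        · exact (hw.comp (continuous_add_const L)).sub (hw.comp (continuous_add_const (L - h)))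
        · have := rpow_sub_rpow_le (L := L) hr (x := s + (L - h)) (y := s + L)
            (by linarith [hs.1]) (by linarith) (by linarith [hs.2])
          rw [abs_of_nonneg (by linarith [hs.1]), abs_of_nonneg (by linarith [hs.1])]
          have e : s + L - (s + (L - h)) = h := by ring
          rwa [e] at this
    _ = _ := by rw [intervalIntegral.integral_const, smul_eq_mul]; ring

lemma le_integral_incrementCorr_rpow (hr : 1 ≤ r) (hh : 0 < h) :
    h / 2 ≤ ∫ s in (0 : ℝ)..h, |incrementCorr (fun x => |x| ^ r) h s| := by
  have hw := continuous_abs_rpow (r := r) (by linarith)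
  simp_rw [abs_of_nonneg (incrementCorr_rpow_nonneg hr hh _)]
  rw [integral_incrementCorr, integral_secondDifference hw hh.le le_rfl, abs_of_pos hh]
  have hp : 0 < h ^ r := Real.rpow_pos_of_pos hh r
  have h1 : h * h ^ r ≤ ∫ s in (0 : ℝ)..h, (|s + h| ^ r - |s + (h - h)| ^ r) := by
    calc h * h ^ r = ∫ s in (0 : ℝ)..h, h ^ r := by
          rw [intervalIntegral.integral_const, smul_eq_mul]; ring
      _ ≤ _ := by
        refine intervalIntegral.integral_mono_on hh.le (by simp)
          (Continuous.intervalIntegrable ?_ _ _) fun s hs => ?_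
        · exact (hw.comp (continuous_add_const h)).sub (hw.comp (continuous_add_const (h - h)))
        · rw [abs_of_nonneg (by linarith [hs.1]), sub_self, add_zero, abs_of_nonneg hs.1]
          have := Real.add_rpow_le_rpow_add hs.1 hh.le hr
          linarith
  calc h / 2 = h * h ^ r / (2 * h ^ r) := by field_simp
    _ ≤ _ := by gcongr

lemma div_le_incrementCorr_sq {s : ℝ} (hh : 0 < h) (hs : h ≤ s) :
    h / 64 * s⁻¹ ≤ incrementCorr (fun x => |x| ^ (3 / 2 : ℝ)) h s ^ 2 := by
  have hs0 : 0 < s := hh.trans_le hs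
  have ht1 : h / s ≤ 1 := (div_le_one hs0).2 hs
  have k := two_add_sq_div_four_le (t := h / s) (by positivity) ht1
  have hsp : 0 < s ^ (3 / 2 : ℝ) := Real.rpow_pos_of_pos hs0 _
  have hhp : 0 < h ^ (3 / 2 : ℝ) := Real.rpow_pos_of_pos hh _
  have e1 : (s + h) ^ (3 / 2 : ℝ) = s ^ (3 / 2 : ℝ) * (1 + h / s) ^ (3 / 2 : ℝ) := by
    rw [← Real.mul_rpow hs0.le (by positivity)]; congr 1; field_simp
  have e2 : (s - h) ^ (3 / 2 : ℝ) = s ^ (3 / 2 : ℝ) * (1 - h / s) ^ (3 / 2 : ℝ) := by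
    rw [← Real.mul_rpow hs0.le (by linarith)]; congr 1; field_simp
  have h1 : s ^ (3 / 2 : ℝ) * ((h / s) ^ 2 / 4) / (2 * h ^ (3 / 2 : ℝ)) ≤
      incrementCorr (fun x => |x| ^ (3 / 2 : ℝ)) h s := by
    rw [incrementCorr, abs_abs, abs_abs, abs_abs, abs_of_nonneg (by linarith : 0 ≤ s + h),
      abs_of_nonneg (by linarith : 0 ≤ s - h), abs_of_pos hs0, abs_of_pos hh, e1, e2]
    gcongr
    nlinarith
  have sq3 : ∀ {x : ℝ}, 0 ≤ x → (x ^ (3 / 2 : ℝ)) ^ 2 = x ^ 3 := fun {x} hx => by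
    rw [rpow_three_halves hx, ← pow_mul, mul_comm 3 2, pow_mul, Real.sq_sqrt hx]
  refine le_trans (le_of_eq ?_) (pow_le_pow_left₀ (by positivity) h1 2)
  rw [div_pow, mul_pow, mul_pow, sq3 hs0.le, sq3 hh.le]
  field_simp
  norm_num

/-- Increment variances `h ↦ h ^ r` with `1 < r ≤ 3 / 2`. -/
lemma eventually_integral_abs_incrementCorr_rpow_le (hr : 1 < r) (hr2 : r ≤ 3 / 2) (hL : 0 < L)
    {η : ℝ} (hη : 0 < η) :
    ∀ᶠ h in 𝓝[>] (0 : ℝ),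
      0 < ∫ s in (0 : ℝ)..(L / 2), incrementCorr (fun x => |x| ^ r) h s ^ 2 ∧
      ∫ s in (0 : ℝ)..L, |incrementCorr (fun x => |x| ^ r) h s| ≤
        η * √(∫ s in (0 : ℝ)..(L / 2), incrementCorr (fun x => |x| ^ r) h s ^ 2) := by
  have hw := continuous_abs_rpow (r := r) (by linarith)
  set K := (2 * L + 1) ^ r with hK
  have hK0 : 0 < K := Real.rpow_pos_of_pos (by linarith) r
  have hlow : ∀ h ∈ Ioc 0 (L / 2), √h / 2 ≤
      √(∫ s in (0 : ℝ)..(L / 2), incrementCorr (fun x => |x| ^ r) h s ^ 2) := fun h hh => by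
    have hc := continuous_incrementCorr hw h
    have b1 := intervalIntegral_abs_le_sqrt hc hh.1.le
    have b2 := Real.sqrt_le_sqrt (intervalIntegral_sq_mono hc hh.1.le hh.2)
    have b3 := le_integral_incrementCorr_rpow hr.le hh.1
    have hs : 0 < √h := Real.sqrt_pos.2 hh.1
    have b4 : √h * (√h / 2) ≤ √h * √(∫ s in (0 : ℝ)..h, incrementCorr (fun x => |x| ^ r) h s ^ 2) := by
      calc _ = h / 2 := by rw [← mul_div_assoc, Real.mul_self_sqrt hh.1.le]
        _ ≤ _ := b3.trans b1
    exact (le_of_mul_le_mul_left b4 hs).trans b2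
  have hpos : ∀ h ∈ Ioc 0 (L / 2),
      0 < ∫ s in (0 : ℝ)..(L / 2), incrementCorr (fun x => |x| ^ r) h s ^ 2 := fun h hh => by
    have := hlow h hh
    have hs : 0 < √h := Real.sqrt_pos.2 hh.1
    exact Real.sqrt_pos.1 (by linarith)
  have hsplit : ∀ h : ℝ, 0 < h → h ^ 2 / h ^ r = h ^ (3 / 2 - r) * √h := fun h hh => by
    rw [Real.sqrt_eq_rpow, ← Real.rpow_add hh, ← Real.rpow_natCast, ← Real.rpow_sub hh]
    congr 1; push_cast; ring
  have hA : ∀ h ∈ Ioc 0 (L / 2), ∫ s in (0 : ℝ)..L, |incrementCorr (fun x => |x| ^ r) h s| ≤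
      K / 2 * (h ^ (3 / 2 - r) * √h) := fun h hh => by
    refine (integral_abs_incrementCorr_rpow_le hr.le hh.1 (by linarith [hh.2])).trans (le_of_eq ?_)
    rw [← hsplit h hh.1, ← hK]
    have : 0 < h ^ r := Real.rpow_pos_of_pos hh.1 r
    field_simp
  rcases hr2.lt_or_eq with hr2 | rfl
  · have ht : Tendsto (fun h : ℝ => K * h ^ (3 / 2 - r)) (𝓝[>] 0) (𝓝 0) := by
      have hc : ContinuousAt (fun h : ℝ => K * h ^ (3 / 2 - r)) 0 :=
        continuousAt_const.mul (Real.continuousAt_rpow_const 0 _ (Or.inr (by linarith)))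
      have := hc.tendsto.mono_left (nhdsWithin_le_nhds (s := Ioi (0 : ℝ)))
      rwa [Real.zero_rpow (by linarith), mul_zero] at this
    filter_upwards [Ioc_mem_nhdsGT (half_pos hL), ht.eventually_le_const hη] with h hh hη'
    refine ⟨hpos h hh, (hA h hh).trans ?_⟩
    have hp : 0 < h ^ (3 / 2 - r) := Real.rpow_pos_of_pos hh.1 _
    calc _ = (K * h ^ (3 / 2 - r)) * (√h / 2) := by ring
      _ ≤ η * _ := mul_le_mul hη' (hlow h hh) (by positivity) hη.le
  · have ht : Tendsto (fun h : ℝ => Real.log (L / 2 / h)) (𝓝[>] 0) atTop :=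
      Real.tendsto_log_atTop.comp (tendsto_inv_nhdsGT_zero.const_mul_atTop (half_pos hL))
    filter_upwards [Ioc_mem_nhdsGT (half_pos hL), ht.eventually_ge_atTop ((4 * K / η) ^ 2)]
      with h hh hlog
    refine ⟨hpos h hh, (hA h hh).trans ?_⟩
    rw [sub_self, Real.rpow_zero, one_mul]
    have hc := continuous_incrementCorr hw h
    have hB : h / 64 * Real.log (L / 2 / h) ≤
        ∫ s in (0 : ℝ)..(L / 2), incrementCorr (fun x => |x| ^ (3 / 2 : ℝ)) h s ^ 2 := by
      rw [← integral_inv_of_pos hh.1 (half_pos hL), ← intervalIntegral.integral_const_mul]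
      have h0 : (0 : ℝ) ∉ uIcc h (L / 2) := by
        rw [uIcc_of_le hh.2]; exact fun h0 => absurd h0.1 (not_le.2 hh.1)
      have h1 : ∫ s in h..(L / 2), h / 64 * s⁻¹ ≤
          ∫ s in h..(L / 2), incrementCorr (fun x => |x| ^ (3 / 2 : ℝ)) h s ^ 2 := by
        refine intervalIntegral.integral_mono_on hh.2
          ((intervalIntegral.intervalIntegrable_inv (fun s hs h' => h0 (h' ▸ hs)) continuousOn_id).const_mul _)
          ((hc.pow 2).intervalIntegrable _ _) fun s hs => ?_
        exact div_le_incrementCorr_sq hh.1 hs.1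
      have h2 := intervalIntegral.integral_add_adjacent_intervals
        ((hc.pow 2).intervalIntegrable (μ := volume) 0 h) ((hc.pow 2).intervalIntegrable h (L / 2))
      simp only [Pi.pow_apply] at h2
      have h3 : 0 ≤ ∫ s in (0 : ℝ)..h, incrementCorr (fun x => |x| ^ (3 / 2 : ℝ)) h s ^ 2 :=
        intervalIntegral.integral_nonneg hh.1.le fun _ _ => sq_nonneg _
      linarith
    calc K / 2 * √h = η * √(h / 64 * (4 * K / η) ^ 2) := by
          rw [Real.sqrt_mul (by linarith [hh.1]), Real.sqrt_sq (by positivity),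
            Real.sqrt_div hh.1.le, show (64 : ℝ) = 8 ^ 2 by norm_num, Real.sqrt_sq (by norm_num)]
          field_simp
          ring
      _ ≤ η * √(h / 64 * Real.log (L / 2 / h)) := by
          gcongr
          linarith [hh.1]
      _ ≤ _ := by gcongr
end

section

lemma memLp_abs_rpow_gaussianReal {p : ℝ} (hp : 0 < p) :
    MemLp (fun y : ℝ => |y| ^ p) 2 (gaussianReal 0 1) := by
  have hp0 : ENNReal.ofReal p ≠ 0 := by simpa using hp
  have h := (memLp_id_gaussianReal' (μ := 0) (v := 1) (2 * ENNReal.ofReal p)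
    (ENNReal.mul_ne_top (by norm_num) ENNReal.ofReal_ne_top)).norm_rpow_div (ENNReal.ofReal p)
  rw [ENNReal.mul_div_cancel_right hp0 ENNReal.ofReal_ne_top, ENNReal.toReal_ofReal hp.le] at h
  exact h

lemma integral_abs_rpow_mul_ne_zero {p : ℝ} (hp : 0 < p) :
    ∫ z : ℝ, |z| ^ p * (z ^ 2 - 1) ∂(gaussianReal 0 1) ≠ 0 := by
  intro h0
  have m2 := memLp_id_sq_sub_one_gaussianReal
  have i1 : Integrable (fun z : ℝ => |z| ^ p * (z ^ 2 - 1)) (gaussianReal 0 1) :=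
    (memLp_abs_rpow_gaussianReal hp).integrable_mul m2
  have i2 := m2.integrable (by norm_num)
  have h2 : ∫ z : ℝ, (z ^ 2 - 1) ∂(gaussianReal 0 1) = 0 := by
    have := integral_cos_mul_sq_sub_one_gaussianReal 0
    simpa using this
  have i3 : Integrable (fun z : ℝ => (|z| ^ p - 1) * (z ^ 2 - 1)) (gaussianReal 0 1) := by
    refine (i1.sub i2).congr (Eventually.of_forall fun z => ?_)
    simp only [Pi.sub_apply]; ring
  have h3 : ∫ z : ℝ, (|z| ^ p - 1) * (z ^ 2 - 1) ∂(gaussianReal 0 1) = 0 := by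
    have e : ∀ z : ℝ, (|z| ^ p - 1) * (z ^ 2 - 1) = |z| ^ p * (z ^ 2 - 1) - (z ^ 2 - 1) :=
      fun z => by ring
    simp_rw [e]
    rw [integral_sub i1 i2, h0, h2, sub_zero]
  have hsign : ∀ z : ℝ, 0 ≤ (|z| ^ p - 1) * (z ^ 2 - 1) ∧
      ((|z| ^ p - 1) * (z ^ 2 - 1) = 0 → z ∈ ({1, -1} : Set ℝ)) := fun z => by
    have hz : z ^ 2 - 1 = (|z| - 1) * (|z| + 1) := by rw [← sq_abs]; ring
    have h0 := abs_nonneg z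
    rcases lt_trichotomy |z| 1 with h | h | h
    · have h1 : |z| ^ p < 1 := Real.rpow_lt_one h0 h hp
      have h2 : z ^ 2 - 1 < 0 := by rw [hz]; exact mul_neg_of_neg_of_pos (by linarith) (by linarith)
      have h3 := mul_pos_of_neg_of_neg (sub_neg.2 h1) h2
      exact ⟨h3.le, fun h4 => absurd h4 h3.ne'⟩
    · rw [h, Real.one_rpow, sub_self, zero_mul]
      refine ⟨le_rfl, fun _ => ?_⟩
      rcases eq_or_eq_neg_of_abs_eq h with h | h <;> simp [h]
    · have h1 : 1 < |z| ^ p := Real.one_lt_rpow h hp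
      have h2 : 0 < z ^ 2 - 1 := by rw [hz]; exact mul_pos (by linarith) (by linarith)
      have h3 := mul_pos (sub_pos.2 h1) h2
      exact ⟨h3.le, fun h4 => absurd h4 h3.ne'⟩
  rw [integral_eq_zero_iff_of_nonneg (fun z => (hsign z).1) i3] at h3
  have := nullSingletonClass_gaussianReal (μ := 0) (v := 1) one_ne_zero
  have h4 : ∀ᵐ z ∂(gaussianReal 0 1), z ∉ ({1, -1} : Set ℝ) :=
    measure_eq_zero_iff_ae_notMem.1 ((Set.toFinite _).measure_zero _)
  have h5 : ∀ᵐ _ ∂(gaussianReal 0 1), False := by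
    filter_upwards [h3, h4] with z hz hz'
    exact hz' ((hsign z).2 hz)
  obtain ⟨_, h6⟩ := h5.exists
  exact h6

lemma incrementCorr_neg (v : ℝ → ℝ) (h s : ℝ) : incrementCorr v h (-s) = incrementCorr v h s := by
  simp only [incrementCorr, abs_neg]
  rw [show -s + h = -(s - h) by ring, show -s - h = -(s + h) by ring, abs_neg, abs_neg]
  ring

section kernel

variable {a b : ℝ} {f : ℝ → ℝ}

lemma integral_projIcc_sub (hab : a ≤ b) (g : ℝ → ℝ) (x : ℝ) :
    ∫ y in Ioc a b, g (x - projIcc a b hab y) = ∫ s in (x - b)..(x - a), g s := by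
  rw [← intervalIntegral.integral_comp_sub_left, intervalIntegral.integral_of_le hab]
  refine setIntegral_congr_fun measurableSet_Ioc fun y hy => ?_
  simp only [projIcc_of_mem hab (Ioc_subset_Icc_self hy)]

lemma integral_comp_projIcc (hab : a ≤ b) (g : ℝ → ℝ) :
    ∫ y in Ioc a b, g (projIcc a b hab y) = ∫ y in a..b, g y := by
  rw [intervalIntegral.integral_of_le hab]
  refine setIntegral_congr_fun measurableSet_Ioc fun y hy => ?_
  simp only [projIcc_of_mem hab (Ioc_subset_Icc_self hy)]

lemma integral_abs_kernel_le (hab : a ≤ b) (hf : Continuous f) (hfe : ∀ s, f (-s) = f s) (x : ℝ) :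
    ∫ y in Ioc a b, |f (projIcc a b hab x - projIcc a b hab y)| ≤
      2 * ∫ s in (0 : ℝ)..(b - a), |f s| := by
  have hx := (projIcc a b hab x).2
  set z : ℝ := ((projIcc a b hab x : Icc a b) : ℝ)
  have hi : ∀ p q : ℝ, IntervalIntegrable (fun s => |f s|) volume p q := fun p q =>
    hf.abs.intervalIntegrable _ _
  rw [integral_projIcc_sub hab (fun s => |f s|)]
  have h1 : ∫ s in (z - b)..(z - a), |f s| ≤ ∫ s in (-(b - a))..(b - a), |f s| :=
    intervalIntegral.integral_mono_interval (by linarith [hx.1]) (by linarith) (by linarith [hx.2])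
      (Eventually.of_forall fun _ => abs_nonneg _) (hi _ _)
  have h2 : ∫ s in (-(b - a))..0, |f s| = ∫ s in (0 : ℝ)..(b - a), |f s| := by
    have := intervalIntegral.integral_comp_neg (a := 0) (b := b - a) (fun s => |f s|)
    simp only [hfe, neg_zero] at this
    exact this.symm
  have h3 := intervalIntegral.integral_add_adjacent_intervals (hi (-(b - a)) 0) (hi 0 (b - a))
  linarith

lemma le_integral_sq_kernel (hab : a ≤ b) (hf : Continuous f) (hfe : ∀ s, f (-s) = f s)
    (hb : ∀ x y, |f (projIcc a b hab x - projIcc a b hab y)| ≤ 1) :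
    (b - a) * ∫ s in (0 : ℝ)..((b - a) / 2), f s ^ 2 ≤
      ∫ q : ℝ × ℝ, f (projIcc a b hab q.1 - projIcc a b hab q.2) ^ 2
        ∂((volume.restrict (Ioc a b)).prod (volume.restrict (Ioc a b))) := by
  have hpc : Continuous fun x => (projIcc a b hab x : ℝ) := continuous_subtype_val.comp continuous_projIcc
  have hi : Integrable (fun q : ℝ × ℝ => f (projIcc a b hab q.1 - projIcc a b hab q.2) ^ 2)
      ((volume.restrict (Ioc a b)).prod (volume.restrict (Ioc a b))) := by
    refine Integrable.of_bound (Continuous.aestronglyMeasurable ?_) 1 (Eventually.of_forall fun q => ?_)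
    · exact (hf.comp ((hpc.comp continuous_fst).sub (hpc.comp continuous_snd))).pow 2
    · rw [Real.norm_eq_abs, abs_pow]
      exact pow_le_one₀ (abs_nonneg _) (hb _ _)
  rw [integral_prod _ hi]
  have i1 : ∀ p q : ℝ, IntervalIntegrable (fun s => f s ^ 2) volume p q := fun p q =>
    (hf.pow 2).intervalIntegrable _ _
  calc _ = ∫ _ in Ioc a b, ∫ s in (0 : ℝ)..((b - a) / 2), f s ^ 2 := by
        simp [hab]
    _ ≤ _ := by
        refine integral_mono (integrable_const _) hi.integral_prod_left fun x => ?_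
        dsimp only
        have hx := (projIcc a b hab x).2
        set z : ℝ := ((projIcc a b hab x : Icc a b) : ℝ)
        rw [integral_projIcc_sub hab (fun s => f s ^ 2)]
        rcases le_total ((b - a) / 2) (z - a) with h | h
        · exact intervalIntegral.integral_mono_interval (by linarith [hx.2]) (by linarith) h
            (Eventually.of_forall fun _ => sq_nonneg _) (i1 _ _)
        · have h2 : ∫ s in (-((b - a) / 2))..0, f s ^ 2 = ∫ s in (0 : ℝ)..((b - a) / 2), f s ^ 2 := by
            have := intervalIntegral.integral_comp_neg (a := 0) (b := (b - a) / 2) (fun s => f s ^ 2)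
            simp only [hfe, neg_zero] at this
            exact this.symm
          rw [← h2]
          exact intervalIntegral.integral_mono_interval (by linarith [hx.1]) (by linarith)
            (by linarith [hx.1]) (Eventually.of_forall fun _ => sq_nonneg _) (i1 _ _)

end kernel
end

section

variable {Ω : Type*} [MeasurableSpace Ω] {μ : Measure Ω} [IsProbabilityMeasure μ]
  {a b ε : ℝ} {hle : a ≤ b + ε} {G : Icc a (b + ε) → Ω → ℝ} {v : ℝ → ℝ}

lemma measurable_abs_rpow (p : ℝ) : Measurable fun y : ℝ => |y| ^ p := measurable_id.abs.pow_const p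

/-- The normalized increment of length `h` at the point of `[a, b]` closest to `x`. -/
noncomputable def clampedIncrement (hle : a ≤ b + ε) (hab : a ≤ b) (G : Icc a (b + ε) → Ω → ℝ)
    (v : ℝ → ℝ) (h x : ℝ) (ω : Ω) : ℝ :=
  (IccExtend hle G (projIcc a b hab x + h) ω - IccExtend hle G (projIcc a b hab x) ω) / √(v h)

lemma measurable_IccExtend (hm : Measurable (fun z : Icc a (b + ε) × Ω => G z.1 z.2))
    {T : Type*} [MeasurableSpace T] {f : T → ℝ} (hf : Measurable f) :
    Measurable (fun q : T × Ω => IccExtend hle G (f q.1) q.2) := by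
  have h1 : Measurable (fun q : T × Ω => (projIcc a (b + ε) hle (f q.1), q.2)) :=
    (((continuous_projIcc (h := hle)).measurable.comp hf).comp measurable_fst).prodMk measurable_snd
  exact hm.comp h1

lemma measurable_clampedIncrement (hab : a ≤ b)
    (hm : Measurable (fun z : Icc a (b + ε) × Ω => G z.1 z.2)) (h : ℝ) :
    Measurable (fun q : ℝ × Ω => clampedIncrement hle hab G v h q.1 q.2) := by
  have hp : Measurable fun x => (projIcc a b hab x : ℝ) :=
    (continuous_subtype_val.comp continuous_projIcc).measurable
  exact ((measurable_IccExtend hm (hp.add_const h)).sub (measurable_IccExtend hm hp)).div_const _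

lemma isGaussianProcess_clampedIncrement (hab : a ≤ b) (hG : IsGaussianProcess G μ) (h : ℝ) :
    IsGaussianProcess (clampedIncrement hle hab G v h) μ := by
  classical
  refine hG.of_isGaussianProcess fun x => ?_
  set p := projIcc a (b + ε) hle (projIcc a b hab x + h)
  set q := projIcc a (b + ε) hle (projIcc a b hab x)
  refine ⟨{p, q}, (√(v h))⁻¹ • (ContinuousLinearMap.proj ⟨p, by simp⟩ -
    ContinuousLinearMap.proj ⟨q, by simp⟩), fun ω => ?_⟩
  simp [clampedIncrement, IccExtend, div_eq_inv_mul, p, q]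

lemma integral_clampedIncrement (hab : a ≤ b) (hG : IsGaussianProcess G μ)
    (h0 : ∀ x, ∫ ω, G x ω ∂μ = 0) (h x : ℝ) : ∫ ω, clampedIncrement hle hab G v h x ω ∂μ = 0 := by
  have hi : ∀ x, Integrable (G x) μ := fun x => (hG.hasGaussianLaw_eval x).integrable
  simp only [clampedIncrement, IccExtend, Function.comp_apply]
  rw [integral_div, integral_sub (hi _) (hi _), h0, h0]
  simp

lemma isGaussianField_clampedIncrement (hab : a ≤ b)
    (hm : Measurable (fun z : Icc a (b + ε) × Ω => G z.1 z.2)) (hG : IsGaussianProcess G μ)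
    (h0 : ∀ x, ∫ ω, G x ω ∂μ = 0) (h : ℝ) :
    IsGaussianField (clampedIncrement hle hab G v h) (fun x y => ∫ ω,
      clampedIncrement hle hab G v h x ω * clampedIncrement hle hab G v h y ω ∂μ) μ :=
  (isGaussianProcess_clampedIncrement hab hG h).isGaussianField (measurable_clampedIncrement hab hm h)
    (integral_clampedIncrement hab hG h0 h)

lemma integral_increment_mul (hG : IsGaussianProcess G μ)
    (hv : ∀ x y : Icc a (b + ε), ∫ ω, (G x ω - G y ω) ^ 2 ∂μ = v |(x : ℝ) - (y : ℝ)|)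
    (x x' y y' : Icc a (b + ε)) :
    ∫ ω, (G x' ω - G x ω) * (G y' ω - G y ω) ∂μ =
      (v |(x' : ℝ) - y| + v |(x : ℝ) - y'| - v |(x' : ℝ) - y'| - v |(x : ℝ) - y|) / 2 := by
  have hL : ∀ x, MemLp (G x) 2 μ := fun x => (hG.hasGaussianLaw_eval x).memLp_two
  have hi : ∀ x y, Integrable (fun ω => (G x ω - G y ω) ^ 2) μ := fun x y =>
    ((hL x).sub (hL y)).integrable_sq
  have e : ∀ ω, (G x' ω - G x ω) * (G y' ω - G y ω) = ((G x' ω - G y ω) ^ 2 + (G x ω - G y' ω) ^ 2 -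
      ((G x' ω - G y' ω) ^ 2 + (G x ω - G y ω) ^ 2)) / 2 := fun ω => by ring
  have i1 : ∀ x y x' y', Integrable (fun ω => (G x ω - G y ω) ^ 2 + (G x' ω - G y' ω) ^ 2) μ :=
    fun x y x' y' => (hi x y).add (hi x' y')
  simp_rw [e]
  rw [integral_div, integral_sub (i1 _ _ _ _) (i1 _ _ _ _), integral_add (hi _ _) (hi _ _),
    integral_add (hi _ _) (hi _ _)]
  simp only [hv]
  ring

lemma cov_clampedIncrement (hab : a ≤ b) (hG : IsGaussianProcess G μ)
    (hv : ∀ x y : Icc a (b + ε), ∫ ω, (G x ω - G y ω) ^ 2 ∂μ = v |(x : ℝ) - (y : ℝ)|) {h : ℝ}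
    (hh : h ∈ Ioc 0 ε) (hvh : 0 < v h) (x y : ℝ) :
    ∫ ω, clampedIncrement hle hab G v h x ω * clampedIncrement hle hab G v h y ω ∂μ =
      incrementCorr v h (projIcc a b hab x - projIcc a b hab y) := by
  have hx := (projIcc a b hab x).2
  have hy := (projIcc a b hab y).2
  simp only [clampedIncrement, IccExtend, Function.comp_apply]
  set s : ℝ := ((projIcc a b hab x : Icc a b) : ℝ)
  set t : ℝ := ((projIcc a b hab y : Icc a b) : ℝ)
  have e : ∀ A B : ℝ, A / √(v h) * (B / √(v h)) = A * B / v h := fun A B => by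
    rw [div_mul_div_comm, Real.mul_self_sqrt hvh.le]
  simp_rw [e]
  have m : ∀ z, z ∈ Icc a b → z ∈ Icc a (b + ε) ∧ z + h ∈ Icc a (b + ε) := fun z hz =>
    ⟨⟨hz.1, by linarith [hz.2, hh.1, hh.2]⟩, ⟨by linarith [hz.1, hh.1], by linarith [hz.2, hh.2]⟩⟩
  rw [integral_div, integral_increment_mul hG hv]
  simp only [projIcc_of_mem hle (m s hx).1, projIcc_of_mem hle (m s hx).2,
    projIcc_of_mem hle (m t hy).1, projIcc_of_mem hle (m t hy).2, incrementCorr]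
  rw [show s + h - t = s - t + h by ring, show s - (t + h) = s - t - h by ring,
    show s + h - (t + h) = s - t by ring]
  field_simp
  ring

lemma measurable_centeredFunctional (hab : a ≤ b)
    (hm : Measurable (fun z : Icc a (b + ε) × Ω => G z.1 z.2)) (p h : ℝ) :
    Measurable (GaussianIncrements.centeredFunctional hle G v p h) := by
  unfold GaussianIncrements.centeredFunctional GaussianIncrements.powerFunctional
  refine Measurable.sub_const ?_ _
  simp_rw [intervalIntegral.integral_of_le hab]
  have hp : Measurable (fun q : ℝ × Ω =>
      |(IccExtend hle G (q.1 + h) q.2 - IccExtend hle G q.1 q.2) / √(v h)| ^ p) := by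
    have h1 := measurable_IccExtend (hle := hle) hm (measurable_id.add_const h)
    have h2 := measurable_IccExtend (hle := hle) hm measurable_id
    exact ((h1.sub h2).div_const _).abs.pow_const p
  exact (hp.stronglyMeasurable.integral_prod_left' (μ := volume.restrict (Ioc a b))).measurable

lemma centeredFunctional_ae_eq (hab : a ≤ b) {p : ℝ} (hp : 0 < p) {h : ℝ} {R : ℝ → ℝ → ℝ}
    (hF : IsGaussianField (clampedIncrement hle hab G v h) R μ) (hR : ∀ x, R x x = 1) :
    GaussianIncrements.centeredFunctional hle G v p h =ᵐ[μ]
      normalizedFunctional (volume.restrict (Ioc a b)) (clampedIncrement hle hab G v h)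
        (fun y => |y| ^ p) := by
  filter_upwards [(hF.ae_integrable_apply (ν := volume.restrict (Ioc a b)) hR
    (measurable_abs_rpow p) (memLp_abs_rpow_gaussianReal hp)).2] with ω hω
  rw [normalizedFunctional, integral_sub hω (integrable_const _)]
  simp only [GaussianIncrements.centeredFunctional, GaussianIncrements.powerFunctional,
    GaussianIncrements.normalAbsMoment, clampedIncrement]
  rw [integral_comp_projIcc hab
    (fun x => |(IccExtend hle G (x + h) ω - IccExtend hle G x ω) / √(v h)| ^ p)]
  simp [hab, mul_comm]

/-- The central limit theorem, given a continuous version `w` of the increment variance whose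
correlations satisfy the smallness criterion. -/
theorem tendstoInDistribution_centeredFunctional (hab : a < b) (hε : 0 < ε)
    (hm : Measurable (fun z : Icc a (b + ε) × Ω => G z.1 z.2)) (hG : IsGaussianProcess G μ)
    (h0 : ∀ x, ∫ ω, G x ω ∂μ = 0)
    (hv : ∀ x y : Icc a (b + ε), ∫ ω, (G x ω - G y ω) ^ 2 ∂μ = v |(x : ℝ) - (y : ℝ)|)
    {w : ℝ → ℝ} (hw : Continuous w) {M : ℝ} (hM : b - a < M) (hvw : ∀ s ∈ Icc 0 M, v s = w s)
    (hpos : ∀ᶠ h in 𝓝[>] (0 : ℝ), 0 < v h)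
    (hsmall : ∀ η : ℝ, 0 < η → ∀ᶠ h in 𝓝[>] (0 : ℝ),
      0 < ∫ s in (0 : ℝ)..((b - a) / 2), incrementCorr w h s ^ 2 ∧
      ∫ s in (0 : ℝ)..(b - a), |incrementCorr w h s| ≤
        η * √(∫ s in (0 : ℝ)..((b - a) / 2), incrementCorr w h s ^ 2))
    {p : ℝ} (hp : 0 < p) :
    TendstoInDistribution
      (fun (h : ℝ) (ω : Ω) => GaussianIncrements.centeredFunctional hle G v p h ω /
          √(variance (GaussianIncrements.centeredFunctional hle G v p h) μ))
      (𝓝[>] (0 : ℝ)) (fun y : ℝ => y) (fun _ => μ) (gaussianReal 0 1) := by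
  have hmeas : ∀ h, Measurable fun ω => GaussianIncrements.centeredFunctional hle G v p h ω /
      √(variance (GaussianIncrements.centeredFunctional hle G v p h) μ) := fun h =>
    (measurable_centeredFunctional hab.le hm p h).div_const _
  refine ⟨fun h => (hmeas h).aemeasurable, by fun_prop, ?_⟩
  have hchar : ∀ t : ℝ, Tendsto (fun h => charFun (μ.map fun ω =>
      GaussianIncrements.centeredFunctional hle G v p h ω /
        √(variance (GaussianIncrements.centeredFunctional hle G v p h) μ)) t) (𝓝[>] 0)
      (𝓝 (charFun ((gaussianReal 0 1).map fun y : ℝ => y) t)) := fun t => by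
    rw [Metric.tendsto_nhds]
    intro δ hδ
    obtain ⟨η, hη, hη'⟩ := exists_norm_charFun_normalizedFunctional_sub_le μ
      (volume.restrict (Ioc a b)) (u := fun y : ℝ => |y| ^ p) (measurable_abs_rpow p)
      (memLp_abs_rpow_gaussianReal hp) (fun y => by rw [abs_neg])
      (integral_abs_rpow_mul_ne_zero hp) t (half_pos hδ)
    have hLp : 0 < b - a := sub_pos.2 hab
    filter_upwards [hsmall (η * √(b - a) / 2) (by positivity), hpos, Ioc_mem_nhdsGT hε,
      Ioc_mem_nhdsGT (sub_pos.2 hM)] with h hs hvh hhε hhM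
    have hv0 : v 0 = 0 := by
      have := hv ⟨a, le_rfl, hle⟩ ⟨a, le_rfl, hle⟩
      simpa using this.symm
    have hF := isGaussianField_clampedIncrement (v := v) (hle := hle) hab.le hm hG h0 h
    set X := clampedIncrement hle hab.le G v h with hX
    set R : ℝ → ℝ → ℝ := fun x y => ∫ ω, X x ω * X y ω ∂μ with hRd
    have hRv : ∀ x y, R x y = incrementCorr v h (projIcc a b hab.le x - projIcc a b hab.le y) :=
      cov_clampedIncrement hab.le hG hv hhε hvh
    have hRR : ∀ x, R x x = 1 := fun x => by
      rw [hRv, sub_self, incrementCorr, zero_add, zero_sub, abs_neg, abs_zero, abs_of_pos hhε.1, hv0]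
      field_simp
      ring
    have hRw : ∀ x y, R x y = incrementCorr w h (projIcc a b hab.le x - projIcc a b hab.le y) :=
      fun x y => by
        rw [hRv]
        have hx := (projIcc a b hab.le x).2
        have hy := (projIcc a b hab.le y).2
        set s : ℝ := ((projIcc a b hab.le x : Icc a b) : ℝ)
        set t : ℝ := ((projIcc a b hab.le y : Icc a b) : ℝ)
        have hst : |s - t| ≤ b - a := abs_le.2 ⟨by linarith [hx.1, hy.2], by linarith [hx.2, hy.1]⟩
        have h1 := abs_add_le (s - t) h
        have h2 := abs_sub (s - t) h
        rw [abs_of_pos hhε.1] at h1 h2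
        simp only [incrementCorr]
        rw [hvw _ ⟨abs_nonneg _, by linarith [hhM.2]⟩, hvw _ ⟨abs_nonneg _, by linarith [hhM.2]⟩,
          hvw _ ⟨abs_nonneg (s - t), by linarith⟩, hvw h ⟨hhε.1.le, by linarith [hhM.2]⟩]
    have hρc := continuous_incrementCorr hw h
    have hρe := incrementCorr_neg w h
    set A := 2 * ∫ s in (0 : ℝ)..(b - a), |incrementCorr w h s| with hA
    have hA0 : 0 ≤ A := mul_nonneg zero_le_two
      (intervalIntegral.integral_nonneg hLp.le fun _ _ => abs_nonneg _)
    have hAR : ∀ x, ∫ y in Ioc a b, |R x y| ≤ A := fun x => by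
      simp_rw [hRw]
      exact integral_abs_kernel_le hab.le hρc hρe x
    have hVR := le_integral_sq_kernel hab.le hρc hρe fun x y => by
      rw [← hRw]; exact hF.abs_cov_le_one (hRR x) (hRR y)
    simp_rw [← hRw] at hVR
    set B := ∫ s in (0 : ℝ)..((b - a) / 2), incrementCorr w h s ^ 2
    set V := ∫ q : ℝ × ℝ, R q.1 q.2 ^ 2 ∂((volume.restrict (Ioc a b)).prod (volume.restrict (Ioc a b)))
    have hAV : A ≤ η * √V := by
      calc A ≤ 2 * (η * √(b - a) / 2 * √B) := by
            rw [hA]; exact mul_le_mul_of_nonneg_left hs.2 zero_le_two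
        _ = η * √((b - a) * B) := by rw [Real.sqrt_mul hLp.le]; ring
        _ ≤ _ := mul_le_mul_of_nonneg_left (Real.sqrt_le_sqrt hVR) hη.le
    have hmain := hη' X R A hF hRR hA0 hAR (lt_of_lt_of_le (mul_pos hLp hs.1) hVR) hAV
    have hae : GaussianIncrements.centeredFunctional hle G v p h =ᵐ[μ]
        normalizedFunctional (volume.restrict (Ioc a b)) X (fun y => |y| ^ p) :=
      centeredFunctional_ae_eq hab.le hp hF hRR
    have hmem := (hF.normalizedFunctional_sq (ν := volume.restrict (Ioc a b)) hRR
      (measurable_abs_rpow p) (memLp_abs_rpow_gaussianReal hp)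
      (fun y => by rw [abs_neg])).1
    have hvar : variance (GaussianIncrements.centeredFunctional hle G v p h) μ =
        ∫ ω, normalizedFunctional (volume.restrict (Ioc a b)) X (fun y => |y| ^ p) ω ^ 2 ∂μ := by
      rw [variance_congr hae, variance_of_integral_eq_zero hmem.aestronglyMeasurable.aemeasurable
        (hF.integral_normalizedFunctional hRR (measurable_abs_rpow p)
          (memLp_abs_rpow_gaussianReal hp))]
    rw [Measure.map_id', charFun_apply_real, charFun_apply_real, integral_cexp_gaussianReal,
      integral_map (hmeas h).aemeasurable (by fun_prop), dist_eq_norm, hvar]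
    refine lt_of_le_of_lt (le_of_eq ?_) (hmain.trans_lt (half_lt_self hδ))
    congr 1
    refine congrArg₂ _ (integral_congr_ae ?_) (by push_cast; rfl)
    filter_upwards [hae] with ω hω
    rw [hω]
    congr 1
    push_cast
    ring
  refine tendsto_of_seq_tendsto fun x hx => ?_
  refine ProbabilityMeasure.tendsto_iff_tendsto_charFun.2 fun t => ?_
  exact (hchar t).comp hx
end

section

variable {Ω : Type*} [MeasurableSpace Ω] {μ : Measure Ω} [IsProbabilityMeasure μ]
  {a b ε : ℝ} {hle : a ≤ b + ε} {G : Icc a (b + ε) → Ω → ℝ} {v : ℝ → ℝ}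

lemma incrementVariance_eq (hv : ∀ x y : Icc a (b + ε),
    ∫ ω, (G x ω - G y ω) ^ 2 ∂μ = v |(x : ℝ) - (y : ℝ)|) {s t : ℝ} (hs : 0 ≤ s) (ht : 0 ≤ t)
    (hst : s + t ≤ b - a + ε) :
    ∫ ω, (G ⟨a + (s + t), by linarith, by linarith⟩ ω - G ⟨a + t, by linarith, by linarith⟩ ω) ^ 2 ∂μ
      = v s := by
  rw [hv]
  congr 1
  rw [show a + (s + t) - (a + t) = s by ring, abs_of_nonneg hs]

lemma incrementVariance_nonneg (hv : ∀ x y : Icc a (b + ε),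
    ∫ ω, (G x ω - G y ω) ^ 2 ∂μ = v |(x : ℝ) - (y : ℝ)|) {s : ℝ} (hs : s ∈ Icc 0 (b - a + ε)) :
    0 ≤ v s := by
  rw [← incrementVariance_eq hv hs.1 le_rfl (by linarith [hs.2])]
  exact integral_nonneg fun _ => sq_nonneg _

lemma incrementVariance_add_le (hG : IsGaussianProcess G μ) (hv : ∀ x y : Icc a (b + ε),
    ∫ ω, (G x ω - G y ω) ^ 2 ∂μ = v |(x : ℝ) - (y : ℝ)|) {s t : ℝ} (hs : 0 ≤ s) (ht : 0 ≤ t)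
    (hst : s + t ≤ b - a + ε) : v (s + t) ≤ 2 * v s + 2 * v t := by
  have hi : ∀ x y, Integrable (fun ω => (G x ω - G y ω) ^ 2) μ := fun x y =>
    ((hG.hasGaussianLaw_eval x).memLp_two.sub (hG.hasGaussianLaw_eval y).memLp_two).integrable_sq
  have e1 := incrementVariance_eq hv hs ht hst
  have e2 := incrementVariance_eq hv ht le_rfl (by linarith)
  have e3 := incrementVariance_eq hv (add_nonneg hs ht) le_rfl (by linarith)
  simp only [add_zero] at e2 e3
  rw [← e1, ← e2, ← e3, ← integral_const_mul, ← integral_const_mul,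
    ← integral_add ((hi _ _).const_mul 2) ((hi _ _).const_mul 2)]
  refine integral_mono (hi _ _) (((hi _ _).const_mul 2).add ((hi _ _).const_mul 2)) fun ω => ?_
  dsimp only
  nlinarith [sq_nonneg ((G ⟨a + (s + t), by linarith, by linarith⟩ ω -
    G ⟨a + t, by linarith, by linarith⟩ ω) - (G ⟨a + t, by linarith, by linarith⟩ ω -
    G ⟨a, by linarith, by linarith⟩ ω))]

lemma exists_incrementVariance_pos (hG : IsGaussianProcess G μ) (hv : ∀ x y : Icc a (b + ε),
    ∫ ω, (G x ω - G y ω) ^ 2 ∂μ = v |(x : ℝ) - (y : ℝ)|) (hne : ∃ h ∈ Icc 0 (b - a + ε), v h ≠ 0)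
    {L : ℝ} (hL : 0 < L) (hLb : L ≤ b - a + ε) (v0 : v 0 = 0) : ∃ q ∈ Ioc 0 L, 0 < v q := by
  by_contra! hcon
  have hz : ∀ s ∈ Icc 0 L, v s = 0 := fun s hs => by
    rcases hs.1.eq_or_lt with rfl | h
    · exact v0
    · exact le_antisymm (hcon s ⟨h, hs.2⟩) (incrementVariance_nonneg hv ⟨hs.1, hs.2.trans hLb⟩)
  have hall : ∀ n : ℕ, ∀ s ∈ Icc 0 (b - a + ε), s ≤ n * L → v s = 0 := fun n => by
    induction n with
    | zero =>
      intro s hs h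
      rw [Nat.cast_zero, zero_mul] at h
      rw [le_antisymm h hs.1, v0]
    | succ n ih =>
      intro s hs h
      push_cast at h
      rcases le_total s L with h1 | h1
      · exact hz s ⟨hs.1, h1⟩
      · have h2 := incrementVariance_add_le hG hv (s := s - L) (t := L) (by linarith) hL.le
          (by linarith [hs.2])
        rw [sub_add_cancel, ih (s - L) ⟨by linarith, by linarith [hs.2]⟩ (by linarith),
          hz L ⟨hL.le, le_rfl⟩] at h2
        exact le_antisymm (by linarith) (incrementVariance_nonneg hv hs)
  obtain ⟨h, hh, hne⟩ := hne
  obtain ⟨n, hn⟩ := exists_nat_ge (h / L)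
  exact hne (hall n h hh ((div_le_iff₀ hL).1 hn))

lemma tendsto_incrementVariance (hab : a < b) (hε : 0 < ε) (hle : a ≤ b + ε)
    (hm : Measurable (fun z : Icc a (b + ε) × Ω => G z.1 z.2)) (hG : IsGaussianProcess G μ)
    (h0 : ∀ x, ∫ ω, G x ω ∂μ = 0) (hv : ∀ x y : Icc a (b + ε),
      ∫ ω, (G x ω - G y ω) ^ 2 ∂μ = v |(x : ℝ) - (y : ℝ)|) : Tendsto v (𝓝[>] 0) (𝓝 0) := by
  have hF := hG.isGaussianField hm h0
  have hcos : ∀ x y : Icc a (b + ε), ∫ ω, Real.cos (G x ω - G y ω) ∂μ =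
      Real.exp (-(v |(x : ℝ) - y|) / 2) := fun x y => by
    have hL : ∀ x, MemLp (G x) 2 μ := fun x => (hG.hasGaussianLaw_eval x).memLp_two
    have i : ∀ x y, Integrable (fun ω => G x ω * G y ω) μ := fun x y => (hL x).integrable_mul (hL y)
    have h1 := hF.integral_cos_pair x y 1 (-1)
    have e : ∀ ω, 1 * G x ω + -1 * G y ω = G x ω - G y ω := fun ω => by ring
    simp_rw [e] at h1
    rw [h1, ← hv]
    congr 3
    have e2 : ∀ ω, (G x ω - G y ω) ^ 2 = G x ω * G x ω - 2 * (G x ω * G y ω) + G y ω * G y ω :=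
      fun ω => by ring
    have i2 : Integrable (fun ω => G x ω * G x ω - 2 * (G x ω * G y ω)) μ :=
      (i x x).sub ((i x y).const_mul 2)
    simp_rw [e2]
    rw [integral_add i2 (i y y), integral_sub (i x x) ((i x y).const_mul 2), integral_const_mul]
    ring
  refine tendsto_increment_variance (G := fun x ω => IccExtend hle G x ω) (μ := μ)
    (measurable_IccExtend hm measurable_id) hab hε fun h hh x hx => ?_
  have m1 : x ∈ Icc a (b + ε) := ⟨hx.1, by linarith [hx.2]⟩
  have m2 : x + h ∈ Icc a (b + ε) := ⟨by linarith [hx.1, hh.1], by linarith [hx.2, hh.2]⟩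
  rw [IccExtend_of_mem hle G m1, IccExtend_of_mem hle G m2, hcos, add_sub_cancel_left,
    abs_of_pos hh.1]

/-- A concave increment variance has a continuous extension from a neighbourhood of `[0, L]`. -/
lemma ConcaveOn.exists_continuous_eqOn {N M : ℝ} (hconc : ConcaveOn ℝ (Icc 0 N) v) (hM : 0 < M)
    (hMN : M < N) (h0 : Tendsto v (𝓝[>] 0) (𝓝 (v 0))) :
    ∃ w : ℝ → ℝ, Continuous w ∧ ∀ s ∈ Icc 0 M, v s = w s := by
  have hc : ContinuousOn v (Icc 0 M) := fun s hs => by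
    rcases hs.1.eq_or_lt with rfl | h
    · have h1 : ContinuousWithinAt v (Ici 0) 0 :=
        continuousWithinAt_Ioi_iff_Ici.1 h0
      exact h1.mono Icc_subset_Ici_self
    · have h1 := hconc.continuousOn_interior
      rw [interior_Icc] at h1
      exact (h1.continuousAt (Ioo_mem_nhds h (hs.2.trans_lt hMN))).continuousWithinAt
  refine ⟨IccExtend hM.le ((Icc 0 M).domRestrict v), hc.domRestrict.Icc_extend', fun s hs => ?_⟩
  rw [IccExtend_of_mem hM.le _ hs, domRestrict_apply]

end

theorem corollary1p1 {Ω : Type*} [MeasurableSpace Ω] (μ : Measure Ω) [IsProbabilityMeasure μ]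
    (a b ε : ℝ) (hab : a < b) (hε : 0 < ε) (hle : a ≤ b + ε)
    -- a mean zero, jointly measurable Gaussian process on `[a, b + ε]`
    (G : Icc a (b + ε) → Ω → ℝ)
    (hG_meas : Measurable (fun z : Icc a (b + ε) × Ω => G z.1 z.2))
    (hG_gauss : IsGaussianProcess G μ)
    (hG_mean : ∀ x, ∫ ω, G x ω ∂μ = 0)
    -- with stationary increments, whose variance function `σ²` is not identically zero
    (sigmaSq : ℝ → ℝ)
    (hG_incr : ∀ x y : Icc a (b + ε),
      ∫ ω, (G x ω - G y ω) ^ 2 ∂μ = sigmaSq |(x : ℝ) - (y : ℝ)|)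
    (hσ_ne : ∃ h ∈ Icc 0 (b - a + ε), sigmaSq h ≠ 0)
    (hσ : ConcaveOn ℝ (Icc 0 (2 * (b - a))) sigmaSq ∨
      ∃ r : ℝ, 1 < r ∧ r ≤ 3 / 2 ∧ ∀ h ∈ Icc 0 (2 * (b - a)), sigmaSq h = h ^ r)
    (p : ℝ) (hp : 1 ≤ p) :
    TendstoInDistribution
      (fun (h : ℝ) (ω : Ω) =>
        GaussianIncrements.centeredFunctional hle G sigmaSq p h ω /
          √(variance (GaussianIncrements.centeredFunctional hle G sigmaSq p h) μ))
      (𝓝[>] (0 : ℝ)) (fun y : ℝ => y) (fun _ => μ) (gaussianReal 0 1) := by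
  have hL : 0 < b - a := sub_pos.2 hab
  have hp0 : 0 < p := by linarith
  rcases hσ with hconc | ⟨r, hr1, hr2, hr⟩
  · have v0 : sigmaSq 0 = 0 := by
      have := hG_incr ⟨a, le_rfl, hle⟩ ⟨a, le_rfl, hle⟩
      simpa using this.symm
    obtain ⟨q, hq, hvq⟩ := exists_incrementVariance_pos hG_gauss hG_incr hσ_ne hL (by linarith) v0
    have ht := tendsto_incrementVariance hab hε hle hG_meas hG_gauss hG_mean hG_incr
    set M := min (3 / 2 * (b - a)) (b - a + ε) with hM
    have hM1 : M ≤ 3 / 2 * (b - a) := min_le_left _ _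
    have hM2 : M ≤ b - a + ε := min_le_right _ _
    have hLM : b - a < M := lt_min (by linarith) (by linarith)
    obtain ⟨w, hw, hvw⟩ := hconc.exists_continuous_eqOn (M := M) (by linarith) (by linarith)
      (by rwa [v0])
    have hcM : ConcaveOn ℝ (Icc 0 M) sigmaSq :=
      hconc.subset (Icc_subset_Icc_right (by linarith)) (convex_Icc _ _)
    have hcw : ConcaveOn ℝ (Icc 0 M) w := hcM.congr hvw
    have hqM : q ∈ Icc 0 M := ⟨hq.1.le, by linarith [hq.2]⟩
    refine tendstoInDistribution_centeredFunctional hab hε hG_meas hG_gauss hG_mean hG_incr hw hLM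
      hvw ?_ (fun η hη => ?_) hp0
    · filter_upwards [Ioc_mem_nhdsGT hq.1] with h hh
      have h1 := hcM.2 (show (0 : ℝ) ∈ Icc 0 M from ⟨le_rfl, by linarith⟩) hqM
        (show (0 : ℝ) ≤ 1 - h / q by
          rw [sub_nonneg, div_le_one hq.1]; exact hh.2) (div_nonneg hh.1.le hq.1.le) (by ring)
      simp only [smul_eq_mul, mul_zero, zero_add, v0] at h1
      rw [div_mul_cancel₀ _ hq.1.ne'] at h1
      exact lt_of_lt_of_le (mul_pos (div_pos hh.1 hq.1) hvq) h1
    · refine hcw.eventually_integral_abs_incrementCorr_le hw hL hLM ?_ (fun s hs => ?_) hq ?_ hη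
      · rw [← hvw 0 ⟨le_rfl, by linarith⟩, v0]
      · rw [← hvw s hs]
        exact incrementVariance_nonneg hG_incr ⟨hs.1, hs.2.trans hM2⟩
      · rwa [← hvw q hqM]
  · refine tendstoInDistribution_centeredFunctional hab hε hG_meas hG_gauss hG_mean hG_incr
      (w := fun x => |x| ^ r) (M := 2 * (b - a)) (continuous_abs_rpow (by linarith)) (by linarith)
      (fun s hs => by rw [hr s hs, abs_of_nonneg hs.1]) ?_
      (fun η hη => eventually_integral_abs_incrementCorr_rpow_le hr1 hr2 hL hη) hp0
    filter_upwards [Ioc_mem_nhdsGT hL] with h hh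
    rw [hr h ⟨hh.1.le, by linarith [hh.2]⟩]
    exact Real.rpow_pos_of_pos hh.1 r
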